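/- **Conventions.** A tangent category $(\mathbb X,\mathbb T)$ is a category with a tangent structure $\mathbb T=(T,p,z,s,l,c)$ in the sense of Cockett and Cruttwell (tangent bundle functor, projection, zero, sum, vertical lift, canonical flip; negatives are not required); its *tangent limits* are the $n$-fold pullbacks $T_nA$ of each $p_A$ along itself and the pullback squares expressing the universal property of the vertical lift. A *lax tangent morphism* $(F,\alpha)\colon(\mathbb X,\mathbb T)\to(\mathbb X',\mathbb T')$ is a functor $F$ with a natural transformation $\alpha\colon FT\Rightarrow T'F$ compatible with $p,z,s,l,c$; a *colax tangent morphism* has instead $\alpha\colon T'F\Rightarrow FT$ with the dual compatibilities (the compatibility with the sums being expressed by a morphism $T'_2F\to FT_2$ over the projections; preservation of limits is not part of this definition). A lax or colax tangent morphism is *strong* if $\alpha$ is invertible and $F$ preserves the tangent limits, and *strict* if moreover $\alpha$ is the identity. A *cloven tangent fibration* is a functor $\Pi\colon\mathbb X'\to\mathbb X$ between the underlying categories of tangent categories $(\mathbb X',\mathbb T')$ and $(\mathbb X,\mathbb T)$, with a chosen cartesian lift $\varphi^f_E\colon f^*E\to E$ for each $f\colon A\to A'$ and each $E$ over $A'$,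 such that $\Pi$ is a strict tangent morphism and $(T,T')$ is a morphism of fibrations, i.e. $T'$ preserves cartesian morphisms. A *lax (colax) morphism* $\Pi\to\Pi_\bullet$ of tangent fibrations is a pair of lax (colax) tangent morphisms $(F,\beta)$ between the bases and $(F',\beta')$ between the total categories with $\Pi_\bullet F'=F\Pi$ and $\Pi_\bullet\beta'=\beta\Pi$, such that $F'$ preserves cartesian morphisms. It is *strong* (*strict*) if $(F,\beta)$ and $(F',\beta')$ are, and *strict on the base* if $(F,\beta)$ is strict. Let $\mathsf{TNGFIB}_{\mathsf{strb}}$ and $\mathsf{TNGFIB}_{\mathsf{co},\mathsf{strb}}$ be the categories of cloven tangent fibrations and of lax, respectively colax, morphisms strict on the base. An *indexed tangent category* is a tangent category $(\mathbb X,\mathbb T)$ together with a pseudofunctor from $\mathbb X^{\mathrm{op}}$ to tangent categories and strong tangent morphisms: tangent categories $(\mathbb X^A,\mathbb T^A)$, substitution functors $f^*$ with distributive laws $\alpha^f\colon T^Af^*\Rightarrow f^*T^{A'}$ making them strong tangent morphisms, and coherent natural isomorphisms $\mathrm{id}\cong(\mathrm{id}_A)^*$, $f^*g^*\cong(gf)^*$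 compatible with the distributive laws. A *lax (colax) morphism* of indexed tangent categories consists of a lax (colax) tangent morphism $(F,\beta)$ of the bases, lax (colax) tangent morphisms $(F^A,\beta^A)\colon(\mathbb X^A,\mathbb T^A)\to(\mathbb X_\bullet^{FA},\mathbb T_\bullet^{FA})$, and natural isomorphisms (distributors) $\kappa^f\colon F^Af^*\Rightarrow(Ff)^*F^{A'}$ compatible with the identity and composition isomorphisms and such that, in the lax case, $$(Ff)^*\beta^{A'}\circ\kappa^f_{T^{A'}}\circ F^A\alpha^f=\alpha^{Ff}_{F^{A'}}\circ T^{FA}\kappa^f\circ\beta^A_{f^*},$$ and in the colax case $$\kappa^f_{T^{A'}}\circ F^A\alpha^f\circ\beta^A_{f^*}=(Ff)^*\beta^{A'}\circ\alpha^{Ff}_{F^{A'}}\circ T^{FA}\kappa^f.$$ It is *strong* (*strict*) if $(F,\beta)$ and all $(F^A,\beta^A)$ are, and *strict on the base* if $(F,\beta)$ is strict. Let $\mathsf{INDXTNG}_{\mathsf{strb}}$ and $\mathsf{INDXTNG}_{\mathsf{co},\mathsf{strb}}$ be the corresponding categories of indexed tangent categories and lax, respectively colax, morphisms strict on the base. **Proposition.**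 Every cloven tangent fibration $\Pi\colon(\mathbb X',\mathbb T')\to(\mathbb X,\mathbb T)$ has an associated indexed tangent category $\mathscr I(\Pi)$ with base $(\mathbb X,\mathbb T)$: its value at $A$ is the fibre $\Pi^{-1}A$ with tangent bundle functor $T^A=z_A^*T'$ and the structure morphisms induced from those of $\mathbb T'$ through the chosen lifts $\zeta_E\colon T^AE\to T'E$ of $z_A$, and its substitution functors are those of the cleavage, with $\alpha^f$ determined by $\zeta_E\circ\varphi^f_{T^{A'}E}\circ\alpha^f_E=T'\varphi^f_E\circ\zeta_{f^*E}$. The assignment $\Pi\mapsto\mathscr I(\Pi)$ extends to functors $$\mathscr I\colon\mathsf{TNGFIB}_{\mathsf{strb}}\to\mathsf{INDXTNG}_{\mathsf{strb}},\qquad \mathscr I\colon\mathsf{TNGFIB}_{\mathsf{co},\mathsf{strb}}\to\mathsf{INDXTNG}_{\mathsf{co},\mathsf{strb}},$$ which send $(F,\beta,F',\beta')$ to the morphism with base $(F,\beta)$, functors $F^A$ the restrictions of $F'$ to the fibres, distributors determined by $\varphi^{Ff}\circ\kappa^f=F'\varphi^f$, and distributive laws determined by $\zeta_{F'E}\circ\beta^A_E=\beta'_E\circ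 F'\zeta_E$ in the lax case and by $F'\zeta_E\circ\beta^A_E=\beta'_E\circ\zeta_{F'E}$ in the colax case. Moreover: 1. in the colax case, if $F$ and $F'$ preserve the tangent limits, then so do all $F^A$; 2. both functors send strong morphisms to strong morphisms; 3. both functors send to strict morphisms those strict morphisms whose functor $F'$ maps, for every $A$ and every $E$ over $A$, the chosen lift $\zeta_E$ of $z_A$ to the chosen lift $\zeta_{F'E}$ of $z_{FA}$ (for instance those preserving the cleavages). -/

import Mathlib

open CategoryTheory CategoryTheory.Limits

universe v u v₁ u₁ v₂ u₂ v₃ u₃ v₄ u₄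

set_option linter.checkUnivs false

namespace TangentTheory

/-! ## Additive bundles -/

section AdditiveBundles

variable {C : Type u} [Category.{v} C] {D : Type u₁} [Category.{v₁} D]

/-- `P`, with structure map `b : P ⟶ B` and projections `π i : P ⟶ E`, is an `n`-fold pullback of
`q : E ⟶ B` along itself. -/
def IsNFoldPullback {E B : C} (q : E ⟶ B) {n : ℕ} {P : C} (b : P ⟶ B)
    (π : Fin n → (P ⟶ E)) : Prop :=
  ∃ h : ∀ i, π i ≫ q = b, Nonempty (IsLimit (WidePullbackCone.mk (f := fun _ : Fin n => q) b π h))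

variable (C) in
/-- The data underlying an additive bundle: a projection `q`, a zero `z`, an object `E₂` with two
maps to `E` (to be the pullback of `q` along itself) and a sum `s`. -/
structure BundleData where
  B : C
  E : C
  E₂ : C
  q : E ⟶ B
  π₁ : E₂ ⟶ E
  π₂ : E₂ ⟶ E
  z : B ⟶ E
  s : E₂ ⟶ E

/-- The image of bundle data under a functor. -/
@[simps]
def BundleData.map (X : BundleData C) (F : C ⥤ D) : BundleData D where
  B := F.obj X.B
  E := F.obj X.E
  E₂ := F.obj X.E₂
  q := F.map X.q
  π₁ := F.map X.π₁
  π₂ := F.map X.π₂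
  z := F.map X.z
  s := F.map X.s

/-- Additive bundles: commutative monoids in a slice category, for which all `n`-fold pullbacks
of the projection exist. -/
structure BundleData.IsAdditive (X : BundleData C) : Prop where
  exists_nfold : ∀ n : ℕ, ∃ (P : C) (b : P ⟶ X.B) (π : Fin n → (P ⟶ X.E)),
    IsNFoldPullback X.q b π
  isPullback : IsPullback X.π₁ X.π₂ X.q X.q
  zero_proj : X.z ≫ X.q = 𝟙 X.B
  sum_proj : X.s ≫ X.q = X.π₁ ≫ X.q
  sum_assoc : ∀ {W : C} (a b c : W ⟶ X.E) (hab : a ≫ X.q = b ≫ X.q) (hbc : b ≫ X.q = c ≫ X.q),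
    isPullback.lift (isPullback.lift a b hab ≫ X.s) c
        (by rw [Category.assoc, sum_proj, IsPullback.lift_fst_assoc, hab, hbc]) ≫ X.s =
      isPullback.lift a (isPullback.lift b c hbc ≫ X.s)
        (by rw [Category.assoc, sum_proj, IsPullback.lift_fst_assoc, hab]) ≫ X.s
  zero_sum : isPullback.lift (X.q ≫ X.z) (𝟙 X.E)
    (by rw [Category.assoc, zero_proj, Category.comp_id, Category.id_comp]) ≫ X.s = 𝟙 X.E
  sum_comm : isPullback.lift X.π₂ X.π₁ isPullback.w.symm ≫ X.s = X.s

/-- Additive bundle morphisms `(f, g)`. The morphism `g₂ : E₂ ⟶ E₂'` is the induced morphism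
`g ×_B g`; it is unique as soon as `E₂'` is the pullback of `q'` along itself. -/
structure IsAdditiveMorphism (X Y : BundleData C) (f : X.B ⟶ Y.B) (g : X.E ⟶ Y.E) : Prop where
  proj : X.q ≫ f = g ≫ Y.q
  zero : X.z ≫ g = f ≫ Y.z
  sum : ∃ g₂ : X.E₂ ⟶ Y.E₂, g₂ ≫ Y.π₁ = X.π₁ ≫ g ∧ g₂ ≫ Y.π₂ = X.π₂ ≫ g ∧ X.s ≫ g = g₂ ≫ Y.s

end AdditiveBundles

/-! ## Tangent categories -/

section TangentStructures

variable {C : Type u} [Category.{v} C]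

/-- The `m`-th iterate of an endofunctor. -/
def iter (T : C ⥤ C) : ℕ → C ⥤ C
  | 0 => 𝟭 C
  | m + 1 => iter T m ⋙ T

/-- The data of a tangent structure with tangent bundle functor `T`. -/
structure TangentData (T : C ⥤ C) where
  /-- projection -/
  p : T ⟶ 𝟭 C
  /-- zero morphism -/
  z : 𝟭 C ⟶ T
  /-- the pullback of the projection along itself, with its two projections -/
  T₂ : C ⥤ C
  π₁ : T₂ ⟶ T
  π₂ : T₂ ⟶ T
  /-- sum morphism -/
  s : T₂ ⟶ T
  /-- vertical lift -/
  l : T ⟶ T ⋙ T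
  /-- canonical flip -/
  c : T ⋙ T ⟶ T ⋙ T

namespace TangentData

variable {T : C ⥤ C} (D : TangentData T)

/-- The bundle `(A, T A, p, z, s)`. -/
@[simps]
def bundle (A : C) : BundleData C where
  B := A
  E := T.obj A
  E₂ := D.T₂.obj A
  q := D.p.app A
  π₁ := D.π₁.app A
  π₂ := D.π₂.app A
  z := D.z.app A
  s := D.s.app A

/-- `w` is the morphism `T₂ A ⟶ T T₂ A ⟶ T² A`, the composite of `⟨π₁ l, π₂ z_T⟩` and `T s`. -/
def IsVerticalLiftMap (A : C) (w : D.T₂.obj A ⟶ T.obj (T.obj A)) : Prop :=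
  ∃ r : D.T₂.obj A ⟶ T.obj (D.T₂.obj A),
    r ≫ T.map (D.π₁.app A) = D.π₁.app A ≫ D.l.app A ∧
    r ≫ T.map (D.π₂.app A) = D.π₂.app A ≫ D.z.app (T.obj A) ∧
    w = r ≫ T.map (D.s.app A)

end TangentData

/-- A tangent structure on a category with tangent bundle functor `T`. -/
structure TangentStructure (T : C ⥤ C) extends TangentData T where
  additive : ∀ A, (toTangentData.bundle A).IsAdditive
  iter_nfold : ∀ (m n : ℕ) (A P : C) (b : P ⟶ A) (π : Fin n → (P ⟶ T.obj A)),
    IsNFoldPullback (p.app A : T.obj A ⟶ A) b π →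
    IsNFoldPullback ((iter T m).map (p.app A : T.obj A ⟶ A)) ((iter T m).map b)
      (fun i => (iter T m).map (π i))
  lift_additive : ∀ A, IsAdditiveMorphism (toTangentData.bundle A)
    ((toTangentData.bundle A).map T) (z.app A) (l.app A)
  flip_additive : ∀ A, IsAdditiveMorphism ((toTangentData.bundle A).map T)
    (toTangentData.bundle (T.obj A)) (𝟙 (T.obj A)) (c.app A)
  lift_coassoc : ∀ A, l.app A ≫ T.map (l.app A) = l.app A ≫ l.app (T.obj A)
  flip_flip : ∀ A, c.app A ≫ c.app A = 𝟙 (T.obj (T.obj A))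
  flip_braid : ∀ A,
    T.map (c.app A) ≫ c.app (T.obj A) ≫ T.map (c.app A) =
      c.app (T.obj A) ≫ T.map (c.app A) ≫ c.app (T.obj A)
  lift_flip : ∀ A, l.app A ≫ c.app A = l.app A
  lift_flip' : ∀ A,
    l.app (T.obj A) ≫ T.map (c.app A) ≫ c.app (T.obj A) = c.app A ≫ T.map (l.app A)
  lift_universal : ∀ A, ∃ w : T₂.obj A ⟶ T.obj (T.obj A), toTangentData.IsVerticalLiftMap A w ∧
    IsPullback w (π₁.app A ≫ p.app A) (T.map (p.app A)) (z.app A)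

end TangentStructures

/-- Tangent categories. -/
structure TangentCat : Type (max (u + 1) (v + 1)) where
  carrier : Type u
  [cat : Category.{v} carrier]
  T : carrier ⥤ carrier
  str : TangentStructure T

instance : CoeSort TangentCat.{v, u} (Type u) := ⟨TangentCat.carrier⟩

instance (X : TangentCat.{v, u}) : Category.{v} X := X.cat

/-! ## Tangent morphisms -/

section Morphisms

variable {X : TangentCat.{v₁, u₁}} {Y : TangentCat.{v₂, u₂}} {Z : TangentCat.{v₃, u₃}}

/-- `F` preserves the `n`-fold pullbacks of the projection along itself and the pullback expressing
the universal property of the vertical lift. -/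
structure PreservesTangentLimits (F : X ⥤ Y) : Prop where
  nfold : ∀ (n : ℕ) (A P : X) (b : P ⟶ A) (π : Fin n → (P ⟶ X.T.obj A)),
    IsNFoldPullback (X.str.p.app A : X.T.obj A ⟶ A) b π →
    IsNFoldPullback (F.map (X.str.p.app A)) (F.map b) (fun i => F.map (π i))
  vlift : ∀ (A : X) (w : X.str.T₂.obj A ⟶ X.T.obj (X.T.obj A)), X.str.IsVerticalLiftMap A w →
    IsPullback (F.map w) (F.map (X.str.π₁.app A ≫ X.str.p.app A))
      (F.map (X.T.map (X.str.p.app A))) (F.map (X.str.z.app A))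

/-- A lax distributive law `F ∘ T ⇒ T' ∘ F`, making `F` a lax tangent morphism. -/
@[ext]
structure LaxLaw (F : X ⥤ Y) where
  α : X.T ⋙ F ⟶ F ⋙ Y.T
  additive : ∀ A, IsAdditiveMorphism ((X.str.bundle A).map F) (Y.str.bundle (F.obj A))
    (𝟙 (F.obj A)) (α.app A)
  lift : ∀ A, F.map (X.str.l.app A) ≫ α.app (X.T.obj A) ≫ Y.T.map (α.app A) =
    α.app A ≫ Y.str.l.app (F.obj A)
  flip : ∀ A, F.map (X.str.c.app A) ≫ α.app (X.T.obj A) ≫ Y.T.map (α.app A) =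
    (α.app (X.T.obj A) ≫ Y.T.map (α.app A)) ≫ Y.str.c.app (F.obj A)

/-- A colax distributive law `T' ∘ F ⇒ F ∘ T`, making `F` a colax tangent morphism. Preservation
of pullbacks by `F` is not part of this structure. -/
@[ext]
structure ColaxLaw (F : X ⥤ Y) where
  β : F ⋙ Y.T ⟶ X.T ⋙ F
  additive : ∀ A, IsAdditiveMorphism (Y.str.bundle (F.obj A)) ((X.str.bundle A).map F)
    (𝟙 (F.obj A)) (β.app A)
  lift : ∀ A, Y.str.l.app (F.obj A) ≫ Y.T.map (β.app A) ≫ β.app (X.T.obj A) =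
    β.app A ≫ F.map (X.str.l.app A)
  flip : ∀ A, Y.str.c.app (F.obj A) ≫ Y.T.map (β.app A) ≫ β.app (X.T.obj A) =
    (Y.T.map (β.app A) ≫ β.app (X.T.obj A)) ≫ F.map (X.str.c.app A)

/-- Strong tangent morphisms, presented by the inverse (lax) distributive law. -/
def LaxLaw.IsStrong {F : X ⥤ Y} (L : LaxLaw F) : Prop :=
  IsIso L.α ∧ PreservesTangentLimits F

/-- Strong tangent morphisms. -/
def ColaxLaw.IsStrong {F : X ⥤ Y} (L : ColaxLaw F) : Prop :=
  IsIso L.β ∧ PreservesTangentLimits F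

/-- Strict tangent morphisms: the distributive law is the identity. -/
def LaxLaw.IsStrict {F : X ⥤ Y} (L : LaxLaw F) : Prop :=
  (∃ h : X.T ⋙ F = F ⋙ Y.T, L.α = eqToHom h) ∧ PreservesTangentLimits F

/-- Strict tangent morphisms: the distributive law is the identity. -/
def ColaxLaw.IsStrict {F : X ⥤ Y} (L : ColaxLaw F) : Prop :=
  (∃ h : F ⋙ Y.T = X.T ⋙ F, L.β = eqToHom h) ∧ PreservesTangentLimits F

end Morphisms

/-! ### Composition of tangent morphisms -/

section AdditiveLemmas

variable {C : Type u} [Category.{v} C] {D : Type u₁} [Category.{v₁} D]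

theorem IsAdditiveMorphism.refl (X : BundleData C) : IsAdditiveMorphism X X (𝟙 X.B) (𝟙 X.E) :=
  ⟨by simp, by simp, 𝟙 _, by simp, by simp, by simp⟩

theorem IsAdditiveMorphism.comp {X Y Z : BundleData C} {f : X.B ⟶ Y.B} {g : X.E ⟶ Y.E}
    {f' : Y.B ⟶ Z.B} {g' : Y.E ⟶ Z.E} (h : IsAdditiveMorphism X Y f g)
    (h' : IsAdditiveMorphism Y Z f' g') : IsAdditiveMorphism X Z (f ≫ f') (g ≫ g') := by
  obtain ⟨a, b, k, k1, k2, k3⟩ := h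
  obtain ⟨a', b', k', k1', k2', k3'⟩ := h'
  refine ⟨?_, ?_, k ≫ k', ?_, ?_, ?_⟩
  · rw [← Category.assoc, a, Category.assoc, a', Category.assoc]
  · rw [← Category.assoc, b, Category.assoc, b', Category.assoc]
  · rw [Category.assoc, k1', ← Category.assoc, k1, Category.assoc]
  · rw [Category.assoc, k2', ← Category.assoc, k2, Category.assoc]
  · rw [← Category.assoc, k3, Category.assoc, k3', Category.assoc]

theorem IsAdditiveMorphism.map {X Y : BundleData C} {f : X.B ⟶ Y.B} {g : X.E ⟶ Y.E}
    (h : IsAdditiveMorphism X Y f g) (F : C ⥤ D) :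
    IsAdditiveMorphism (X.map F) (Y.map F) (F.map f) (F.map g) := by
  obtain ⟨a, b, k, k1, k2, k3⟩ := h
  refine ⟨?_, ?_, F.map k, ?_, ?_, ?_⟩ <;> simp only [BundleData.map, ← F.map_comp, *]

theorem isNFoldPullback_iff {E B : C} {q : E ⟶ B} {n : ℕ} {P : C} {b : P ⟶ B}
    {π : Fin n → (P ⟶ E)} : IsNFoldPullback q b π ↔ (∀ i, π i ≫ q = b) ∧
      ∀ {W : C} (b' : W ⟶ B) (π' : Fin n → (W ⟶ E)), (∀ i, π' i ≫ q = b') →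
        ∃! r : W ⟶ P, r ≫ b = b' ∧ ∀ i, r ≫ π i = π' i := by
  constructor
  · rintro ⟨h, ⟨hl⟩⟩
    refine ⟨h, fun {W} b' π' h' => ⟨WidePullbackCone.IsLimit.lift hl b' π' h', ⟨?_, ?_⟩, ?_⟩⟩
    · exact WidePullbackCone.IsLimit.lift_base hl b' π' h'
    · exact WidePullbackCone.IsLimit.lift_π hl b' π' h'
    · rintro r ⟨h1, h2⟩
      refine WidePullbackCone.IsLimit.hom_ext hl ?_ ?_
      · exact h1.trans (WidePullbackCone.IsLimit.lift_base hl b' π' h').symm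
      · exact fun i => (h2 i).trans (WidePullbackCone.IsLimit.lift_π hl b' π' h' i).symm
  · rintro ⟨h, hu⟩
    refine ⟨h, ⟨WidePullbackCone.IsLimit.mk _
      (fun t => (hu t.base t.π t.condition).choose) ?_ ?_ ?_⟩⟩
    · exact fun t => (hu t.base t.π t.condition).choose_spec.1.1
    · exact fun t => (hu t.base t.π t.condition).choose_spec.1.2
    · exact fun t m h1 h2 => (hu t.base t.π t.condition).choose_spec.2 m ⟨h1, h2⟩

theorem IsNFoldPullback.of_iso {E B E' B' : C} {q : E ⟶ B} {q' : E' ⟶ B'} {n : ℕ} {P : C}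
    {b : P ⟶ B} {π : Fin n → (P ⟶ E)} (h : IsNFoldPullback q b π) (e : E ≅ E') (d : B ≅ B')
    (w : e.hom ≫ q' = q ≫ d.hom) :
    IsNFoldPullback q' (b ≫ d.hom) (fun i => π i ≫ e.hom) := by
  rw [isNFoldPullback_iff] at h ⊢
  obtain ⟨h, hu⟩ := h
  have w' : e.inv ≫ q = q' ≫ d.inv := by
    rw [Iso.inv_comp_eq, ← Category.assoc, w, Category.assoc, Iso.hom_inv_id, Category.comp_id]
  refine ⟨fun i => by rw [Category.assoc, w, ← Category.assoc, h], fun b' π' h' => ?_⟩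
  obtain ⟨r, ⟨h1, h2⟩, h3⟩ := hu (b' ≫ d.inv) (fun i => π' i ≫ e.inv)
    (fun i => by rw [Category.assoc, w', ← Category.assoc, h'])
  refine ⟨r, ⟨by rw [← Category.assoc, h1]; simp, fun i => by rw [← Category.assoc, h2]; simp⟩, ?_⟩
  rintro r' ⟨h1', h2'⟩
  exact h3 r' ⟨by rw [← h1']; simp, fun i => by rw [← h2']; simp⟩

theorem isPullback_iff_nfold {E B P : C} {q : E ⟶ B} {π₁ π₂ : P ⟶ E} :
    IsPullback π₁ π₂ q q ↔ (π₁ ≫ q = π₂ ≫ q ∧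
      IsNFoldPullback q (π₁ ≫ q) (fun i : Fin 2 => if i = 0 then π₁ else π₂)) := by
  rw [isNFoldPullback_iff]
  constructor
  · intro h
    refine ⟨h.w, ?_, fun b' π' h' => ?_⟩
    · intro i
      by_cases hi : i = 0
      · simp [hi]
      · simpa [hi] using h.w.symm
    · refine ⟨h.lift (π' 0) (π' 1) (by rw [h', h']), ⟨?_, ?_⟩, ?_⟩
      · rw [← Category.assoc, h.lift_fst, h']
      · rw [Fin.forall_fin_two]
        exact ⟨by simp, by simp⟩
      · rintro r ⟨-, hr⟩
        have h0 := hr 0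
        have h1 := hr 1
        simp only [if_true, Fin.isValue, one_ne_zero, if_false] at h0 h1
        apply h.hom_ext
        · rw [h.lift_fst, h0]
        · rw [h.lift_snd, h1]
  · rintro ⟨w, -, hu⟩
    have key : ∀ {W : C} (a b : W ⟶ E), a ≫ q = b ≫ q →
        ∃! r : W ⟶ P, r ≫ π₁ = a ∧ r ≫ π₂ = b := by
      intro W a b hab
      obtain ⟨r, ⟨-, h2⟩, h3⟩ := hu (a ≫ q) (fun i => if i = 0 then a else b) (by
        rw [Fin.forall_fin_two]
        exact ⟨by simp, by simpa using hab.symm⟩)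
      have h0 := h2 0
      have h1 := h2 1
      simp only [if_true, Fin.isValue, one_ne_zero, if_false] at h0 h1
      refine ⟨r, ⟨h0, h1⟩, ?_⟩
      rintro r' ⟨h0', h1'⟩
      refine h3 r' ⟨by rw [← Category.assoc, h0'], ?_⟩
      rw [Fin.forall_fin_two]
      exact ⟨by simpa using h0', by simpa using h1'⟩
    refine ⟨⟨w⟩, ⟨PullbackCone.IsLimit.mk w
      (fun t => (key t.fst t.snd t.condition).choose) ?_ ?_ ?_⟩⟩
    · exact fun t => (key t.fst t.snd t.condition).choose_spec.1.1
    · exact fun t => (key t.fst t.snd t.condition).choose_spec.1.2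
    · exact fun t m h1 h2 => (key t.fst t.snd t.condition).choose_spec.2 m ⟨h1, h2⟩

theorem IsAdditiveMorphism.inv {X Y : BundleData C} {f : X.B ⟶ Y.B} {g : X.E ⟶ Y.E}
    (h : IsAdditiveMorphism X Y f g) (hX : IsPullback X.π₁ X.π₂ X.q X.q)
    (hY : IsPullback Y.π₁ Y.π₂ Y.q Y.q) {f' : Y.B ⟶ X.B} {g' : Y.E ⟶ X.E}
    (hf : f ≫ f' = 𝟙 _) (hf' : f' ≫ f = 𝟙 _) (hg : g ≫ g' = 𝟙 _) (hg' : g' ≫ g = 𝟙 _) :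
    IsAdditiveMorphism Y X f' g' := by
  obtain ⟨h1, h2, k, k1, k2, k3⟩ := h
  have a : Y.q ≫ f' = g' ≫ X.q := by
    have : Y.q = g' ≫ X.q ≫ f := by rw [h1, reassoc_of% hg']
    rw [this]
    simp [hf]
  have b : Y.z ≫ g' = f' ≫ X.z := by
    have : Y.z = f' ≫ X.z ≫ g := by rw [h2, reassoc_of% hf']
    rw [this]
    simp [hg]
  have w : (Y.π₁ ≫ g') ≫ X.q = (Y.π₂ ≫ g') ≫ X.q := by
    rw [Category.assoc, Category.assoc, ← a, reassoc_of% hY.w]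
  refine ⟨a, b, hX.lift _ _ w, hX.lift_fst _ _ w, hX.lift_snd _ _ w, ?_⟩
  have e : hX.lift _ _ w ≫ k = 𝟙 _ := by
    apply hY.hom_ext
    · rw [Category.assoc, k1, ← Category.assoc, hX.lift_fst, Category.assoc, hg',
        Category.comp_id, Category.id_comp]
    · rw [Category.assoc, k2, ← Category.assoc, hX.lift_snd, Category.assoc, hg',
        Category.comp_id, Category.id_comp]
  have e' : X.s = k ≫ Y.s ≫ g' := by rw [← reassoc_of% k3, hg, Category.comp_id]
  rw [e', reassoc_of% e]

theorem isPullback_map_of_nfold (F : C ⥤ D) {E B P : C} {q : E ⟶ B} {π₁ π₂ : P ⟶ E}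
    (h : IsPullback π₁ π₂ q q)
    (hF : ∀ (b : P ⟶ B) (π : Fin 2 → (P ⟶ E)), IsNFoldPullback q b π →
      IsNFoldPullback (F.map q) (F.map b) (fun i => F.map (π i))) :
    IsPullback (F.map π₁) (F.map π₂) (F.map q) (F.map q) := by
  have h' := isPullback_iff_nfold.1 h
  refine isPullback_iff_nfold.2 ⟨by rw [← F.map_comp, h'.1, F.map_comp], ?_⟩
  have := hF _ _ h'.2
  rw [F.map_comp] at this
  convert this using 2 with i
  split <;> rfl

end AdditiveLemmas

section MorphismComposition

variable {X : TangentCat.{v₁, u₁}} {Y : TangentCat.{v₂, u₂}} {Z : TangentCat.{v₃, u₃}}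
  {W : TangentCat.{v₄, u₄}}

/-- The identity lax tangent morphism. -/
@[simps]
def LaxLaw.id (X : TangentCat.{v₁, u₁}) : LaxLaw (𝟭 X) where
  α := { app := fun A => 𝟙 (X.T.obj A) }
  additive A := IsAdditiveMorphism.refl (X.str.bundle A)
  lift A := by simp
  flip A := by simp

/-- Composition of lax tangent morphisms. -/
@[simps]
def LaxLaw.comp {F : X ⥤ Y} {G : Y ⥤ Z} (L : LaxLaw F) (M : LaxLaw G) : LaxLaw (F ⋙ G) where
  α :=
    { app := fun A => G.map (L.α.app A) ≫ M.α.app (F.obj A)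
      naturality := fun A B f => by
        have h1 := L.α.naturality f
        have h2 := M.α.naturality (F.map f)
        simp only [Functor.comp_map, Functor.comp_obj] at h1 h2 ⊢
        rw [← Category.assoc, ← G.map_comp, h1, G.map_comp, Category.assoc, h2, Category.assoc] }
  additive A := by
    have h := ((L.additive A).map G).comp (M.additive (F.obj A))
    have e : G.map (𝟙 (F.obj A)) ≫ 𝟙 (G.obj (F.obj A)) = 𝟙 (G.obj (F.obj A)) := by simp
    exact e ▸ h
  lift A := by
    have h1 := L.lift A
    have h2 := M.lift (F.obj A)
    have h3 := M.α.naturality (L.α.app A)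
    simp only [Functor.comp_map, Functor.comp_obj, Functor.map_comp, Category.assoc] at h1 h2 h3 ⊢
    rw [← reassoc_of% h3, ← h2]
    simp only [← Category.assoc, ← G.map_comp]
    simp only [Category.assoc, h1]
  flip A := by
    have h1 := L.flip A
    have h2 := M.flip (F.obj A)
    have h3 := M.α.naturality (L.α.app A)
    simp only [Functor.comp_map, Functor.comp_obj, Functor.map_comp, Category.assoc] at h1 h2 h3 ⊢
    rw [← reassoc_of% h3, ← reassoc_of% h3, ← h2]
    simp only [← Category.assoc, ← G.map_comp]
    simp only [Category.assoc, h1]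

/-- The identity colax tangent morphism. -/
@[simps]
def ColaxLaw.id (X : TangentCat.{v₁, u₁}) : ColaxLaw (𝟭 X) where
  β := { app := fun A => 𝟙 (X.T.obj A) }
  additive A := IsAdditiveMorphism.refl (X.str.bundle A)
  lift A := by simp
  flip A := by simp

/-- Composition of colax tangent morphisms. -/
@[simps]
def ColaxLaw.comp {F : X ⥤ Y} {G : Y ⥤ Z} (L : ColaxLaw F) (M : ColaxLaw G) :
    ColaxLaw (F ⋙ G) where
  β :=
    { app := fun A => M.β.app (F.obj A) ≫ G.map (L.β.app A)
      naturality := fun A B f => by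
        have h1 := L.β.naturality f
        have h2 := M.β.naturality (F.map f)
        simp only [Functor.comp_map, Functor.comp_obj] at h1 h2 ⊢
        rw [← Category.assoc, h2, Category.assoc, ← G.map_comp, h1, G.map_comp, Category.assoc] }
  additive A := by
    have h := (M.additive (F.obj A)).comp ((L.additive A).map G)
    have e : 𝟙 (G.obj (F.obj A)) ≫ G.map (𝟙 (F.obj A)) = 𝟙 (G.obj (F.obj A)) := by simp
    exact e ▸ h
  lift A := by
    have h1 := L.lift A
    have h2 := M.lift (F.obj A)
    have h3 := M.β.naturality (L.β.app A)
    simp only [Functor.comp_map, Functor.comp_obj, Functor.map_comp, Category.assoc] at h1 h2 h3 ⊢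
    rw [reassoc_of% h3, reassoc_of% h2, ← G.map_comp, ← G.map_comp, ← G.map_comp, h1]
  flip A := by
    have h1 := L.flip A
    have h2 := M.flip (F.obj A)
    have h3 := M.β.naturality (L.β.app A)
    simp only [Functor.comp_map, Functor.comp_obj, Functor.map_comp, Category.assoc] at h1 h2 h3 ⊢
    rw [reassoc_of% h3, reassoc_of% h2, reassoc_of% h3, ← G.map_comp, ← G.map_comp,
      ← G.map_comp, ← G.map_comp, h1]

theorem PreservesTangentLimits.isPullback {F : X ⥤ Y} (hF : PreservesTangentLimits F) (A : X) :
    IsPullback ((X.str.bundle A).map F).π₁ ((X.str.bundle A).map F).π₂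
      ((X.str.bundle A).map F).q ((X.str.bundle A).map F).q :=
  isPullback_map_of_nfold F (X.str.additive A).isPullback (fun b π h => hF.nfold 2 A _ b π h)

/-- The inverse of an invertible colax distributive law on a functor preserving the tangent
limits. -/
def ColaxLaw.invLax {F : X ⥤ Y} (L : ColaxLaw F) (a : X.T ⋙ F ⟶ F ⋙ Y.T)
    (h₁ : a ≫ L.β = 𝟙 _) (h₂ : L.β ≫ a = 𝟙 _) (hF : PreservesTangentLimits F) :
    LaxLaw F where
  α := a
  additive A := (L.additive A).inv (Y.str.additive (F.obj A)).isPullback (hF.isPullback A)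
    (Category.comp_id _) (Category.comp_id _) (congrArg (fun t => t.app A) h₂)
    (congrArg (fun t => t.app A) h₁)
  lift A := by
    have h := L.lift A
    have i₁ : ∀ A, a.app A ≫ L.β.app A = 𝟙 _ := fun A => congrArg (fun t => t.app A) h₁
    have i₂ : ∀ A, L.β.app A ≫ a.app A = 𝟙 _ := fun A => congrArg (fun t => t.app A) h₂
    simp only [Functor.comp_obj] at h i₁ i₂
    have e : F.map (X.str.l.app A) =
        a.app A ≫ Y.str.l.app (F.obj A) ≫ Y.T.map (L.β.app A) ≫ L.β.app (X.T.obj A) := by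
      rw [h, reassoc_of% i₁]
    rw [e]
    simp only [Category.assoc, reassoc_of% i₂, ← Functor.map_comp, i₂]
    simp
  flip A := by
    have h := L.flip A
    have i₁ : ∀ A, a.app A ≫ L.β.app A = 𝟙 _ := fun A => congrArg (fun t => t.app A) h₁
    have i₂ : ∀ A, L.β.app A ≫ a.app A = 𝟙 _ := fun A => congrArg (fun t => t.app A) h₂
    simp only [Functor.comp_obj] at h i₁ i₂
    have j : Y.T.map (a.app A) ≫ Y.T.map (L.β.app A) = 𝟙 _ := by
      rw [← Functor.map_comp, i₁]
      simp
    have j' : Y.T.map (L.β.app A) ≫ Y.T.map (a.app A) = 𝟙 _ := by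
      rw [← Functor.map_comp, i₂]
      simp
    have e : F.map (X.str.c.app A) = a.app (X.T.obj A) ≫ Y.T.map (a.app A) ≫
        Y.str.c.app (F.obj A) ≫ Y.T.map (L.β.app A) ≫ L.β.app (X.T.obj A) := by
      rw [h, Category.assoc, reassoc_of% j, reassoc_of% i₁]
    rw [e]
    simp only [Category.assoc, reassoc_of% i₂, j']
    simp

theorem PreservesTangentLimits.id (X : TangentCat.{v₁, u₁}) :
    PreservesTangentLimits (𝟭 X : X ⥤ X) where
  nfold _ _ _ _ _ h := h
  vlift A w h := by
    obtain ⟨w', h', hp⟩ := X.str.lift_universal A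
    have : w = w' := by
      obtain ⟨r, h1, h2, rfl⟩ := h
      obtain ⟨r', h1', h2', rfl⟩ := h'
      have hT : IsPullback (X.T.map (X.str.π₁.app A)) (X.T.map (X.str.π₂.app A))
          (X.T.map (X.str.p.app A)) (X.T.map (X.str.p.app A)) := 
        isPullback_map_of_nfold X.T (X.str.additive A).isPullback
          (fun b π h => X.str.iter_nfold 1 2 A _ b π h)
      rw [hT.hom_ext (h1.trans h1'.symm) (h2.trans h2'.symm)]
    subst this
    exact hp

/-- Functors preserving the tangent limits and carrying an invertible lax distributive law are
closed under composition. -/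
theorem PreservesTangentLimits.comp {F : X ⥤ Y} {G : Y ⥤ Z} (hF : PreservesTangentLimits F)
    (hG : PreservesTangentLimits G) (L : LaxLaw F) (hL : IsIso L.α) :
    PreservesTangentLimits (F ⋙ G) where
  nfold n A P b π h := by
    have h1 := hF.nfold n A P b π h
    have hp := (L.additive A).proj
    change F.map (X.str.p.app A) ≫ 𝟙 _ = L.α.app A ≫ Y.str.p.app (F.obj A) at hp
    have h2 := h1.of_iso (q' := (Y.str.p.app (F.obj A) : _ ⟶ F.obj A))
      (asIso (L.α.app A)) (Iso.refl (F.obj A)) hp.symm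
    have h3 := hG.nfold n (F.obj A) _ _ _ h2
    have h4 := h3.of_iso (q' := (G.map (F.map (X.str.p.app A)) : _ ⟶ G.obj (F.obj A)))
      (asIso (G.map (L.α.app A))).symm (Iso.refl (G.obj (F.obj A))) (by
        change inv (G.map (L.α.app A)) ≫ _ = _ ≫ 𝟙 _
        rw [IsIso.inv_comp_eq, Category.comp_id]
        erw [← G.map_comp, ← hp, Category.comp_id])
    simpa using h4
  vlift A w hw := by
    obtain ⟨α, hα⟩ : ∃ α : ∀ B, F.obj (X.T.obj B) ≅ Y.T.obj (F.obj B),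
        ∀ B, (α B).hom = L.α.app B := ⟨fun B => asIso (L.α.app B), fun _ => rfl⟩
    have nat : ∀ {B B' : X} (f : B ⟶ B'), F.map (X.T.map f) ≫ (α B').hom =
      (α B).hom ≫ Y.T.map (F.map f) := fun f => by
        rw [hα, hα]; exact L.α.naturality f
    have hp' : ∀ B : X, F.map (X.str.p.app B) = (α B).hom ≫ Y.str.p.app (F.obj B) := fun B => by
      rw [hα]; exact (Category.comp_id _).symm.trans (L.additive B).proj
    have hz' : ∀ B : X, F.map (X.str.z.app B) ≫ (α B).hom = Y.str.z.app (F.obj B) := fun B => by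
      rw [hα]; exact (L.additive B).zero.trans (Category.id_comp _)
    have hl : F.map (X.str.l.app A) ≫ (α (X.T.obj A)).hom ≫ Y.T.map (α A).hom =
        (α A).hom ≫ Y.str.l.app (F.obj A) := by
      rw [hα, hα]; exact L.lift A
    obtain ⟨-, -, k, k1, k2, k3⟩ := L.additive A
    change F.obj (X.str.T₂.obj A) ⟶ Y.str.T₂.obj (F.obj A) at k
    change k ≫ Y.str.π₁.app (F.obj A) = F.map (X.str.π₁.app A) ≫ L.α.app A at k1
    change k ≫ Y.str.π₂.app (F.obj A) = F.map (X.str.π₂.app A) ≫ L.α.app A at k2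
    change F.map (X.str.s.app A) ≫ L.α.app A = k ≫ Y.str.s.app (F.obj A) at k3
    rw [← hα] at k1 k2 k3
    have hFp : IsPullback (F.map (X.str.π₁.app A)) (F.map (X.str.π₂.app A))
      (F.map (X.str.p.app A)) (F.map (X.str.p.app A)) := hF.isPullback A
    have hY : IsPullback (Y.str.π₁.app (F.obj A)) (Y.str.π₂.app (F.obj A))
      (Y.str.p.app (F.obj A)) (Y.str.p.app (F.obj A)) := (Y.str.additive (F.obj A)).isPullback
    -- the induced comparison of the pullbacks is invertible
    have hw : ((Y.str.π₁.app (F.obj A)) ≫ (α A).inv) ≫ F.map (X.str.p.app A) =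
        ((Y.str.π₂.app (F.obj A)) ≫ (α A).inv) ≫ F.map (X.str.p.app A) := by
      rw [hp']
      simpa using hY.w
    obtain ⟨K, hK⟩ : ∃ K : F.obj (X.str.T₂.obj A) ≅ Y.str.T₂.obj (F.obj A), K.hom = k := by
      refine ⟨⟨k, hFp.lift _ _ hw, ?_, ?_⟩, rfl⟩
      · apply hFp.hom_ext
        · rw [Category.assoc, hFp.lift_fst, ← Category.assoc, k1]; simp
        · rw [Category.assoc, hFp.lift_snd, ← Category.assoc, k2]; simp
      · apply hY.hom_ext
        · rw [Category.assoc, k1, ← Category.assoc, hFp.lift_fst]; simp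
        · rw [Category.assoc, k2, ← Category.assoc, hFp.lift_snd]; simp
    subst hK
    obtain ⟨r, r1, r2, rfl⟩ := ‹X.str.IsVerticalLiftMap A w›
    have hv : Y.str.IsVerticalLiftMap (F.obj A) (K.inv ≫ F.map (r ≫ X.T.map (X.str.s.app A)) ≫
        (α (X.T.obj A)).hom ≫ Y.T.map (α A).hom) := by
      refine ⟨K.inv ≫ F.map r ≫ (α _).hom ≫ Y.T.map K.hom, ?_, ?_, ?_⟩
      · simp only [Category.assoc]
        rw [← Functor.map_comp, k1, Functor.map_comp, ← reassoc_of% nat, ← F.map_comp_assoc, r1,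
          F.map_comp, Category.assoc, hl, ← reassoc_of% k1, Iso.inv_hom_id_assoc]
      · simp only [Category.assoc]
        rw [← Functor.map_comp, k2, Functor.map_comp, ← reassoc_of% nat, ← F.map_comp_assoc, r2,
          F.map_comp, Category.assoc, reassoc_of% hz']
        have := Y.str.z.naturality (α A).hom
        simp only [Functor.id_map, Functor.id_obj] at this
        rw [← this, ← reassoc_of% k2, Iso.inv_hom_id_assoc]
      · simp only [Category.assoc]
        rw [← Functor.map_comp, ← k3, F.map_comp, Y.T.map_comp, Category.assoc, reassoc_of% nat]
    have h1 := hG.vlift (F.obj A) _ hv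
    refine h1.of_iso (G.mapIso K.symm) (G.mapIso ((α (X.T.obj A)) ≪≫ Y.T.mapIso (α A))).symm
      (Iso.refl (G.obj (F.obj A))) (G.mapIso (α A)).symm ?_ ?_ ?_ ?_
    · simp [← Functor.map_comp]
    · change _ ≫ 𝟙 _ = G.map K.inv ≫ G.map (F.map _)
      rw [Category.comp_id, ← G.map_comp]
      congr 1
      rw [F.map_comp, hp', ← reassoc_of% k1, Iso.inv_hom_id_assoc]
    · change G.map _ ≫ G.map (α A).inv =
        G.map (Y.T.map (α A).inv ≫ (α (X.T.obj A)).inv) ≫ G.map (F.map _)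
      rw [← G.map_comp, ← G.map_comp]
      congr 1
      rw [Iso.comp_inv_eq, Category.assoc, Category.assoc]
      erw [nat (X.str.p.app A)]
      rw [Iso.inv_hom_id_assoc, ← Y.T.map_comp, hp', Iso.inv_hom_id_assoc]
    · change G.map _ ≫ G.map (α A).inv = 𝟙 _ ≫ G.map (F.map _)
      rw [← G.map_comp, Category.id_comp]
      congr 1
      rw [Iso.comp_inv_eq, hz']

theorem LaxLaw.IsStrict.isStrong {F : X ⥤ Y} {L : LaxLaw F} (h : L.IsStrict) : L.IsStrong := by
  obtain ⟨⟨e, he⟩, hF⟩ := h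
  exact ⟨by rw [he]; infer_instance, hF⟩

theorem ColaxLaw.IsStrict.isStrong {F : X ⥤ Y} {L : ColaxLaw F} (h : L.IsStrict) :
    L.IsStrong := by
  obtain ⟨⟨e, he⟩, hF⟩ := h
  exact ⟨by rw [he]; infer_instance, hF⟩

theorem LaxLaw.IsStrict.id (X : TangentCat.{v₁, u₁}) : (LaxLaw.id X).IsStrict :=
  ⟨⟨rfl, rfl⟩, .id X⟩

theorem ColaxLaw.IsStrict.id (X : TangentCat.{v₁, u₁}) : (ColaxLaw.id X).IsStrict :=
  ⟨⟨rfl, rfl⟩, .id X⟩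

theorem LaxLaw.IsStrong.comp {F : X ⥤ Y} {G : Y ⥤ Z} {L : LaxLaw F} {M : LaxLaw G}
    (hL : L.IsStrong) (hM : M.IsStrong) : (L.comp M).IsStrong := by
  obtain ⟨iL, hF⟩ := hL
  obtain ⟨iM, hG⟩ := hM
  refine ⟨?_, hF.comp hG L iL⟩
  have : ∀ A, IsIso ((L.comp M).α.app A) := fun A => by
    rw [LaxLaw.comp_α_app]; infer_instance
  exact NatIso.isIso_of_isIso_app _

theorem ColaxLaw.IsStrong.comp {F : X ⥤ Y} {G : Y ⥤ Z} {L : ColaxLaw F} {M : ColaxLaw G}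
    (hL : L.IsStrong) (hM : M.IsStrong) : (L.comp M).IsStrong := by
  obtain ⟨iL, hF⟩ := hL
  obtain ⟨iM, hG⟩ := hM
  refine ⟨?_, hF.comp hG
    (L.invLax (inv L.β) (IsIso.inv_hom_id _) (IsIso.hom_inv_id _) hF) (IsIso.inv_isIso)⟩
  have : ∀ A, IsIso ((L.comp M).β.app A) := fun A => by
    rw [ColaxLaw.comp_β_app]; infer_instance
  exact NatIso.isIso_of_isIso_app _

theorem LaxLaw.IsStrict.comp {F : X ⥤ Y} {G : Y ⥤ Z} {L : LaxLaw F} {M : LaxLaw G}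
    (hL : L.IsStrict) (hM : M.IsStrict) : (L.comp M).IsStrict := by
  refine ⟨?_, (hL.isStrong.comp hM.isStrong).2⟩
  obtain ⟨⟨e, he⟩, -⟩ := hL
  obtain ⟨⟨d, hd⟩, -⟩ := hM
  refine ⟨(congrArg (· ⋙ G) e).trans (congrArg (F ⋙ ·) d), ?_⟩
  ext A
  rw [LaxLaw.comp_α_app, he, hd, eqToHom_app, eqToHom_app, eqToHom_app, eqToHom_map]
  exact eqToHom_trans _ _

theorem ColaxLaw.IsStrict.comp {F : X ⥤ Y} {G : Y ⥤ Z} {L : ColaxLaw F} {M : ColaxLaw G}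
    (hL : L.IsStrict) (hM : M.IsStrict) : (L.comp M).IsStrict := by
  refine ⟨?_, (hL.isStrong.comp hM.isStrong).2⟩
  obtain ⟨⟨e, he⟩, -⟩ := hL
  obtain ⟨⟨d, hd⟩, -⟩ := hM
  refine ⟨(congrArg (F ⋙ ·) d).trans (congrArg (· ⋙ G) e), ?_⟩
  ext A
  rw [ColaxLaw.comp_β_app, he, hd, eqToHom_app, eqToHom_app, eqToHom_app, eqToHom_map]
  exact eqToHom_trans _ _

theorem LaxLaw.id_comp {F : X ⥤ Y} (L : LaxLaw F) :
    ((LaxLaw.id X).comp L : LaxLaw F) = L := by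
  refine LaxLaw.ext (NatTrans.ext (funext fun A => ?_))
  change F.map (𝟙 _) ≫ L.α.app A = L.α.app A
  simp

theorem LaxLaw.comp_id {F : X ⥤ Y} (L : LaxLaw F) :
    (L.comp (LaxLaw.id Y) : LaxLaw F) = L := by
  refine LaxLaw.ext (NatTrans.ext (funext fun A => ?_))
  change L.α.app A ≫ 𝟙 _ = L.α.app A
  simp

theorem LaxLaw.assoc {F : X ⥤ Y} {G : Y ⥤ Z} {H : Z ⥤ W} (L : LaxLaw F) (M : LaxLaw G)
    (N : LaxLaw H) : ((L.comp M).comp N : LaxLaw (F ⋙ G ⋙ H)) = L.comp (M.comp N) := by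
  refine LaxLaw.ext (NatTrans.ext (funext fun A => ?_))
  change H.map (G.map (L.α.app A) ≫ M.α.app (F.obj A)) ≫ N.α.app (G.obj (F.obj A)) =
    H.map (G.map (L.α.app A)) ≫ H.map (M.α.app (F.obj A)) ≫ N.α.app (G.obj (F.obj A))
  simp

theorem ColaxLaw.id_comp {F : X ⥤ Y} (L : ColaxLaw F) :
    ((ColaxLaw.id X).comp L : ColaxLaw F) = L := by
  refine ColaxLaw.ext (NatTrans.ext (funext fun A => ?_))
  change L.β.app A ≫ F.map (𝟙 _) = L.β.app A
  simp

theorem ColaxLaw.comp_id {F : X ⥤ Y} (L : ColaxLaw F) :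
    (L.comp (ColaxLaw.id Y) : ColaxLaw F) = L := by
  refine ColaxLaw.ext (NatTrans.ext (funext fun A => ?_))
  change 𝟙 _ ≫ L.β.app A = L.β.app A
  simp

theorem ColaxLaw.assoc {F : X ⥤ Y} {G : Y ⥤ Z} {H : Z ⥤ W} (L : ColaxLaw F) (M : ColaxLaw G)
    (N : ColaxLaw H) : ((L.comp M).comp N : ColaxLaw (F ⋙ G ⋙ H)) = L.comp (M.comp N) := by
  refine ColaxLaw.ext (NatTrans.ext (funext fun A => ?_))
  change N.β.app (G.obj (F.obj A)) ≫ H.map (M.β.app (F.obj A) ≫ G.map (L.β.app A)) =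
    (N.β.app (G.obj (F.obj A)) ≫ H.map (M.β.app (F.obj A))) ≫ H.map (G.map (L.β.app A))
  simp

end MorphismComposition

/-! ## Tangent fibrations -/

section FiberMap

variable {S : Type u₁} [Category.{v₁} S] {E : Type u₂} [Category.{v₂} E]
  {S' : Type u₃} [Category.{v₃} S'] {E' : Type u₄} [Category.{v₄} E']
  {p : E ⥤ S} {q : E' ⥤ S'} {F : S ⥤ S'} {F' : E ⥤ E'}

theorem isHomLift_map (h : F' ⋙ q = p ⋙ F) {A B : S} (f : A ⟶ B) {a b : E} (φ : a ⟶ b)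
    (hφ : p.IsHomLift f φ) : q.IsHomLift (F.map f) (F'.map φ) := by
  obtain ⟨φ⟩ := hφ
  exact IsHomLift.of_fac' _ _ _ (Functor.congr_obj h _) (Functor.congr_obj h _)
    (Functor.congr_hom h φ)

theorem isHomLift_comp {A B C : S} {f : A ⟶ B} {g : B ⟶ C} {a b c : E} {φ : a ⟶ b} {ψ : b ⟶ c}
    (hφ : p.IsHomLift f φ) (hψ : p.IsHomLift g ψ) : p.IsHomLift (f ≫ g) (φ ≫ ψ) :=
  inferInstance

/-- The functor between fibres induced by a commutative square of functors. -/
def fiberMap (h : F' ⋙ q = p ⋙ F) (A : S) : p.Fiber A ⥤ q.Fiber (F.obj A) where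
  obj X := ⟨F'.obj X.1, (Functor.congr_obj h X.1).trans (congrArg F.obj X.2)⟩
  map φ := ⟨F'.map φ.1, by
    have := isHomLift_map h (𝟙 A) φ.1 φ.2
    rwa [F.map_id] at this⟩
  map_id X := Subtype.ext (F'.map_id X.1)
  map_comp φ ψ := Subtype.ext (F'.map_comp φ.1 ψ.1)

end FiberMap

/-- Cloven tangent fibrations: a functor with a chosen cartesian lift `lift f E : f^* E ⟶ E` for
each `f : A ⟶ A'` and each `E` over `A'`, which is a strict tangent morphism and such that the
tangent bundle functors form a morphism of fibrations. -/
structure TangentFibration where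
  base : TangentCat.{v₁, u₁}
  total : TangentCat.{v₂, u₂}
  proj : total ⥤ base
  pull {A A' : base} (f : A ⟶ A') (E : proj.Fiber A') : proj.Fiber A
  lift {A A' : base} (f : A ⟶ A') (E : proj.Fiber A') : (pull f E).1 ⟶ E.1
  lift_cartesian {A A' : base} (f : A ⟶ A') (E : proj.Fiber A') :
    proj.IsStronglyCartesian f (lift f E)
  proj_strict : ∃ L : ColaxLaw proj, L.IsStrict
  T_lift_cartesian {A A' : base} (f : A ⟶ A') (E : proj.Fiber A') :
    proj.IsStronglyCartesian (base.T.map f) (total.T.map (lift f E))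

namespace TangentFibration

variable (P : TangentFibration.{v₁, u₁, v₂, u₂})

attribute [instance] lift_cartesian

/-- The substitution functor `f^*`. -/
noncomputable def sub ⦃A A' : P.base⦄ (f : A ⟶ A') : P.proj.Fiber A' ⥤ P.proj.Fiber A where
  obj E := P.pull f E
  map {E E'} φ :=
    haveI := φ.2
    ⟨Functor.IsStronglyCartesian.map P.proj f (P.lift f E') (Category.id_comp f).symm
      (P.lift f E ≫ φ.1), inferInstance⟩
  map_id E := by
    refine Subtype.ext (Eq.symm ?_)
    have h₁ : P.proj.IsHomLift (𝟙 A) (𝟙 (P.pull f E).1) := IsHomLift.id (P.pull f E).2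
    have h₂ : P.proj.IsHomLift (𝟙 A') (𝟙 E : E ⟶ E).1 := (𝟙 E : E ⟶ E).2
    exact Functor.IsStronglyCartesian.map_uniq P.proj f (P.lift f E) (g := 𝟙 A)
      (Category.id_comp f).symm (P.lift f E ≫ (𝟙 E : E ⟶ E).1) (𝟙 (P.pull f E).1)
      ((Category.id_comp _).trans (Category.comp_id _).symm)
  map_comp {E E' E''} φ ψ := by
    refine Subtype.ext (Eq.symm ?_)
    have h₁ := φ.2
    have h₂ := ψ.2
    have h₃ := (φ ≫ ψ).2
    refine Functor.IsStronglyCartesian.map_uniq P.proj f (P.lift f E'') (g := 𝟙 A)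
      (Category.id_comp f).symm (P.lift f E ≫ (φ ≫ ψ).1)
      (Functor.IsStronglyCartesian.map P.proj f (P.lift f E') (Category.id_comp f).symm
          (P.lift f E ≫ φ.1) ≫
        Functor.IsStronglyCartesian.map P.proj f (P.lift f E'') (Category.id_comp f).symm
          (P.lift f E' ≫ ψ.1)) ?_
    rw [Category.assoc, Functor.IsStronglyCartesian.fac, Functor.IsStronglyCartesian.fac_assoc,
      Category.assoc]
    rfl

theorem T_proj : P.total.T ⋙ P.proj = P.proj ⋙ P.base.T := by
  obtain ⟨L, ⟨h, -⟩, -⟩ := P.proj_strict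
  exact h.symm

/-- The tangent bundle functor of the total category, from the fibre over `A` to the fibre
over `T A`. -/
def totalT (A : P.base) : P.proj.Fiber A ⥤ P.proj.Fiber (P.base.T.obj A) :=
  fiberMap P.T_proj A

/-- The tangent bundle functor of the fibre over `A`: the functor `z^* T'`. -/
noncomputable def fiberT (A : P.base) : P.proj.Fiber A ⥤ P.proj.Fiber A :=
  P.totalT A ⋙ P.sub (P.base.str.z.app A)

/-- The chosen cartesian lift `z^* T' E ⟶ T' E` of the zero morphism. -/
def zeroLift {A : P.base} (E : P.proj.Fiber A) :
    ((P.fiberT A).obj E).1 ⟶ P.total.T.obj E.1 :=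
  P.lift (P.base.str.z.app A) ((P.totalT A).obj E)

end TangentFibration

/-- Morphisms of fibrations: a commutative square of functors such that the functor between the
total categories preserves cartesian lifts. -/
structure FibrationMap (P Q : TangentFibration.{v₁, u₁, v₂, u₂}) where
  base : P.base ⥤ Q.base
  total : P.total ⥤ Q.total
  comm : total ⋙ Q.proj = P.proj ⋙ base
  cartesian {A A' : P.base} (f : A ⟶ A') {E E' : P.total} (φ : E ⟶ E') :
    P.proj.IsStronglyCartesian f φ → Q.proj.IsStronglyCartesian (base.map f) (total.map φ)

namespace FibrationMap

/-- The restriction to the fibres. -/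
def fiber {P Q : TangentFibration.{v₁, u₁, v₂, u₂}} (m : FibrationMap P Q) (A : P.base) :
    P.proj.Fiber A ⥤ Q.proj.Fiber (m.base.obj A) :=
  fiberMap m.comm A

/-- The identity morphism of fibrations. -/
@[simps]
def id (P : TangentFibration.{v₁, u₁, v₂, u₂}) : FibrationMap P P where
  base := 𝟭 _
  total := 𝟭 _
  comm := rfl
  cartesian _ _ _ _ h := h

/-- Composition of morphisms of fibrations. -/
@[simps]
def comp {P Q R : TangentFibration.{v₁, u₁, v₂, u₂}} (m : FibrationMap P Q)
    (n : FibrationMap Q R) : FibrationMap P R where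
  base := m.base ⋙ n.base
  total := m.total ⋙ n.total
  comm := by rw [Functor.assoc, n.comm, ← Functor.assoc, m.comm, Functor.assoc]
  cartesian _ _ _ _ h := n.cartesian _ _ (m.cartesian _ _ h)

end FibrationMap

/-- Lax morphisms of tangent fibrations. -/
structure LaxHom (P Q : TangentFibration.{v₁, u₁, v₂, u₂}) where
  map : FibrationMap P Q
  baseLaw : LaxLaw map.base
  totalLaw : LaxLaw map.total
  law_lift (E : P.total) :
    Q.proj.IsHomLift (baseLaw.α.app (P.proj.obj E)) (totalLaw.α.app E)

/-- Colax morphisms of tangent fibrations. -/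
structure ColaxHom (P Q : TangentFibration.{v₁, u₁, v₂, u₂}) where
  map : FibrationMap P Q
  baseLaw : ColaxLaw map.base
  totalLaw : ColaxLaw map.total
  law_lift (E : P.total) :
    Q.proj.IsHomLift (baseLaw.β.app (P.proj.obj E)) (totalLaw.β.app E)

theorem LaxHom.mk_congr {P Q : TangentFibration.{v₁, u₁, v₂, u₂}} {m : FibrationMap P Q}
    {a b : LaxLaw m.base} {a' b' : LaxLaw m.total} (h : a = b) (h' : a' = b') (ha hb) :
    LaxHom.mk m a a' ha = LaxHom.mk m b b' hb := by
  subst h h'; rfl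

theorem ColaxHom.mk_congr {P Q : TangentFibration.{v₁, u₁, v₂, u₂}} {m : FibrationMap P Q}
    {a b : ColaxLaw m.base} {a' b' : ColaxLaw m.total} (h : a = b) (h' : a' = b') (ha hb) :
    ColaxHom.mk m a a' ha = ColaxHom.mk m b b' hb := by
  subst h h'; rfl

/-- The category of cloven tangent fibrations and lax morphisms. -/
def TNGFIB := TangentFibration.{v₁, u₁, v₂, u₂}

/-- The category of cloven tangent fibrations and colax morphisms. -/
def TNGFIBco := TangentFibration.{v₁, u₁, v₂, u₂}

theorem isHomLift_total {P Q : TangentFibration.{v₁, u₁, v₂, u₂}} (m : FibrationMap P Q)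
    {A B : P.base} (f : A ⟶ B) {a b : P.total} (φ : a ⟶ b) (h : P.proj.IsHomLift f φ) :
    Q.proj.IsHomLift (m.base.map f) (m.total.map φ) := isHomLift_map m.comm f φ h

theorem isHomLift_law_congr {P : TangentFibration.{v₁, u₁, v₂, u₂}} {C : Type u₃}
    {F G : C → P.base} (α : ∀ A, F A ⟶ G A) {A B : C} (h : A = B) {a b : P.total} (φ : a ⟶ b)
    (hφ : P.proj.IsHomLift (α A) φ) : P.proj.IsHomLift (α B) φ := by
  subst h; exact hφ

instance : Category TNGFIB.{v₁, u₁, v₂, u₂} where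
  Hom P Q := LaxHom P Q
  id P := ⟨.id P, .id P.base, .id P.total, fun E =>
    IsHomLift.id (Functor.congr_obj P.T_proj E)⟩
  comp {P Q R} φ ψ := ⟨φ.map.comp ψ.map, φ.baseLaw.comp ψ.baseLaw, φ.totalLaw.comp ψ.totalLaw,
    fun E => by
      have h1 := isHomLift_total ψ.map _ _ (φ.law_lift E)
      have h3 := isHomLift_law_congr (P := R) (fun A => ψ.baseLaw.α.app A)
        (Functor.congr_obj φ.map.comm E) _ (ψ.law_lift (φ.map.total.obj E))
      exact isHomLift_comp h1 h3⟩
  id_comp {P Q} φ := LaxHom.mk_congr (m := φ.map) φ.baseLaw.id_comp φ.totalLaw.id_comp _ _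
  comp_id {P Q} φ := LaxHom.mk_congr (m := φ.map) φ.baseLaw.comp_id φ.totalLaw.comp_id _ _
  assoc {P Q R S} φ ψ χ := LaxHom.mk_congr (m := (φ.map.comp ψ.map).comp χ.map)
    (φ.baseLaw.assoc ψ.baseLaw χ.baseLaw) (φ.totalLaw.assoc ψ.totalLaw χ.totalLaw) _ _

instance : Category TNGFIBco.{v₁, u₁, v₂, u₂} where
  Hom P Q := ColaxHom P Q
  id P := ⟨.id P, .id P.base, .id P.total, fun E =>
    IsHomLift.id (Functor.congr_obj P.T_proj E)⟩
  comp {P Q R} φ ψ := ⟨φ.map.comp ψ.map, φ.baseLaw.comp ψ.baseLaw, φ.totalLaw.comp ψ.totalLaw,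
    fun E => by
      have h1 := isHomLift_total ψ.map _ _ (φ.law_lift E)
      have h3 := isHomLift_law_congr (P := R) (fun A => ψ.baseLaw.β.app A)
        (Functor.congr_obj φ.map.comm E) _ (ψ.law_lift (φ.map.total.obj E))
      exact isHomLift_comp h3 h1⟩
  id_comp {P Q} φ := ColaxHom.mk_congr (m := φ.map) φ.baseLaw.id_comp φ.totalLaw.id_comp _ _
  comp_id {P Q} φ := ColaxHom.mk_congr (m := φ.map) φ.baseLaw.comp_id φ.totalLaw.comp_id _ _
  assoc {P Q R S} φ ψ χ := ColaxHom.mk_congr (m := (φ.map.comp ψ.map).comp χ.map)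
    (φ.baseLaw.assoc ψ.baseLaw χ.baseLaw) (φ.totalLaw.assoc ψ.totalLaw χ.totalLaw) _ _

/-! ## Indexed tangent categories -/

/-- The remaining data of an indexed tangent category with fibres `fib A` and substitution functors
`sub f`: distributive laws `T (f^* E) ⟶ f^* (T E)` making the substitution functors strong tangent
morphisms, and coherent invertible comparisons for identities and composition, compatible with
the distributive laws. In other words, a pseudofunctor to the 2-category of tangent categories and
strong tangent morphisms. -/
structure PseudoStr (X : TangentCat.{v₁, u₁}) (fib : X → TangentCat.{v₂, u₂})
    (sub : ∀ ⦃A A' : X⦄, (A ⟶ A') → (fib A' ⥤ fib A)) where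
  law {A A' : X} (f : A ⟶ A') : ColaxLaw (sub f)
  law_strong {A A' : X} (f : A ⟶ A') : (law f).IsStrong
  unit (A : X) : 𝟭 (fib A) ≅ sub (𝟙 A)
  comp {A A' A'' : X} (f : A ⟶ A') (g : A' ⟶ A'') : sub g ⋙ sub f ≅ sub (f ≫ g)
  unit_law (A : X) (E : fib A) :
    (fib A).T.map ((unit A).hom.app E) ≫ (law (𝟙 A)).β.app E =
      (unit A).hom.app ((fib A).T.obj E)
  comp_law {A A' A'' : X} (f : A ⟶ A') (g : A' ⟶ A'') (E : fib A'') :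
    (fib A).T.map ((comp f g).hom.app E) ≫ (law (f ≫ g)).β.app E =
      ((law g).comp (law f)).β.app E ≫ (comp f g).hom.app ((fib A'').T.obj E)
  unit_comp {A A' : X} (f : A ⟶ A') (E : fib A') :
    (unit A).hom.app ((sub f).obj E) ≫ (comp (𝟙 A) f).hom.app E =
      eqToHom (by rw [Category.id_comp]; rfl)
  comp_unit {A A' : X} (f : A ⟶ A') (E : fib A') :
    (sub f).map ((unit A').hom.app E) ≫ (comp f (𝟙 A')).hom.app E =
      eqToHom (by rw [Category.comp_id]; rfl)
  assoc {A A' A'' B : X} (f : A ⟶ A') (g : A' ⟶ A'') (h : A'' ⟶ B) (E : fib B) :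
    (sub f).map ((comp g h).hom.app E) ≫ (comp f (g ≫ h)).hom.app E =
      (comp f g).hom.app ((sub h).obj E) ≫ (comp (f ≫ g) h).hom.app E ≫
        eqToHom (by rw [Category.assoc])

/-- Indexed tangent categories. -/
structure IndexedTangentCat where
  base : TangentCat.{v₁, u₁}
  fib : base → TangentCat.{v₂, u₂}
  sub : ∀ ⦃A A' : base⦄, (A ⟶ A') → (fib A' ⥤ fib A)
  str : PseudoStr base fib sub

/-- The distributors making a functor `F` between the bases and functors `G A` between the fibres
into a morphism of indexed categories. -/
structure Distributors (I J : IndexedTangentCat.{v₁, u₁, v₂, u₂}) (F : I.base ⥤ J.base)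
    (G : ∀ A, I.fib A ⥤ J.fib (F.obj A)) where
  κ {A A' : I.base} (f : A ⟶ A') : I.sub f ⋙ G A ≅ G A' ⋙ J.sub (F.map f)
  κ_id (A : I.base) (E : I.fib A) :
    (G A).map ((I.str.unit A).hom.app E) ≫ (κ (𝟙 A)).hom.app E =
      (J.str.unit (F.obj A)).hom.app ((G A).obj E) ≫ eqToHom (by rw [← F.map_id]; rfl)
  κ_comp {A A' A'' : I.base} (f : A ⟶ A') (g : A' ⟶ A'') (E : I.fib A'') :
    (G A).map ((I.str.comp f g).hom.app E) ≫ (κ (f ≫ g)).hom.app E =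
      (κ f).hom.app ((I.sub g).obj E) ≫ (J.sub (F.map f)).map ((κ g).hom.app E) ≫
        (J.str.comp (F.map f) (F.map g)).hom.app ((G A'').obj E) ≫
          eqToHom (by rw [← F.map_comp]; rfl)

/-- Lax morphisms of indexed tangent categories. -/
structure LaxIndexedHom (I J : IndexedTangentCat.{v₁, u₁, v₂, u₂}) where
  base : I.base ⥤ J.base
  fib (A : I.base) : I.fib A ⥤ J.fib (base.obj A)
  dist : Distributors I J base fib
  baseLaw : LaxLaw base
  fibLaw (A : I.base) : LaxLaw (fib A)
  coherence {A A' : I.base} (f : A ⟶ A') (E : I.fib A') :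
    (fib A).map ((I.str.law f).β.app E) ≫ (dist.κ f).hom.app ((I.fib A').T.obj E) ≫
        (J.sub (base.map f)).map ((fibLaw A').α.app E) =
      (fibLaw A).α.app ((I.sub f).obj E) ≫ (J.fib (base.obj A)).T.map ((dist.κ f).hom.app E) ≫
        (J.str.law (base.map f)).β.app ((fib A').obj E)

/-- Colax morphisms of indexed tangent categories. -/
structure ColaxIndexedHom (I J : IndexedTangentCat.{v₁, u₁, v₂, u₂}) where
  base : I.base ⥤ J.base
  fib (A : I.base) : I.fib A ⥤ J.fib (base.obj A)
  dist : Distributors I J base fib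
  baseLaw : ColaxLaw base
  fibLaw (A : I.base) : ColaxLaw (fib A)
  coherence {A A' : I.base} (f : A ⟶ A') (E : I.fib A') :
    (fibLaw A).β.app ((I.sub f).obj E) ≫ (fib A).map ((I.str.law f).β.app E) ≫
        (dist.κ f).hom.app ((I.fib A').T.obj E) =
      (J.fib (base.obj A)).T.map ((dist.κ f).hom.app E) ≫
        (J.str.law (base.map f)).β.app ((fib A').obj E) ≫
          (J.sub (base.map f)).map ((fibLaw A').β.app E)

theorem Distributors.ext {I J : IndexedTangentCat.{v₁, u₁, v₂, u₂}} {F : I.base ⥤ J.base}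
    {G : ∀ A, I.fib A ⥤ J.fib (F.obj A)} {a b : Distributors I J F G}
    (h : ∀ (A A' : I.base) (f : A ⟶ A') (E : I.fib A'), (a.κ f).hom.app E = (b.κ f).hom.app E) :
    a = b := by
  obtain ⟨a, _, _⟩ := a
  obtain ⟨b, _, _⟩ := b
  have : @a = @b := by
    funext A A' f
    exact Iso.ext (NatTrans.ext (funext (h A A' f)))
  subst this
  rfl

theorem LaxIndexedHom.mk_congr {I J : IndexedTangentCat.{v₁, u₁, v₂, u₂}} {F : I.base ⥤ J.base}
    {G : ∀ A, I.fib A ⥤ J.fib (F.obj A)} {d e : Distributors I J F G} {a b : LaxLaw F}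
    {a' b' : ∀ A, LaxLaw (G A)}
    (hd : ∀ (A A' : I.base) (f : A ⟶ A') (E : I.fib A'), (d.κ f).hom.app E = (e.κ f).hom.app E)
    (h : a = b) (h' : ∀ A, a' A = b' A) (ha hb) :
    LaxIndexedHom.mk F G d a a' ha = LaxIndexedHom.mk F G e b b' hb := by
  obtain rfl := Distributors.ext hd
  obtain rfl := funext h'
  subst h
  rfl

theorem ColaxIndexedHom.mk_congr {I J : IndexedTangentCat.{v₁, u₁, v₂, u₂}} {F : I.base ⥤ J.base}
    {G : ∀ A, I.fib A ⥤ J.fib (F.obj A)} {d e : Distributors I J F G} {a b : ColaxLaw F}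
    {a' b' : ∀ A, ColaxLaw (G A)}
    (hd : ∀ (A A' : I.base) (f : A ⟶ A') (E : I.fib A'), (d.κ f).hom.app E = (e.κ f).hom.app E)
    (h : a = b) (h' : ∀ A, a' A = b' A) (ha hb) :
    ColaxIndexedHom.mk F G d a a' ha = ColaxIndexedHom.mk F G e b b' hb := by
  obtain rfl := Distributors.ext hd
  obtain rfl := funext h'
  subst h
  rfl

theorem κ_congr {I J : IndexedTangentCat.{v₁, u₁, v₂, u₂}} {F : I.base ⥤ J.base}
    {G : ∀ A, I.fib A ⥤ J.fib (F.obj A)} (d : Distributors I J F G) {A A' : I.base}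
    {f g : A ⟶ A'} (h : f = g) (E : I.fib A') (h₁ h₂) :
    (G A).map (eqToHom h₁ : (I.sub f).obj E ⟶ (I.sub g).obj E) ≫ (d.κ g).hom.app E =
      (d.κ f).hom.app E ≫
        (eqToHom h₂ : (J.sub (F.map f)).obj ((G A').obj E) ⟶ (J.sub (F.map g)).obj _) := by
  subst h
  simp

/-- The identity distributors. -/
@[simps κ]
def Distributors.id (I : IndexedTangentCat.{v₁, u₁, v₂, u₂}) :
    Distributors I I (𝟭 _) (fun A => 𝟭 (I.fib A)) where
  κ f := Iso.refl (I.sub f)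
  κ_id A E := by
    change (I.str.unit A).hom.app E ≫ 𝟙 _ = _
    simp
  κ_comp f g E := by
    change (I.str.comp f g).hom.app E ≫ 𝟙 _ =
      𝟙 _ ≫ (I.sub f).map (𝟙 _) ≫ (I.str.comp f g).hom.app E ≫ _
    simp

/-- Composition of distributors. -/
def Distributors.comp {I J K : IndexedTangentCat.{v₁, u₁, v₂, u₂}} {F : I.base ⥤ J.base}
    {G : ∀ A, I.fib A ⥤ J.fib (F.obj A)} {F' : J.base ⥤ K.base}
    {G' : ∀ A, J.fib A ⥤ K.fib (F'.obj A)} (d : Distributors I J F G)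
    (e : Distributors J K F' G') :
    Distributors I K (F ⋙ F') (fun A => G A ⋙ G' (F.obj A)) where
  κ {A A'} f := NatIso.ofComponents
    (fun E => (G' (F.obj A)).mapIso ((d.κ f).app E) ≪≫ (e.κ (F.map f)).app ((G A').obj E))
    (fun {E E'} φ => by
      have h1 := (d.κ f).hom.naturality φ
      have h2 := (e.κ (F.map f)).hom.naturality ((G A').map φ)
      simp only [Functor.comp_map, Functor.comp_obj] at h1 h2
      change (G' (F.obj A)).map ((G A).map ((I.sub f).map φ)) ≫
        (G' (F.obj A)).map ((d.κ f).hom.app E') ≫ (e.κ (F.map f)).hom.app ((G A').obj E') =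
        ((G' (F.obj A)).map ((d.κ f).hom.app E) ≫ (e.κ (F.map f)).hom.app ((G A').obj E)) ≫
          (K.sub (F'.map (F.map f))).map ((G' (F.obj A')).map ((G A').map φ))
      rw [← Functor.map_comp_assoc, h1, Functor.map_comp_assoc, h2, Category.assoc])
  κ_id A E := by
    change (G' (F.obj A)).map ((G A).map ((I.str.unit A).hom.app E)) ≫
        (G' (F.obj A)).map ((d.κ (𝟙 A)).hom.app E) ≫ (e.κ (F.map (𝟙 A))).hom.app ((G A).obj E) =
      (K.str.unit (F'.obj (F.obj A))).hom.app ((G' (F.obj A)).obj ((G A).obj E)) ≫ _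
    rw [← Functor.map_comp_assoc, d.κ_id, Functor.map_comp_assoc, κ_congr e (F.map_id A).symm,
      ← Category.assoc, e.κ_id, Category.assoc, eqToHom_trans]
    rw [F.map_id]
  κ_comp {A A' A''} f g E := by
    have h := (e.κ (F.map f)).hom.naturality ((d.κ g).hom.app E)
    simp only [Functor.comp_map, Functor.comp_obj] at h
    change (G' (F.obj A)).map ((G A).map ((I.str.comp f g).hom.app E)) ≫
        (G' (F.obj A)).map ((d.κ (f ≫ g)).hom.app E) ≫
          (e.κ (F.map (f ≫ g))).hom.app ((G A'').obj E) =
      ((G' (F.obj A)).map ((d.κ f).hom.app ((I.sub g).obj E)) ≫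
        (e.κ (F.map f)).hom.app ((G A').obj ((I.sub g).obj E))) ≫
      (K.sub (F'.map (F.map f))).map ((G' (F.obj A')).map ((d.κ g).hom.app E) ≫
        (e.κ (F.map g)).hom.app ((G A'').obj E)) ≫
      (K.str.comp (F'.map (F.map f)) (F'.map (F.map g))).hom.app
        ((G' (F.obj A'')).obj ((G A'').obj E)) ≫ _
    rw [← Functor.map_comp_assoc, d.κ_comp]
    simp only [Functor.map_comp, Category.assoc]
    have hc := e.κ_comp (F.map f) (F.map g) ((G A'').obj E)
    rw [κ_congr e (F.map_comp f g).symm, reassoc_of% hc, reassoc_of% h, eqToHom_trans]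
    rw [F.map_comp]

/-- The category of indexed tangent categories and lax morphisms. -/
def INDXTNG := IndexedTangentCat.{v₁, u₁, v₂, u₂}

/-- The category of indexed tangent categories and colax morphisms. -/
def INDXTNGco := IndexedTangentCat.{v₁, u₁, v₂, u₂}

/-- The identity lax morphism. -/
def LaxIndexedHom.id (I : IndexedTangentCat.{v₁, u₁, v₂, u₂}) : LaxIndexedHom I I where
  base := 𝟭 _
  fib A := 𝟭 _
  dist := .id I
  baseLaw := .id _
  fibLaw A := .id _
  coherence {A A'} f E := by
    change (I.str.law f).β.app E ≫ 𝟙 _ ≫ (I.sub f).map (𝟙 _) =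
      𝟙 _ ≫ (I.fib A).T.map (𝟙 _) ≫ (I.str.law f).β.app E
    simp

/-- The identity colax morphism. -/
def ColaxIndexedHom.id (I : IndexedTangentCat.{v₁, u₁, v₂, u₂}) : ColaxIndexedHom I I where
  base := 𝟭 _
  fib A := 𝟭 _
  dist := .id I
  baseLaw := .id _
  fibLaw A := .id _
  coherence {A A'} f E := by
    change 𝟙 _ ≫ (I.str.law f).β.app E ≫ 𝟙 _ =
      (I.fib A).T.map (𝟙 _) ≫ (I.str.law f).β.app E ≫ (I.sub f).map (𝟙 _)
    simp

/-- Composition of lax morphisms. -/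
def LaxIndexedHom.comp {I J K : IndexedTangentCat.{v₁, u₁, v₂, u₂}} (φ : LaxIndexedHom I J)
    (ψ : LaxIndexedHom J K) : LaxIndexedHom I K where
  base := φ.base ⋙ ψ.base
  fib A := φ.fib A ⋙ ψ.fib (φ.base.obj A)
  dist := φ.dist.comp ψ.dist
  baseLaw := φ.baseLaw.comp ψ.baseLaw
  fibLaw A := (φ.fibLaw A).comp (ψ.fibLaw (φ.base.obj A))
  coherence {A A'} f E := by
    have h1 := congrArg (ψ.fib (φ.base.obj A)).map (φ.coherence f E)
    have h2 := ψ.coherence (φ.base.map f) ((φ.fib A').obj E)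
    have h3 := (ψ.dist.κ (φ.base.map f)).hom.naturality ((φ.fibLaw A').α.app E)
    have h4 := (ψ.fibLaw (φ.base.obj A)).α.naturality ((φ.dist.κ f).hom.app E)
    simp only [Functor.comp_map, Functor.comp_obj, Functor.map_comp] at h1 h2 h3 h4
    change (ψ.fib (φ.base.obj A)).map ((φ.fib A).map ((I.str.law f).β.app E)) ≫
        ((ψ.fib (φ.base.obj A)).map ((φ.dist.κ f).hom.app ((I.fib A').T.obj E)) ≫
          (ψ.dist.κ (φ.base.map f)).hom.app ((φ.fib A').obj ((I.fib A').T.obj E))) ≫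
        (K.sub (ψ.base.map (φ.base.map f))).map
          ((ψ.fib (φ.base.obj A')).map ((φ.fibLaw A').α.app E) ≫
            (ψ.fibLaw (φ.base.obj A')).α.app ((φ.fib A').obj E)) =
      ((ψ.fib (φ.base.obj A)).map ((φ.fibLaw A).α.app ((I.sub f).obj E)) ≫
          (ψ.fibLaw (φ.base.obj A)).α.app ((φ.fib A).obj ((I.sub f).obj E))) ≫
        (K.fib (ψ.base.obj (φ.base.obj A))).T.map
          ((ψ.fib (φ.base.obj A)).map ((φ.dist.κ f).hom.app E) ≫
            (ψ.dist.κ (φ.base.map f)).hom.app ((φ.fib A').obj E)) ≫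
        (K.str.law (ψ.base.map (φ.base.map f))).β.app
          ((ψ.fib (φ.base.obj A')).obj ((φ.fib A').obj E))
    simp only [Functor.map_comp, Category.assoc]
    rw [← reassoc_of% h3, reassoc_of% h1, h2, reassoc_of% h4]

/-- Composition of colax morphisms. -/
def ColaxIndexedHom.comp {I J K : IndexedTangentCat.{v₁, u₁, v₂, u₂}} (φ : ColaxIndexedHom I J)
    (ψ : ColaxIndexedHom J K) : ColaxIndexedHom I K where
  base := φ.base ⋙ ψ.base
  fib A := φ.fib A ⋙ ψ.fib (φ.base.obj A)
  dist := φ.dist.comp ψ.dist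
  baseLaw := φ.baseLaw.comp ψ.baseLaw
  fibLaw A := (φ.fibLaw A).comp (ψ.fibLaw (φ.base.obj A))
  coherence {A A'} f E := by
    have h1 := congrArg (ψ.fib (φ.base.obj A)).map (φ.coherence f E)
    have h2 := ψ.coherence (φ.base.map f) ((φ.fib A').obj E)
    have h3 := (ψ.dist.κ (φ.base.map f)).hom.naturality ((φ.fibLaw A').β.app E)
    have h4 := (ψ.fibLaw (φ.base.obj A)).β.naturality ((φ.dist.κ f).hom.app E)
    simp only [Functor.comp_map, Functor.comp_obj, Functor.map_comp] at h1 h2 h3 h4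
    change ((ψ.fibLaw (φ.base.obj A)).β.app ((φ.fib A).obj ((I.sub f).obj E)) ≫
          (ψ.fib (φ.base.obj A)).map ((φ.fibLaw A).β.app ((I.sub f).obj E))) ≫
        (ψ.fib (φ.base.obj A)).map ((φ.fib A).map ((I.str.law f).β.app E)) ≫
        ((ψ.fib (φ.base.obj A)).map ((φ.dist.κ f).hom.app ((I.fib A').T.obj E)) ≫
          (ψ.dist.κ (φ.base.map f)).hom.app ((φ.fib A').obj ((I.fib A').T.obj E))) =
        (K.fib (ψ.base.obj (φ.base.obj A))).T.map
          ((ψ.fib (φ.base.obj A)).map ((φ.dist.κ f).hom.app E) ≫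
            (ψ.dist.κ (φ.base.map f)).hom.app ((φ.fib A').obj E)) ≫
        (K.str.law (ψ.base.map (φ.base.map f))).β.app
          ((ψ.fib (φ.base.obj A')).obj ((φ.fib A').obj E)) ≫
        (K.sub (ψ.base.map (φ.base.map f))).map
          ((ψ.fibLaw (φ.base.obj A')).β.app ((φ.fib A').obj E) ≫
            (ψ.fib (φ.base.obj A')).map ((φ.fibLaw A').β.app E))
    simp only [Functor.map_comp, Category.assoc]
    rw [reassoc_of% h1, h3, ← reassoc_of% h2, reassoc_of% h4]

instance : Category INDXTNG.{v₁, u₁, v₂, u₂} where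
  Hom I J := LaxIndexedHom I J
  id I := LaxIndexedHom.id I
  comp φ ψ := LaxIndexedHom.comp φ ψ
  id_comp {I J} φ := LaxIndexedHom.mk_congr (F := φ.base) (G := φ.fib)
    (fun A A' f E => by
      change (φ.fib A).map (𝟙 _) ≫ (φ.dist.κ f).hom.app E = _
      simp)
    φ.baseLaw.id_comp (fun A => (φ.fibLaw A).id_comp) _ _
  comp_id {I J} φ := LaxIndexedHom.mk_congr (F := φ.base) (G := φ.fib)
    (fun A A' f E => by
      change (φ.dist.κ f).hom.app E ≫ 𝟙 _ = _
      simp)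
    φ.baseLaw.comp_id (fun A => (φ.fibLaw A).comp_id) _ _
  assoc {I J K L} φ ψ χ := LaxIndexedHom.mk_congr (F := φ.base ⋙ ψ.base ⋙ χ.base)
    (G := fun A => φ.fib A ⋙ ψ.fib _ ⋙ χ.fib _)
    (fun A A' f E => by
      change (χ.fib _).map ((ψ.fib _).map ((φ.dist.κ f).hom.app E) ≫
        (ψ.dist.κ _).hom.app _) ≫ (χ.dist.κ _).hom.app _ =
        (χ.fib _).map ((ψ.fib _).map ((φ.dist.κ f).hom.app E)) ≫
          (χ.fib _).map ((ψ.dist.κ _).hom.app _) ≫ (χ.dist.κ _).hom.app _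
      rw [Functor.map_comp, Category.assoc])
    (φ.baseLaw.assoc ψ.baseLaw χ.baseLaw)
    (fun A => (φ.fibLaw A).assoc (ψ.fibLaw _) (χ.fibLaw _)) _ _

instance : Category INDXTNGco.{v₁, u₁, v₂, u₂} where
  Hom I J := ColaxIndexedHom I J
  id I := ColaxIndexedHom.id I
  comp φ ψ := ColaxIndexedHom.comp φ ψ
  id_comp {I J} φ := ColaxIndexedHom.mk_congr (F := φ.base) (G := φ.fib)
    (fun A A' f E => by
      change (φ.fib A).map (𝟙 _) ≫ (φ.dist.κ f).hom.app E = _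
      simp)
    φ.baseLaw.id_comp (fun A => (φ.fibLaw A).id_comp) _ _
  comp_id {I J} φ := ColaxIndexedHom.mk_congr (F := φ.base) (G := φ.fib)
    (fun A A' f E => by
      change (φ.dist.κ f).hom.app E ≫ 𝟙 _ = _
      simp)
    φ.baseLaw.comp_id (fun A => (φ.fibLaw A).comp_id) _ _
  assoc {I J K L} φ ψ χ := ColaxIndexedHom.mk_congr (F := φ.base ⋙ ψ.base ⋙ χ.base)
    (G := fun A => φ.fib A ⋙ ψ.fib _ ⋙ χ.fib _)
    (fun A A' f E => by
      change (χ.fib _).map ((ψ.fib _).map ((φ.dist.κ f).hom.app E) ≫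
        (ψ.dist.κ _).hom.app _) ≫ (χ.dist.κ _).hom.app _ =
        (χ.fib _).map ((ψ.fib _).map ((φ.dist.κ f).hom.app E)) ≫
          (χ.fib _).map ((ψ.dist.κ _).hom.app _) ≫ (χ.dist.κ _).hom.app _
      rw [Functor.map_comp, Category.assoc])
    (φ.baseLaw.assoc ψ.baseLaw χ.baseLaw)
    (fun A => (φ.fibLaw A).assoc (ψ.fibLaw _) (χ.fibLaw _)) _ _

/-! ## Strong and strict morphisms -/

/-- Lax morphisms strict on the base. -/
def TNGFIB.strb : MorphismProperty TNGFIB.{v₁, u₁, v₂, u₂} := fun _ _ φ =>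
  (LaxHom.baseLaw φ).IsStrict

/-- Strong morphisms of tangent fibrations. -/
def TNGFIB.strong : MorphismProperty TNGFIB.{v₁, u₁, v₂, u₂} := fun _ _ φ =>
  (LaxHom.baseLaw φ).IsStrong ∧ (LaxHom.totalLaw φ).IsStrong

/-- Strict morphisms of tangent fibrations. -/
def TNGFIB.strict : MorphismProperty TNGFIB.{v₁, u₁, v₂, u₂} := fun _ _ φ =>
  (LaxHom.baseLaw φ).IsStrict ∧ (LaxHom.totalLaw φ).IsStrict

/-- Colax morphisms strict on the base. -/
def TNGFIBco.strb : MorphismProperty TNGFIBco.{v₁, u₁, v₂, u₂} := fun _ _ φ =>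
  (ColaxHom.baseLaw φ).IsStrict

/-- Strong morphisms of tangent fibrations. -/
def TNGFIBco.strong : MorphismProperty TNGFIBco.{v₁, u₁, v₂, u₂} := fun _ _ φ =>
  (ColaxHom.baseLaw φ).IsStrong ∧ (ColaxHom.totalLaw φ).IsStrong

/-- Strict morphisms of tangent fibrations. -/
def TNGFIBco.strict : MorphismProperty TNGFIBco.{v₁, u₁, v₂, u₂} := fun _ _ φ =>
  (ColaxHom.baseLaw φ).IsStrict ∧ (ColaxHom.totalLaw φ).IsStrict

/-- Colax morphisms both of whose functors preserve the tangent limits. -/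
def TNGFIBco.exact : MorphismProperty TNGFIBco.{v₁, u₁, v₂, u₂} := fun _ _ φ =>
  PreservesTangentLimits (ColaxHom.map φ).base ∧ PreservesTangentLimits (ColaxHom.map φ).total

/-- Lax morphisms sending (up to the distributive law, an identity in the strict case) the chosen
lift of `z_A` at `T' E` to the chosen lift of `z_{F A}` at `T' F' E`. -/
def TNGFIB.zeroCloven : MorphismProperty TNGFIB.{v₁, u₁, v₂, u₂} := fun P Q φ =>
  ∀ (A : P.base) (E : P.proj.Fiber A),
    ∃ h : (LaxHom.map φ).total.obj ((P.fiberT A).obj E).1 =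
        ((Q.fiberT _).obj (((LaxHom.map φ).fiber A).obj E)).1,
      (LaxHom.map φ).total.map (P.zeroLift E) ≫ (LaxHom.totalLaw φ).α.app E.1 =
        eqToHom h ≫ Q.zeroLift (((LaxHom.map φ).fiber A).obj E)

/-- Colax morphisms sending (up to the distributive law, an identity in the strict case) the
chosen lift of `z_A` at `T' E` to the chosen lift of `z_{F A}` at `T' F' E`. -/
def TNGFIBco.zeroCloven : MorphismProperty TNGFIBco.{v₁, u₁, v₂, u₂} := fun P Q φ =>
  ∀ (A : P.base) (E : P.proj.Fiber A),
    ∃ h : ((Q.fiberT _).obj (((ColaxHom.map φ).fiber A).obj E)).1 =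
        (ColaxHom.map φ).total.obj ((P.fiberT A).obj E).1,
      Q.zeroLift (((ColaxHom.map φ).fiber A).obj E) ≫ (ColaxHom.totalLaw φ).β.app E.1 =
        eqToHom h ≫ (ColaxHom.map φ).total.map (P.zeroLift E)

/-- Lax morphisms strict on the base. -/
def INDXTNG.strb : MorphismProperty INDXTNG.{v₁, u₁, v₂, u₂} := fun _ _ φ =>
  (LaxIndexedHom.baseLaw φ).IsStrict

/-- Strong morphisms of indexed tangent categories. -/
def INDXTNG.strong : MorphismProperty INDXTNG.{v₁, u₁, v₂, u₂} := fun _ _ φ =>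
  (LaxIndexedHom.baseLaw φ).IsStrong ∧ ∀ A, (LaxIndexedHom.fibLaw φ A).IsStrong

/-- Strict morphisms of indexed tangent categories. -/
def INDXTNG.strict : MorphismProperty INDXTNG.{v₁, u₁, v₂, u₂} := fun _ _ φ =>
  (LaxIndexedHom.baseLaw φ).IsStrict ∧ ∀ A, (LaxIndexedHom.fibLaw φ A).IsStrict

/-- Colax morphisms strict on the base. -/
def INDXTNGco.strb : MorphismProperty INDXTNGco.{v₁, u₁, v₂, u₂} := fun _ _ φ =>
  (ColaxIndexedHom.baseLaw φ).IsStrict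

/-- Strong morphisms of indexed tangent categories. -/
def INDXTNGco.strong : MorphismProperty INDXTNGco.{v₁, u₁, v₂, u₂} := fun _ _ φ =>
  (ColaxIndexedHom.baseLaw φ).IsStrong ∧ ∀ A, (ColaxIndexedHom.fibLaw φ A).IsStrong

/-- Strict morphisms of indexed tangent categories. -/
def INDXTNGco.strict : MorphismProperty INDXTNGco.{v₁, u₁, v₂, u₂} := fun _ _ φ =>
  (ColaxIndexedHom.baseLaw φ).IsStrict ∧ ∀ A, (ColaxIndexedHom.fibLaw φ A).IsStrict

/-- Colax morphisms all of whose functors preserve the tangent limits. -/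
def INDXTNGco.exact : MorphismProperty INDXTNGco.{v₁, u₁, v₂, u₂} := fun _ _ φ =>
  PreservesTangentLimits (ColaxIndexedHom.base φ) ∧
    ∀ A, PreservesTangentLimits (ColaxIndexedHom.fib φ A)

instance : TNGFIB.strb.{v₁, u₁, v₂, u₂}.IsMultiplicative where
  id_mem P := LaxLaw.IsStrict.id P.base
  comp_mem _ _ h h' := LaxLaw.IsStrict.comp h h'

instance : TNGFIBco.strb.{v₁, u₁, v₂, u₂}.IsMultiplicative where
  id_mem P := ColaxLaw.IsStrict.id P.base
  comp_mem _ _ h h' := ColaxLaw.IsStrict.comp h h'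

instance : INDXTNG.strb.{v₁, u₁, v₂, u₂}.IsMultiplicative where
  id_mem I := LaxLaw.IsStrict.id I.base
  comp_mem _ _ h h' := LaxLaw.IsStrict.comp h h'

instance : INDXTNGco.strb.{v₁, u₁, v₂, u₂}.IsMultiplicative where
  id_mem I := ColaxLaw.IsStrict.id I.base
  comp_mem _ _ h h' := ColaxLaw.IsStrict.comp h h'

instance : TNGFIB.strong.{v₁, u₁, v₂, u₂}.IsMultiplicative where
  id_mem P := ⟨(LaxLaw.IsStrict.id P.base).isStrong, (LaxLaw.IsStrict.id P.total).isStrong⟩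
  comp_mem _ _ h h' := ⟨LaxLaw.IsStrong.comp h.1 h'.1, LaxLaw.IsStrong.comp h.2 h'.2⟩

instance : TNGFIBco.strong.{v₁, u₁, v₂, u₂}.IsMultiplicative where
  id_mem P := ⟨(ColaxLaw.IsStrict.id P.base).isStrong, (ColaxLaw.IsStrict.id P.total).isStrong⟩
  comp_mem _ _ h h' := ⟨ColaxLaw.IsStrong.comp h.1 h'.1, ColaxLaw.IsStrong.comp h.2 h'.2⟩

instance : TNGFIB.strict.{v₁, u₁, v₂, u₂}.IsMultiplicative where
  id_mem P := ⟨LaxLaw.IsStrict.id P.base, LaxLaw.IsStrict.id P.total⟩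
  comp_mem _ _ h h' := ⟨LaxLaw.IsStrict.comp h.1 h'.1, LaxLaw.IsStrict.comp h.2 h'.2⟩

instance : TNGFIBco.strict.{v₁, u₁, v₂, u₂}.IsMultiplicative where
  id_mem P := ⟨ColaxLaw.IsStrict.id P.base, ColaxLaw.IsStrict.id P.total⟩
  comp_mem _ _ h h' := ⟨ColaxLaw.IsStrict.comp h.1 h'.1, ColaxLaw.IsStrict.comp h.2 h'.2⟩

instance : INDXTNG.strong.{v₁, u₁, v₂, u₂}.IsMultiplicative where
  id_mem I := ⟨(LaxLaw.IsStrict.id I.base).isStrong,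
    fun A => (LaxLaw.IsStrict.id (I.fib A)).isStrong⟩
  comp_mem _ _ h h' := ⟨LaxLaw.IsStrong.comp h.1 h'.1,
    fun A => LaxLaw.IsStrong.comp (h.2 A) (h'.2 _)⟩

instance : INDXTNGco.strong.{v₁, u₁, v₂, u₂}.IsMultiplicative where
  id_mem I := ⟨(ColaxLaw.IsStrict.id I.base).isStrong,
    fun A => (ColaxLaw.IsStrict.id (I.fib A)).isStrong⟩
  comp_mem _ _ h h' := ⟨ColaxLaw.IsStrong.comp h.1 h'.1,
    fun A => ColaxLaw.IsStrong.comp (h.2 A) (h'.2 _)⟩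

instance : INDXTNG.strict.{v₁, u₁, v₂, u₂}.IsMultiplicative where
  id_mem I := ⟨LaxLaw.IsStrict.id I.base, fun A => LaxLaw.IsStrict.id (I.fib A)⟩
  comp_mem _ _ h h' := ⟨LaxLaw.IsStrict.comp h.1 h'.1,
    fun A => LaxLaw.IsStrict.comp (h.2 A) (h'.2 _)⟩

instance : INDXTNGco.strict.{v₁, u₁, v₂, u₂}.IsMultiplicative where
  id_mem I := ⟨ColaxLaw.IsStrict.id I.base, fun A => ColaxLaw.IsStrict.id (I.fib A)⟩
  comp_mem _ _ h h' := ⟨ColaxLaw.IsStrict.comp h.1 h'.1,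
    fun A => ColaxLaw.IsStrict.comp (h.2 A) (h'.2 _)⟩

/-! ## The indexed tangent category of a tangent fibration -/

/-- The tangent structures on the fibres of a tangent fibration, with tangent bundle functors
`z^* T'`, and the distributive laws of the substitution functors. The structure morphisms are
determined, through the cartesian lifts of the zero morphisms, by those of the total category. -/
structure FibreStr (P : TangentFibration.{v₁, u₁, v₂, u₂}) where
  str (A : P.base) : TangentStructure (P.fiberT A)
  idx : PseudoStr P.base (fun A => ⟨P.proj.Fiber A, P.fiberT A, str A⟩) P.sub
  p_eq {A : P.base} (E : P.proj.Fiber A) :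
    ((str A).p.app E).1 = P.zeroLift E ≫ P.total.str.p.app E.1
  z_eq {A : P.base} (E : P.proj.Fiber A) :
    ((str A).z.app E).1 ≫ P.zeroLift E = P.total.str.z.app E.1
  s_eq {A : P.base} (E : P.proj.Fiber A) (w : ((str A).T₂.obj E).1 ⟶ P.total.str.T₂.obj E.1) :
    w ≫ P.total.str.π₁.app E.1 = ((str A).π₁.app E).1 ≫ P.zeroLift E →
    w ≫ P.total.str.π₂.app E.1 = ((str A).π₂.app E).1 ≫ P.zeroLift E →
    ((str A).s.app E).1 ≫ P.zeroLift E = w ≫ P.total.str.s.app E.1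
  l_eq {A : P.base} (E : P.proj.Fiber A) :
    ((str A).l.app E).1 ≫ P.zeroLift ((P.fiberT A).obj E) ≫ P.total.T.map (P.zeroLift E) =
      P.zeroLift E ≫ P.total.str.l.app E.1
  c_eq {A : P.base} (E : P.proj.Fiber A) :
    ((str A).c.app E).1 ≫ P.zeroLift ((P.fiberT A).obj E) ≫ P.total.T.map (P.zeroLift E) =
      (P.zeroLift ((P.fiberT A).obj E) ≫ P.total.T.map (P.zeroLift E)) ≫ P.total.str.c.app E.1
  law_eq {A A' : P.base} (f : A ⟶ A') (E : P.proj.Fiber A') :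
    ((idx.law f).β.app E).1 ≫ P.lift f ((P.fiberT A').obj E) ≫ P.zeroLift E =
      P.zeroLift (P.pull f E) ≫ P.total.T.map (P.lift f E)
  unit_eq (A : P.base) (E : P.proj.Fiber A) :
    ((idx.unit A).hom.app E).1 ≫ P.lift (𝟙 A) E = 𝟙 E.1
  comp_eq {A A' A'' : P.base} (f : A ⟶ A') (g : A' ⟶ A'') (E : P.proj.Fiber A'') :
    ((idx.comp f g).hom.app E).1 ≫ P.lift (f ≫ g) E = P.lift f (P.pull g E) ≫ P.lift g E

/-- The associated indexed tangent category. -/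
noncomputable def FibreStr.indexed {P : TangentFibration.{v₁, u₁, v₂, u₂}} (cc : FibreStr P) :
    IndexedTangentCat.{v₁, u₁, v₂, u₂} :=
  ⟨P.base, fun A => ⟨P.proj.Fiber A, P.fiberT A, cc.str A⟩, P.sub, cc.idx⟩

section Induced

variable {P Q : TangentFibration.{v₁, u₁, v₂, u₂}}

/-- The distributors are those of the morphism of fibrations, induced by the cartesian lifts. -/
def FibrationMap.IsDistributors (m : FibrationMap P Q) (cP : FibreStr P) (cQ : FibreStr Q)
    (d : Distributors cP.indexed cQ.indexed m.base m.fiber) : Prop :=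
  ∀ {A A' : P.base} (f : A ⟶ A') (E : P.proj.Fiber A'),
    ((d.κ f).hom.app E).1 ≫ Q.lift (m.base.map f) ((m.fiber A').obj E) = m.total.map (P.lift f E)

/-- `ψ` is the lax morphism of indexed tangent categories induced by the lax morphism `φ` of
tangent fibrations: it has the same base, it restricts `φ` to the fibres, its distributive laws
are those induced by that of `φ` and the cartesian lifts of the zero morphisms, and its
distributors are those of `φ`. -/
def LaxHom.Induces (φ : LaxHom P Q) (cP : FibreStr P) (cQ : FibreStr Q)
    (ψ : LaxIndexedHom cP.indexed cQ.indexed) : Prop :=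
  ∃ (d : Distributors cP.indexed cQ.indexed φ.map.base φ.map.fiber)
    (β : ∀ A, LaxLaw (X := cP.indexed.fib A) (Y := cQ.indexed.fib (φ.map.base.obj A))
      (φ.map.fiber A)) (h : _),
    ψ = ⟨φ.map.base, φ.map.fiber, d, φ.baseLaw, β, h⟩ ∧
    φ.map.IsDistributors cP cQ d ∧
    ∀ (A : P.base) (E : P.proj.Fiber A),
      ((β A).α.app E).1 ≫ Q.zeroLift ((φ.map.fiber A).obj E) =
        φ.map.total.map (P.zeroLift E) ≫ φ.totalLaw.α.app E.1

/-- `ψ` is the colax morphism of indexed tangent categories induced by the colax morphism `φ` of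
tangent fibrations. -/
def ColaxHom.Induces (φ : ColaxHom P Q) (cP : FibreStr P) (cQ : FibreStr Q)
    (ψ : ColaxIndexedHom cP.indexed cQ.indexed) : Prop :=
  ∃ (d : Distributors cP.indexed cQ.indexed φ.map.base φ.map.fiber)
    (β : ∀ A, ColaxLaw (X := cP.indexed.fib A) (Y := cQ.indexed.fib _) (φ.map.fiber A)) (h : _),
    ψ = ⟨φ.map.base, φ.map.fiber, d, φ.baseLaw, β, h⟩ ∧
    φ.map.IsDistributors cP cQ d ∧
    ∀ (A : P.base) (E : P.proj.Fiber A),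
      ((β A).β.app E).1 ≫ φ.map.total.map (P.zeroLift E) =
        Q.zeroLift ((φ.map.fiber A).obj E) ≫ φ.totalLaw.β.app E.1

end Induced

end TangentTheory

open TangentTheory

namespace TangentTheory

/-! ## Morphisms and limits in the fibres of a functor -/

section Fibre

variable {S : Type u₁} [Category.{v₁} S] {E : Type u₂} [Category.{v₂} E] {p : E ⥤ S}

/-! Cartesian morphisms out of a fibre control everything that happens in it. If x is cartesian, a
vertical morphism into its domain is determined by its composite with x (`fiber_ext`), and a
morphism into its codomain factors vertically through x as soon as it lies over the right morphism
of the base (`fiberLift`).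

Hence the zero, sum, lift and flip of the fibre over A are lifts of those of T' through ζ : T^A E ⟶
T'E or through its iterate, which is cartesian because T' preserves cartesian morphisms; the
projection is ζ followed by that of T'. The lifts exist because in the base z p = 1, z l = z T(z)
and z T(z) c = z T(z). An equation in the fibre is tested after composition with an iterate of ζ,
where it becomes the same equation for T'.

Limits restrict to fibres by the same principle. A cone in the fibre gives a cone in the total
category, hence a morphism into the total limit; as the projection preserves that limit, the
projection of this morphism is forced, so it lifts to the fibre. The n-fold pullback over E is cut
out by pulling T'_n E back along the projection of the zero morphism E ⟶ T'_n E. More generally, a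
functor G between fibres joined to a functor G' of total categories by natural cartesian morphisms
(`FiberComparison`) preserves the tangent limits whenever G' and its composite with the projection
do. This is applied to the identity, to the iterates of T', to substitution (compared with the
identity) and to the restrictions of F'.

The law α^f compares two cartesian morphisms into T'E, over z T(f) and f z; these agree by
naturality of z, so α^f is invertible. The coherence isomorphisms and the distributors are
comparisons of the same kind.

For morphisms, a lax law lifts F'ζ β' through ζ at F'E, and a colax law lifts ζ β' through F'ζ. The
cases differ at the sum. In the lax case the codomain is a pullback in a fibre. In the colax case
F^A T_2 E need not be one: the given morphism T'_2 F' ⟶ F' T_2 is lifted instead, which only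
requires F to preserve the limits of the base, and this is part of being strict on the base. -/

theorem isHomLift_congr {A B : S} {f g : A ⟶ B} {a b : E} {φ ψ : a ⟶ b}
    (hf : p.IsHomLift f φ) (h : f = g) (h' : φ = ψ) : p.IsHomLift g ψ := by
  subst h h'; exact hf

/-- The morphism of a fibre induced by a cartesian morphism. -/
noncomputable def fiberLift {A B : S} {W X : p.Fiber A} {f : A ⟶ B} {Y : E} (x : X.1 ⟶ Y)
    (hx : p.IsStronglyCartesian f x) (ψ : W.1 ⟶ Y) (hψ : p.IsHomLift f ψ) : W ⟶ X :=
  ⟨Functor.IsStronglyCartesian.map p f x (Category.id_comp f).symm ψ, inferInstance⟩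

theorem fiberLift_fac {A B : S} {W X : p.Fiber A} {f : A ⟶ B} {Y : E} (x : X.1 ⟶ Y)
    (hx : p.IsStronglyCartesian f x) (ψ : W.1 ⟶ Y) (hψ : p.IsHomLift f ψ) :
    (fiberLift x hx ψ hψ).1 ≫ x = ψ :=
  Functor.IsStronglyCartesian.fac p f x (Category.id_comp f).symm ψ

/-- Two vertical morphisms are lifts of the same identity, so the uniqueness half of cartesianness
separates them. Nearly every equation in a fibre is proved this way. -/
theorem fiber_ext {A B : S} {W X : p.Fiber A} {f : A ⟶ B} {Y : E} (x : X.1 ⟶ Y)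
    (hx : p.IsStronglyCartesian f x) {φ ψ : W ⟶ X} (h : φ.1 ≫ x = ψ.1 ≫ x) : φ = ψ := by
  have := φ.2
  have := ψ.2
  exact Subtype.ext (Functor.IsStronglyCartesian.ext p f x (𝟙 A) h)

theorem isCartesian_comp {A B C : S} {f : A ⟶ B} {g : B ⟶ C} {a b c : E} {φ : a ⟶ b} {ψ : b ⟶ c}
    (hφ : p.IsStronglyCartesian f φ) (hψ : p.IsStronglyCartesian g ψ) :
    p.IsStronglyCartesian (f ≫ g) (φ ≫ ψ) :=
  inferInstance

theorem isCartesian_congr {A B : S} {f g : A ⟶ B} {a b : E} {φ ψ : a ⟶ b}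
    (hf : p.IsStronglyCartesian f φ) (h : f = g) (h' : φ = ψ) : p.IsStronglyCartesian g ψ := by
  subst h h'; exact hf

/-- Isomorphisms of a fibre are cartesian. -/
theorem isCartesian_fiber_iso {A : S} {X Y : p.Fiber A} (e : X ≅ Y) :
    p.IsStronglyCartesian (𝟙 A) e.hom.1 := by
  have := e.hom.2
  have : IsIso e.hom.1 := ⟨e.inv.1, congrArg Subtype.val e.hom_inv_id,
    congrArg Subtype.val e.inv_hom_id⟩
  infer_instance

/-- A morphism of a fibre whose composite with a cartesian morphism is cartesian over the same
morphism of the base is an isomorphism. -/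
theorem isIso_fiber {A B : S} {W X : p.Fiber A} {f : A ⟶ B} {Y : E} {x : X.1 ⟶ Y}
    (hx : p.IsStronglyCartesian f x) (φ : W ⟶ X) (h : p.IsStronglyCartesian f (φ.1 ≫ x)) :
    IsIso φ := by
  refine ⟨fiberLift (φ.1 ≫ x) h x hx.toIsHomLift, ?_, ?_⟩
  · refine fiber_ext (φ.1 ≫ x) h ?_
    change (φ.1 ≫ (fiberLift (φ.1 ≫ x) h x hx.toIsHomLift).1) ≫ φ.1 ≫ x = 𝟙 W.1 ≫ φ.1 ≫ x
    rw [Category.assoc, fiberLift_fac, Category.id_comp]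
  · refine fiber_ext x hx ?_
    change ((fiberLift (φ.1 ≫ x) h x hx.toIsHomLift).1 ≫ φ.1) ≫ x = 𝟙 X.1 ≫ x
    rw [Category.assoc, fiberLift_fac, Category.id_comp]

/-- Objects of a fibre lie over A only up to a propositional equality, so a vertical morphism
projects to an `eqToHom` and not literally to an identity. The limit arguments use verticality in
this form. -/
theorem fiber_map_proj {A : S} {W X : p.Fiber A} (φ : W ⟶ X) :
    p.map φ.1 = eqToHom (W.2.trans X.2.symm) := by
  have := φ.2
  rw [IsHomLift.fac' p (𝟙 A) φ.1]
  simp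

theorem isCartesian_proj_map {A B : S} {f : A ⟶ B} {a b : E} {φ : a ⟶ b}
    (h : p.IsStronglyCartesian f φ) : p.IsStronglyCartesian (p.map φ) φ := by
  obtain ⟨⟩ := h.toIsHomLift
  exact h

/-- Lifting a morphism through a cartesian one, with its projection compared in the base. -/
theorem exists_fiberLift {A B : S} {W X : p.Fiber A} {f : A ⟶ B} {Y : E} {x : X.1 ⟶ Y}
    (hx : p.IsStronglyCartesian f x) (ψ : W.1 ⟶ Y)
    (hψ : p.map ψ = eqToHom (W.2.trans X.2.symm) ≫ p.map x) : ∃ r : W ⟶ X, r.1 ≫ x = ψ := by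
  have h1 := hx.toIsHomLift
  refine ⟨fiberLift x hx ψ ?_, fiberLift_fac _ _ _ _⟩
  refine IsHomLift.of_fac' _ _ _ W.2 (IsHomLift.codomain_eq p f x) ?_
  rw [hψ, IsHomLift.fac' p f x]
  simp

theorem isPullback_of_existsUnique {C : Type u} [Category.{v} C] {P X Y Z : C} {a : P ⟶ X}
    {b : P ⟶ Y} {f : X ⟶ Z} {g : Y ⟶ Z} (w : a ≫ f = b ≫ g)
    (h : ∀ {W : C} (s : W ⟶ X) (t : W ⟶ Y), s ≫ f = t ≫ g → ∃ r : W ⟶ P, r ≫ a = s ∧ r ≫ b = t)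
    (h' : ∀ {W : C} (r r' : W ⟶ P), r ≫ a = r' ≫ a → r ≫ b = r' ≫ b → r = r') :
    IsPullback a b f g := by
  refine ⟨⟨w⟩, ⟨PullbackCone.IsLimit.mk w
      (fun t => (h t.fst t.snd t.condition).choose) ?_ ?_ ?_⟩⟩
  · exact fun t => (h t.fst t.snd t.condition).choose_spec.1
  · exact fun t => (h t.fst t.snd t.condition).choose_spec.2
  · intro t m h1 h2
    have := (h t.fst t.snd t.condition).choose_spec
    exact h' _ _ (h1.trans this.1.symm) (h2.trans this.2.symm)

theorem IsNFoldPullback.hom_ext {C : Type u} [Category.{v} C] {X B P : C} {q : X ⟶ B} {n : ℕ}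
    {b : P ⟶ B} {π : Fin n → (P ⟶ X)} (h : IsNFoldPullback q b π) {W : C} {r r' : W ⟶ P}
    (hb : r ≫ b = r' ≫ b) (hπ : ∀ i, r ≫ π i = r' ≫ π i) : r = r' := by
  obtain ⟨h, hu⟩ := isNFoldPullback_iff.1 h
  exact (hu (r' ≫ b) (fun i => r' ≫ π i) (fun i => by rw [Category.assoc, h])).unique
    ⟨hb, hπ⟩ ⟨rfl, fun _ => rfl⟩

/-- An `n`-fold pullback preserved by `p`, restricted along cartesian morphisms to a fibre, is an
`n`-fold pullback of the fibre. -/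
theorem isNFoldPullback_fiber {A B C D : S} {X₀ Y₀ P₀ : p.Fiber A} {q₀ : X₀ ⟶ Y₀} {n : ℕ}
    {b₀ : P₀ ⟶ Y₀} {π₀ : Fin n → (P₀ ⟶ X₀)} {X Y P : E} {q : X ⟶ Y} {b : P ⟶ Y}
    {π : Fin n → (P ⟶ X)} (h : IsNFoldPullback q b π)
    (h' : IsNFoldPullback (p.map q) (p.map b) (fun i => p.map (π i)))
    {f : A ⟶ B} {x : X₀.1 ⟶ X} (hx : p.IsStronglyCartesian f x)
    {g : A ⟶ C} {y : Y₀.1 ⟶ Y} (hy : p.IsStronglyCartesian g y)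
    {k : A ⟶ D} {t : P₀.1 ⟶ P} (ht : p.IsStronglyCartesian k t)
    (eq : q₀.1 ≫ y = x ≫ q) (eb : b₀.1 ≫ y = t ≫ b) (eπ : ∀ i, (π₀ i).1 ≫ x = t ≫ π i) :
    IsNFoldPullback q₀ b₀ π₀ := by
  obtain ⟨hw, hu⟩ := isNFoldPullback_iff.1 h
  refine isNFoldPullback_iff.2 ⟨fun i => ?_, fun {W} b' π' hb' => ?_⟩
  · refine fiber_ext y hy ?_
    change ((π₀ i).1 ≫ q₀.1) ≫ y = b₀.1 ≫ y
    rw [Category.assoc, eq, ← Category.assoc, eπ, Category.assoc, hw, eb]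
  -- Composing the cone of the fibre with the cartesian morphisms gives a cone of the total
  -- category, with induced morphism r.
  · obtain ⟨r, ⟨hr, hr'⟩, -⟩ := hu (b'.1 ≫ y) (fun i => (π' i).1 ≫ x) (fun i => by
      rw [Category.assoc, ← eq, ← Category.assoc]
      exact congrArg (· ≫ y) (congrArg Subtype.val (hb' i)))
    -- To lift r through t its projection must be that of t. The projected legs are jointly monic by
    -- `h'`, and after each of them both sides are the projection of x or y preceded by an
    -- `eqToHom`.
    obtain ⟨r₀, hr₀⟩ := exists_fiberLift ht r (h'.hom_ext (by
        rw [← p.map_comp, hr, Category.assoc, ← p.map_comp, ← eb, p.map_comp, p.map_comp,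
          fiber_map_proj, fiber_map_proj, eqToHom_trans_assoc]) (fun i => by
        rw [← p.map_comp, hr', Category.assoc, ← p.map_comp, ← eπ, p.map_comp, p.map_comp,
          fiber_map_proj, fiber_map_proj, eqToHom_trans_assoc]))
    refine ⟨r₀, ⟨fiber_ext y hy ?_, fun i => fiber_ext x hx ?_⟩, fun r₁ ⟨h1, h2⟩ => ?_⟩
    · change (r₀.1 ≫ b₀.1) ≫ y = _
      rw [Category.assoc, eb, reassoc_of% hr₀, hr]
    · change (r₀.1 ≫ (π₀ i).1) ≫ x = _
      rw [Category.assoc, eπ, reassoc_of% hr₀, hr']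
    · refine fiber_ext t ht (h.hom_ext ?_ fun i => ?_)
      · rw [Category.assoc, ← eb, hr₀, hr, ← h1]
        exact (Category.assoc _ _ _).symm
      · rw [Category.assoc, ← eπ, hr₀, hr', ← h2]
        exact (Category.assoc _ _ _).symm

/-- A pullback square preserved by `p`, restricted along cartesian morphisms to a fibre, is a
pullback square of the fibre. -/
theorem isPullback_fiber {A B C D F : S} {X₀ Y₀ Z₀ P₀ : p.Fiber A} {a₀ : P₀ ⟶ X₀} {b₀ : P₀ ⟶ Y₀}
    {f₀ : X₀ ⟶ Z₀} {g₀ : Y₀ ⟶ Z₀} {X Y Z P : E} {a : P ⟶ X} {b : P ⟶ Y} {f : X ⟶ Z} {g : Y ⟶ Z}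
    (h : IsPullback a b f g) (h' : IsPullback (p.map a) (p.map b) (p.map f) (p.map g))
    {k : A ⟶ B} {x : X₀.1 ⟶ X} (hx : p.IsStronglyCartesian k x)
    {l : A ⟶ C} {y : Y₀.1 ⟶ Y} (hy : p.IsStronglyCartesian l y)
    {m : A ⟶ F} {z : Z₀.1 ⟶ Z} (hz : p.IsStronglyCartesian m z)
    {n : A ⟶ D} {t : P₀.1 ⟶ P} (ht : p.IsStronglyCartesian n t)
    (ea : a₀.1 ≫ x = t ≫ a) (eb : b₀.1 ≫ y = t ≫ b) (ef : f₀.1 ≫ z = x ≫ f)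
    (eg : g₀.1 ≫ z = y ≫ g) : IsPullback a₀ b₀ f₀ g₀ := by
  refine isPullback_of_existsUnique (fiber_ext z hz ?_) (fun {W} s t' hst => ?_)
    (fun {W} r r' h1 h2 => ?_)
  · change (a₀.1 ≫ f₀.1) ≫ z = (b₀.1 ≫ g₀.1) ≫ z
    rw [Category.assoc, Category.assoc, ef, eg, reassoc_of% ea, reassoc_of% eb, h.w]
  · have hw : (s.1 ≫ x) ≫ f = (t'.1 ≫ y) ≫ g := by
      rw [Category.assoc, Category.assoc, ← ef, ← eg, ← Category.assoc, ← Category.assoc]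
      exact congrArg (· ≫ z) (congrArg Subtype.val hst)
    -- The projected square is a pullback, so the projection of the induced morphism is determined
    -- by its two legs; it is that of t up to `eqToHom`, and the morphism lifts.
    obtain ⟨r, hr⟩ := exists_fiberLift ht (h.lift _ _ hw) (h'.hom_ext (by
        rw [← p.map_comp, h.lift_fst, Category.assoc, ← p.map_comp, ← ea, p.map_comp, p.map_comp,
          fiber_map_proj, fiber_map_proj, eqToHom_trans_assoc]) (by
        rw [← p.map_comp, h.lift_snd, Category.assoc, ← p.map_comp, ← eb, p.map_comp, p.map_comp,
          fiber_map_proj, fiber_map_proj, eqToHom_trans_assoc]))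
    refine ⟨r, fiber_ext x hx ?_, fiber_ext y hy ?_⟩
    · change (r.1 ≫ a₀.1) ≫ x = _
      rw [Category.assoc, ea, reassoc_of% hr, h.lift_fst]
    · change (r.1 ≫ b₀.1) ≫ y = _
      rw [Category.assoc, eb, reassoc_of% hr, h.lift_snd]
  · refine fiber_ext t ht (h.hom_ext ?_ ?_)
    · have := congrArg (· ≫ x) (congrArg Subtype.val h1)
      change (r.1 ≫ a₀.1) ≫ x = (r'.1 ≫ a₀.1) ≫ x at this
      simpa only [Category.assoc, ea] using this
    · have := congrArg (· ≫ y) (congrArg Subtype.val h2)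
      change (r.1 ≫ b₀.1) ≫ y = (r'.1 ≫ b₀.1) ≫ y at this
      simpa only [Category.assoc, eb] using this

end Fibre

/-! ## Projections of the tangent structure -/

namespace TangentFibration

variable (P : TangentFibration.{v₁, u₁, v₂, u₂})

theorem preservesTangentLimits_proj : PreservesTangentLimits P.proj := by
  obtain ⟨L, -, h⟩ := P.proj_strict
  exact h

/-- The law of the strict morphism Π is an `eqToHom`, so its compatibility with the projection says
that p' lies over p up to transport, which is what `IsHomLift` expresses. The zero, lift and flip
are treated alike from the corresponding axioms of the law. -/
theorem isHomLift_p {A : P.base} (E : P.proj.Fiber A) :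
    P.proj.IsHomLift (P.base.str.p.app A : P.base.T.obj A ⟶ A)
      (P.total.str.p.app E.1 : P.total.T.obj E.1 ⟶ E.1) := by
  obtain ⟨E, rfl⟩ := E
  obtain ⟨L, ⟨e, he⟩, -⟩ := P.proj_strict
  have h := (L.additive E).proj
  change P.base.str.p.app (P.proj.obj E) ≫ 𝟙 _ = L.β.app E ≫ P.proj.map (P.total.str.p.app E) at h
  rw [he, eqToHom_app, Category.comp_id] at h
  refine IsHomLift.of_fac _ _ _ (Functor.congr_obj P.T_proj E) rfl ?_
  rw [eqToHom_refl, Category.comp_id]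
  exact h

theorem isHomLift_z {A : P.base} (E : P.proj.Fiber A) :
    P.proj.IsHomLift (P.base.str.z.app A : A ⟶ P.base.T.obj A)
      (P.total.str.z.app E.1 : E.1 ⟶ P.total.T.obj E.1) := by
  obtain ⟨E, rfl⟩ := E
  obtain ⟨L, ⟨e, he⟩, -⟩ := P.proj_strict
  have h := (L.additive E).zero
  change P.base.str.z.app (P.proj.obj E) ≫ L.β.app E =
    𝟙 _ ≫ P.proj.map (P.total.str.z.app E) at h
  rw [he, eqToHom_app, Category.id_comp] at h
  refine IsHomLift.of_commsq _ _ _ rfl (Functor.congr_obj P.T_proj E) ?_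
  rw [eqToHom_refl, Category.id_comp]
  change P.proj.map (P.total.str.z.app E) ≫ eqToHom _ = P.base.str.z.app (P.proj.obj E)
  rw [← h, Category.assoc, eqToHom_trans, eqToHom_refl, Category.comp_id]

theorem T_obj_proj {A : P.base} (E : P.proj.Fiber A) :
    P.proj.obj (P.total.T.obj E.1) = P.base.T.obj A :=
  ((P.totalT A).obj E).2

theorem TT_obj_proj {A : P.base} (E : P.proj.Fiber A) :
    P.proj.obj (P.total.T.obj (P.total.T.obj E.1)) = P.base.T.obj (P.base.T.obj A) :=
  ((P.totalT _).obj ((P.totalT A).obj E)).2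

theorem isHomLift_l {A : P.base} (E : P.proj.Fiber A) :
    P.proj.IsHomLift (P.base.str.l.app A : P.base.T.obj A ⟶ P.base.T.obj (P.base.T.obj A))
      (P.total.str.l.app E.1 : P.total.T.obj E.1 ⟶ P.total.T.obj (P.total.T.obj E.1)) := by
  obtain ⟨E, rfl⟩ := E
  obtain ⟨L, ⟨e, he⟩, -⟩ := P.proj_strict
  have h := L.lift E
  rw [he, eqToHom_app, eqToHom_app, eqToHom_map, eqToHom_trans] at h
  refine IsHomLift.of_fac _ _ _ (P.T_obj_proj ⟨E, rfl⟩) (P.TT_obj_proj ⟨E, rfl⟩) ?_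
  rw [← reassoc_of% h, eqToHom_trans]
  exact (Category.comp_id _).symm

theorem isHomLift_c {A : P.base} (E : P.proj.Fiber A) :
    P.proj.IsHomLift
      (P.base.str.c.app A : P.base.T.obj (P.base.T.obj A) ⟶ P.base.T.obj (P.base.T.obj A))
      (P.total.str.c.app E.1 : P.total.T.obj (P.total.T.obj E.1) ⟶ _) := by
  obtain ⟨E, rfl⟩ := E
  obtain ⟨L, ⟨e, he⟩, -⟩ := P.proj_strict
  have h := L.flip E
  rw [he, eqToHom_app, eqToHom_app, eqToHom_map, eqToHom_trans] at h
  refine IsHomLift.of_fac _ _ _ (P.TT_obj_proj ⟨E, rfl⟩) (P.TT_obj_proj ⟨E, rfl⟩) ?_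
  rw [← reassoc_of% h, eqToHom_trans]
  exact (Category.comp_id _).symm

/-- The tangent bundle functor preserves all cartesian morphisms. -/
theorem isCartesian_T {A B : P.base} {f : A ⟶ B} {a b : P.total} {φ : a ⟶ b}
    (h : P.proj.IsStronglyCartesian f φ) :
    P.proj.IsStronglyCartesian (P.base.T.map f) (P.total.T.map φ) := by
  have hl := h.toIsHomLift
  have ha := IsHomLift.domain_eq P.proj f φ
  have hb := IsHomLift.codomain_eq P.proj f φ
  let X : P.proj.Fiber A := ⟨a, ha⟩
  let Y : P.proj.Fiber B := ⟨b, hb⟩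
  -- An arbitrary cartesian morphism is a vertical isomorphism e followed by a chosen lift. T'
  -- carries e to an isomorphism of the fibre over T A, and it preserves the cartesianness of chosen
  -- lifts by hypothesis.
  let e : X ⟶ P.pull f Y := fiberLift (P.lift f Y) (P.lift_cartesian f Y) φ hl
  have he : e.1 ≫ P.lift f Y = φ := fiberLift_fac _ _ _ _
  have : IsIso e := isIso_fiber (P.lift_cartesian f Y) e (isCartesian_congr h rfl he.symm)
  have h1 := isCartesian_fiber_iso ((P.totalT A).mapIso (asIso e))
  refine isCartesian_congr (isCartesian_comp h1 (P.T_lift_cartesian f Y)) (Category.id_comp _) ?_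
  rw [← he, Functor.map_comp]
  rfl

theorem isCartesian_zeroLift {A : P.base} (E : P.proj.Fiber A) :
    P.proj.IsStronglyCartesian (P.base.str.z.app A : A ⟶ P.base.T.obj A) (P.zeroLift E) :=
  P.lift_cartesian _ _

theorem sub_map_fac {A A' : P.base} (f : A ⟶ A') {E E' : P.proj.Fiber A'} (φ : E ⟶ E') :
    ((P.sub f).map φ).1 ≫ P.lift f E' = P.lift f E ≫ φ.1 := by
  exact fiberLift_fac (P.lift f E') (P.lift_cartesian f E') (P.lift f E ≫ φ.1)
    (by have := φ.2; exact IsHomLift.comp_lift_id_right P.proj f (P.lift f E) φ.1)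

theorem zeroLift_naturality {A : P.base} {E E' : P.proj.Fiber A} (φ : E ⟶ E') :
    ((P.fiberT A).map φ).1 ≫ P.zeroLift E' = P.zeroLift E ≫ P.total.T.map φ.1 :=
  P.sub_map_fac _ _

/-- The iterated zero morphism of the base. -/
def iterZero (A : P.base) : ∀ m : ℕ, A ⟶ (iter P.base.T m).obj A
  | 0 => 𝟙 A
  | m + 1 => P.base.str.z.app A ≫ P.base.T.map (iterZero A m)

/-- The iterated lift of the zero morphism. -/
noncomputable def iterLift {A : P.base} (E : P.proj.Fiber A) :
    ∀ m : ℕ, ((iter (P.fiberT A) m).obj E).1 ⟶ (iter P.total.T m).obj E.1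
  | 0 => 𝟙 E.1
  | m + 1 => P.zeroLift ((iter (P.fiberT A) m).obj E) ≫ P.total.T.map (iterLift E m)

theorem isCartesian_iterLift {A : P.base} (E : P.proj.Fiber A) (m : ℕ) :
    P.proj.IsStronglyCartesian (P.iterZero A m) (P.iterLift E m) := by
  induction m with
  | zero => exact isCartesian_fiber_iso (Iso.refl E)
  | succ m ih => exact isCartesian_comp (P.isCartesian_zeroLift _) (P.isCartesian_T ih)

theorem iterLift_naturality {A : P.base} {E E' : P.proj.Fiber A} (φ : E ⟶ E') (m : ℕ) :
    ((iter (P.fiberT A) m).map φ).1 ≫ P.iterLift E' m =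
      P.iterLift E m ≫ (iter P.total.T m).map φ.1 := by
  induction m with
  | zero => exact (Category.comp_id _).trans (Category.id_comp _).symm
  | succ m ih =>
    change ((P.fiberT A).map ((iter (P.fiberT A) m).map φ)).1 ≫
      P.zeroLift ((iter (P.fiberT A) m).obj E') ≫ P.total.T.map (P.iterLift E' m) =
      (P.zeroLift ((iter (P.fiberT A) m).obj E) ≫ P.total.T.map (P.iterLift E m)) ≫
        P.total.T.map ((iter P.total.T m).map φ.1)
    have h := P.zeroLift_naturality ((iter (P.fiberT A) m).map φ)
    rw [reassoc_of% h, ← P.total.T.map_comp, ih, Category.assoc, P.total.T.map_comp]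

theorem isCartesian_iter {A B : P.base} {f : A ⟶ B} {a b : P.total} {φ : a ⟶ b}
    (h : P.proj.IsStronglyCartesian f φ) (m : ℕ) :
    P.proj.IsStronglyCartesian ((iter P.base.T m).map f) ((iter P.total.T m).map φ) := by
  induction m with
  | zero => exact h
  | succ m ih => exact P.isCartesian_T ih

end TangentFibration

/-! ## Comparison of fibres with the total category -/

section Comparison

variable {S : Type u₁} [Category.{v₁} S] {E : Type u₂} [Category.{v₂} E]
  {S' : Type u₃} [Category.{v₃} S'] {E' : Type u₄} [Category.{v₄} E']

/-- Cartesian morphisms, over their own projection. -/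
def IsCart (p : E ⥤ S) {a b : E} (φ : a ⟶ b) : Prop :=
  p.IsStronglyCartesian (p.map φ) φ

variable {p : E ⥤ S} {q : E' ⥤ S'}

theorem IsCart.of {A B : S} {f : A ⟶ B} {a b : E} {φ : a ⟶ b}
    (h : p.IsStronglyCartesian f φ) : IsCart p φ :=
  isCartesian_proj_map h

theorem IsCart.comp {a b c : E} {φ : a ⟶ b} {ψ : b ⟶ c} (hφ : IsCart p φ) (hψ : IsCart p ψ) :
    IsCart p (φ ≫ ψ) :=
  .of (isCartesian_comp hφ hψ)

theorem IsCart.id (a : E) : IsCart p (𝟙 a) :=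
  .of (isCartesian_fiber_iso (Iso.refl (Functor.Fiber.mk (p := p) (a := a) rfl)))

/-- Replacing A by the projection of X makes the base morphism start at A itself, which is the form
the lifting lemmas for fibres require. -/
theorem IsCart.exists_over {A : S} {X : p.Fiber A} {Y : E} {x : X.1 ⟶ Y} (h : IsCart p x) :
    ∃ f : A ⟶ p.obj Y, p.IsStronglyCartesian f x := by
  obtain ⟨X, rfl⟩ := X
  exact ⟨_, h⟩

theorem IsCart.fiber_ext {A : S} {W X : p.Fiber A} {Y : E} {x : X.1 ⟶ Y} (hx : IsCart p x)
    {φ ψ : W ⟶ X} (h : φ.1 ≫ x = ψ.1 ≫ x) : φ = ψ := by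
  obtain ⟨f, hf⟩ := hx.exists_over
  exact TangentTheory.fiber_ext x hf h

theorem fiber_comp_val {A : S} {X Y Z : p.Fiber A} (φ : X ⟶ Y) (ψ : Y ⟶ Z) :
    (φ ≫ ψ).1 = φ.1 ≫ ψ.1 := rfl

/-- Both composites project to k followed by the projection of ψ. The point is to know what t ≫ ψ
lies over without naming the projection of c or of ψ: it suffices to compute d ≫ ψ for one d over
the same k. Later d is a zero morphism into a fibre product of tangent bundles and t a chosen lift
of its projection. -/
theorem isHomLift_transfer {A B C : S} {k : A ⟶ C} {f : A ⟶ B} {a a' c e : E} {t : a ⟶ c}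
    {d : a' ⟶ c} (ψ : c ⟶ e) (ht : p.IsHomLift k t) (hd : p.IsHomLift k d)
    (h : p.IsHomLift f (d ≫ ψ)) : p.IsHomLift f (t ≫ ψ) := by
  obtain ⟨⟩ := hd
  obtain rfl := IsHomLift.codomain_eq p f (d ≫ ψ)
  obtain rfl : f = p.map d ≫ p.map ψ := by
    rw [IsHomLift.eq_of_isHomLift p f (d ≫ ψ), p.map_comp]
  infer_instance

/-- A functor `G` between fibres, together with natural cartesian morphisms to a functor `G'`
between the total categories which preserves cartesian morphisms. -/
structure FiberComparison {A : S} {B : S'} (G : p.Fiber A ⥤ q.Fiber B) (G' : E ⥤ E') where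
  app (X : p.Fiber A) : (G.obj X).1 ⟶ G'.obj X.1
  isCart (X : p.Fiber A) : IsCart q (app X)
  naturality {X Y : p.Fiber A} (φ : X ⟶ Y) : (G.map φ).1 ≫ app Y = app X ≫ G'.map φ.1
  map_isCart {a b : E} {φ : a ⟶ b} : IsCart p φ → IsCart q (G'.map φ)

namespace FiberComparison

/-- The comparison of a fibre with the total category. -/
def id (A : S) : FiberComparison (p := p) (q := p) (𝟭 (p.Fiber A)) (𝟭 E) where
  app X := 𝟙 X.1
  isCart X := .id X.1
  naturality _ := (Category.comp_id _).trans (Category.id_comp _).symm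
  map_isCart h := h

variable {A : S} {B : S'} {G : p.Fiber A ⥤ q.Fiber B} {G' : E ⥤ E'} (γ : FiberComparison G G')

/-- The image of a morphism out of an object of the fibre. -/
def map {X : p.Fiber A} {Y : E} (x : X.1 ⟶ Y) : (G.obj X).1 ⟶ G'.obj Y :=
  γ.app X ≫ G'.map x

theorem isCart_map {X : p.Fiber A} {Y : E} {x : X.1 ⟶ Y} (hx : IsCart p x) :
    IsCart q (γ.map x) :=
  (γ.isCart X).comp (γ.map_isCart hx)

theorem map_comp_map {X : p.Fiber A} {Y Z : E} (x : X.1 ⟶ Y) (y : Y ⟶ Z) :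
    γ.map x ≫ G'.map y = γ.map (x ≫ y) := by
  simp [map]

theorem map_val_map {X Y : p.Fiber A} {Z : E} (φ : X ⟶ Y) (y : Y.1 ⟶ Z) :
    (G.map φ).1 ≫ γ.map y = γ.map (φ.1 ≫ y) := by
  rw [map, map, ← Category.assoc, γ.naturality, Category.assoc, G'.map_comp]

/-- Squares from a fibre to the total category are carried to such squares; this supplies the
compatibility data when limits and bundles are transported along G. -/
theorem map_square {X Y : p.Fiber A} {X' Y' : E} {φ : X ⟶ Y} {x : X.1 ⟶ X'} {y : Y.1 ⟶ Y'}
    {f : X' ⟶ Y'} (h : φ.1 ≫ y = x ≫ f) : (G.map φ).1 ≫ γ.map y = γ.map x ≫ G'.map f := by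
  rw [map_val_map, map_comp_map, h]

/-- The functor `G` preserves `n`-fold pullbacks lying over `n`-fold pullbacks preserved
by `G'`. -/
theorem isNFoldPullback_map (γ : FiberComparison G G') {X₀ Y₀ P₀ : p.Fiber A} {q₀ : X₀ ⟶ Y₀} {n : ℕ}
    {b₀ : P₀ ⟶ Y₀} {π₀ : Fin n → (P₀ ⟶ X₀)} {X Y P : E} {r : X ⟶ Y} {b : P ⟶ Y}
    {π : Fin n → (P ⟶ X)} (h : IsNFoldPullback (G'.map r) (G'.map b) (fun i => G'.map (π i)))
    (h' : IsNFoldPullback (q.map (G'.map r)) (q.map (G'.map b)) (fun i => q.map (G'.map (π i))))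
    {x : X₀.1 ⟶ X} (hx : IsCart p x) {y : Y₀.1 ⟶ Y} (hy : IsCart p y)
    {t : P₀.1 ⟶ P} (ht : IsCart p t)
    (eq : q₀.1 ≫ y = x ≫ r) (eb : b₀.1 ≫ y = t ≫ b) (eπ : ∀ i, (π₀ i).1 ≫ x = t ≫ π i) :
    IsNFoldPullback (G.map q₀) (G.map b₀) (fun i => G.map (π₀ i)) := by
  obtain ⟨_, hx⟩ := (γ.isCart_map hx).exists_over
  obtain ⟨_, hy⟩ := (γ.isCart_map hy).exists_over
  obtain ⟨_, ht⟩ := (γ.isCart_map ht).exists_over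
  exact isNFoldPullback_fiber h h' hx hy ht (γ.map_square eq) (γ.map_square eb)
    (fun i => γ.map_square (eπ i))

/-- The functor `G` preserves pullback squares lying over pullback squares preserved by `G'`. -/
theorem isPullback_map (γ : FiberComparison G G') {X₀ Y₀ Z₀ P₀ : p.Fiber A} {a₀ : P₀ ⟶ X₀} {b₀ : P₀ ⟶ Y₀}
    {f₀ : X₀ ⟶ Z₀} {g₀ : Y₀ ⟶ Z₀} {X Y Z P : E} {a : P ⟶ X} {b : P ⟶ Y} {f : X ⟶ Z} {g : Y ⟶ Z}
    (h : IsPullback (G'.map a) (G'.map b) (G'.map f) (G'.map g))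
    (h' : IsPullback (q.map (G'.map a)) (q.map (G'.map b)) (q.map (G'.map f)) (q.map (G'.map g)))
    {x : X₀.1 ⟶ X} (hx : IsCart p x) {y : Y₀.1 ⟶ Y} (hy : IsCart p y) {z : Z₀.1 ⟶ Z}
    (hz : IsCart p z) {t : P₀.1 ⟶ P} (ht : IsCart p t) (ea : a₀.1 ≫ x = t ≫ a)
    (eb : b₀.1 ≫ y = t ≫ b) (ef : f₀.1 ≫ z = x ≫ f) (eg : g₀.1 ≫ z = y ≫ g) :
    IsPullback (G.map a₀) (G.map b₀) (G.map f₀) (G.map g₀) := by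
  obtain ⟨_, hx⟩ := (γ.isCart_map hx).exists_over
  obtain ⟨_, hy⟩ := (γ.isCart_map hy).exists_over
  obtain ⟨_, hz⟩ := (γ.isCart_map hz).exists_over
  obtain ⟨_, ht⟩ := (γ.isCart_map ht).exists_over
  exact isPullback_fiber h h' hx hy hz ht (γ.map_square ea) (γ.map_square eb) (γ.map_square ef)
    (γ.map_square eg)

end FiberComparison

/-- A morphism from bundle data of a fibre to bundle data of the total category, with cartesian
components. -/
structure BundleComparison {A : S} (X₀ : BundleData (p.Fiber A)) (X : BundleData E) where
  B : X₀.B.1 ⟶ X.B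
  E : X₀.E.1 ⟶ X.E
  E₂ : X₀.E₂.1 ⟶ X.E₂
  isCart_B : IsCart p B
  isCart_E : IsCart p E
  q : X₀.q.1 ≫ B = E ≫ X.q
  π₁ : X₀.π₁.1 ≫ E = E₂ ≫ X.π₁
  π₂ : X₀.π₂.1 ≫ E = E₂ ≫ X.π₂
  z : X₀.z.1 ≫ E = B ≫ X.z
  s : X₀.s.1 ≫ E = E₂ ≫ X.s

/-- The image of a comparison of bundle data. -/
def BundleComparison.map {A : S} {B : S'} {X₀ : BundleData (p.Fiber A)} {X : BundleData E}
    (κ : BundleComparison X₀ X) {G : p.Fiber A ⥤ q.Fiber B} {G' : E ⥤ E'}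
    (γ : FiberComparison G G') : BundleComparison (X₀.map G) (X.map G') where
  B := γ.map κ.B
  E := γ.map κ.E
  E₂ := γ.map κ.E₂
  isCart_B := γ.isCart_map κ.isCart_B
  isCart_E := γ.isCart_map κ.isCart_E
  q := γ.map_square κ.q
  π₁ := γ.map_square κ.π₁
  π₂ := γ.map_square κ.π₂
  z := γ.map_square κ.z
  s := γ.map_square κ.s

/-- Morphisms of bundle data in a fibre lying over an additive bundle morphism are additive. -/
theorem BundleComparison.isAdditiveMorphism {A : S} {X₀ Y₀ : BundleData (p.Fiber A)}
    {X Y : BundleData E} (κ : BundleComparison X₀ X) (μ : BundleComparison Y₀ Y) {f : X.B ⟶ Y.B}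
    {g : X.E ⟶ Y.E} (h : IsAdditiveMorphism X Y f g) {f₀ : X₀.B ⟶ Y₀.B} {g₀ : X₀.E ⟶ Y₀.E}
    (hf : f₀.1 ≫ μ.B = κ.B ≫ f) (hg : g₀.1 ≫ μ.E = κ.E ≫ g)
    (h₂ : ∀ g₂ : X.E₂ ⟶ Y.E₂, g₂ ≫ Y.π₁ = X.π₁ ≫ g → g₂ ≫ Y.π₂ = X.π₂ ≫ g →
      ∃ k : X₀.E₂ ⟶ Y₀.E₂, k.1 ≫ μ.E₂ = κ.E₂ ≫ g₂) : IsAdditiveMorphism X₀ Y₀ f₀ g₀ := by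
  obtain ⟨hp, hz, g₂, h1, h2, h3⟩ := h
  obtain ⟨k, hk⟩ := h₂ g₂ h1 h2
  -- All five equations have codomain the base or the total object of the bundle, where μ is
  -- cartesian. Nothing is assumed of `μ.E₂`, and so the lift k of g₂ had to be supplied by `h₂`.
  refine ⟨μ.isCart_B.fiber_ext ?_, μ.isCart_E.fiber_ext ?_, k, μ.isCart_E.fiber_ext ?_,
    μ.isCart_E.fiber_ext ?_, μ.isCart_E.fiber_ext ?_⟩ <;> simp only [fiber_comp_val, Category.assoc]
  · rw [hf, reassoc_of% κ.q, hp, μ.q, reassoc_of% hg]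
  · rw [hg, reassoc_of% κ.z, hz, μ.z, reassoc_of% hf]
  · rw [μ.π₁, reassoc_of% hk, hg, reassoc_of% κ.π₁, h1]
  · rw [μ.π₂, reassoc_of% hk, hg, reassoc_of% κ.π₂, h2]
  · rw [hg, reassoc_of% κ.s, h3, μ.s, reassoc_of% hk]

/-- When the codomain bundle has its fibre product both in the fibre and in the total category, the
lift of g₂ comes for free: take the morphism induced by the pullback of the fibre; it lies over g₂
because the two composites agree after both projections of the total pullback. -/
theorem BundleComparison.isAdditiveMorphism_of_isPullback {A : S}
    {X₀ Y₀ : BundleData (p.Fiber A)}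
    {X Y : BundleData E} (κ : BundleComparison X₀ X) (μ : BundleComparison Y₀ Y) {f : X.B ⟶ Y.B}
    {g : X.E ⟶ Y.E} (h : IsAdditiveMorphism X Y f g) {f₀ : X₀.B ⟶ Y₀.B} {g₀ : X₀.E ⟶ Y₀.E}
    (hf : f₀.1 ≫ μ.B = κ.B ≫ f) (hg : g₀.1 ≫ μ.E = κ.E ≫ g)
    (hX : X₀.π₁ ≫ X₀.q = X₀.π₂ ≫ X₀.q)
    (hY₀ : IsPullback Y₀.π₁ Y₀.π₂ Y₀.q Y₀.q) (hY : IsPullback Y.π₁ Y.π₂ Y.q Y.q) :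
    IsAdditiveMorphism X₀ Y₀ f₀ g₀ := by
  have e : X₀.q ≫ f₀ = g₀ ≫ Y₀.q := by
    refine μ.isCart_B.fiber_ext ?_
    simp only [fiber_comp_val, Category.assoc]
    rw [hf, reassoc_of% κ.q, h.proj, μ.q, reassoc_of% hg]
  refine κ.isAdditiveMorphism μ h hf hg fun g₂ h1 h2 => ?_
  have w : (X₀.π₁ ≫ g₀) ≫ Y₀.q = (X₀.π₂ ≫ g₀) ≫ Y₀.q := by
    rw [Category.assoc, Category.assoc, ← e, reassoc_of% hX]
  refine ⟨hY₀.lift _ _ w, hY.hom_ext ?_ ?_⟩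
  · have := congrArg Subtype.val (hY₀.lift_fst _ _ w)
    rw [fiber_comp_val, fiber_comp_val] at this
    rw [Category.assoc, ← μ.π₁, reassoc_of% this, hg, Category.assoc, h1, reassoc_of% κ.π₁]
  · have := congrArg Subtype.val (hY₀.lift_snd _ _ w)
    rw [fiber_comp_val, fiber_comp_val] at this
    rw [Category.assoc, ← μ.π₂, reassoc_of% this, hg, Category.assoc, h2, reassoc_of% κ.π₂]

end Comparison

/-! ## The tangent structure of the fibres -/

namespace TangentFibration

variable (P : TangentFibration.{v₁, u₁, v₂, u₂}) {A : P.base}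

theorem isCart_zeroLift (E : P.proj.Fiber A) : IsCart P.proj (P.zeroLift E) :=
  .of (P.isCartesian_zeroLift E)

/-- The comparison of the tangent bundle functors of a fibre and of the total category. -/
noncomputable def zeroComparison (A : P.base) : FiberComparison (P.fiberT A) P.total.T where
  app := P.zeroLift
  isCart := P.isCart_zeroLift
  naturality := P.zeroLift_naturality
  map_isCart h := .of (P.isCartesian_T h)

/-- The comparison of the iterated tangent bundle functors of a fibre and of the total
category. -/
noncomputable def iterComparison (A : P.base) (m : ℕ) :
    FiberComparison (p := P.proj) (q := P.proj) (iter (P.fiberT A) m) (iter P.total.T m) where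
  app E := P.iterLift E m
  isCart E := .of (P.isCartesian_iterLift E m)
  naturality φ := P.iterLift_naturality φ m
  map_isCart h := .of (P.isCartesian_iter h m)

/-- The comparison of a substitution functor with the identity. -/
noncomputable def subComparison {A' : P.base} (f : A ⟶ A') :
    FiberComparison (p := P.proj) (q := P.proj) (P.sub f) (𝟭 P.total) where
  app := P.lift f
  isCart E := .of (P.lift_cartesian f E)
  naturality φ := P.sub_map_fac f φ
  map_isCart h := h

/-- The projection of the fibre. -/
noncomputable def fiberP (E : P.proj.Fiber A) : (P.fiberT A).obj E ⟶ E :=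
  ⟨P.zeroLift E ≫ P.total.str.p.app E.1, isHomLift_congr
    -- The composite lies over z p, which is the identity of A, and is therefore vertical.
    (isHomLift_comp (P.isCartesian_zeroLift E).toIsHomLift (P.isHomLift_p E))
    ((P.base.str.additive A).zero_proj) rfl⟩

/-- The zero of the fibre. -/
noncomputable def fiberZ (E : P.proj.Fiber A) : E ⟶ (P.fiberT A).obj E :=
  fiberLift (P.zeroLift E) (P.isCartesian_zeroLift E) (P.total.str.z.app E.1) (P.isHomLift_z E)

theorem fiberZ_fac (E : P.proj.Fiber A) :
    (P.fiberZ E).1 ≫ P.zeroLift E = P.total.str.z.app E.1 :=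
  fiberLift_fac _ _ _ _

/-- The chosen lift of the iterated zero. -/
noncomputable def zeroLift₂ (E : P.proj.Fiber A) :
    ((P.fiberT A).obj ((P.fiberT A).obj E)).1 ⟶ P.total.T.obj (P.total.T.obj E.1) :=
  P.zeroLift ((P.fiberT A).obj E) ≫ P.total.T.map (P.zeroLift E)

theorem isCartesian_zeroLift₂ (E : P.proj.Fiber A) :
    P.proj.IsStronglyCartesian
      ((P.base.str.z.app A : A ⟶ P.base.T.obj A) ≫ P.base.T.map (P.base.str.z.app A))
      (P.zeroLift₂ E) :=
  isCartesian_comp (P.isCartesian_zeroLift _) (P.isCartesian_T (P.isCartesian_zeroLift E))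

theorem isCart_zeroLift₂ (E : P.proj.Fiber A) : IsCart P.proj (P.zeroLift₂ E) :=
  .of (P.isCartesian_zeroLift₂ E)

/-- The vertical lift of the fibre. -/
noncomputable def fiberL (E : P.proj.Fiber A) :
    (P.fiberT A).obj E ⟶ (P.fiberT A).obj ((P.fiberT A).obj E) :=
  fiberLift (P.zeroLift₂ E) (P.isCartesian_zeroLift₂ E)
    (P.zeroLift E ≫ P.total.str.l.app E.1)
    -- Lifting through ζ² requires z l = z T(z) in the base: the lift is an additive bundle morphism
    -- over z, hence preserves zeros.
    (isHomLift_congr (isHomLift_comp (P.isCartesian_zeroLift E).toIsHomLift (P.isHomLift_l E))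
      (P.base.str.lift_additive A).zero rfl)

theorem fiberL_fac (E : P.proj.Fiber A) :
    (P.fiberL E).1 ≫ P.zeroLift₂ E = P.zeroLift E ≫ P.total.str.l.app E.1 :=
  fiberLift_fac _ _ _ _

/-- The canonical flip of the fibre. -/
noncomputable def fiberC (E : P.proj.Fiber A) :
    (P.fiberT A).obj ((P.fiberT A).obj E) ⟶ (P.fiberT A).obj ((P.fiberT A).obj E) :=
  fiberLift (P.zeroLift₂ E) (P.isCartesian_zeroLift₂ E)
    (P.zeroLift₂ E ≫ P.total.str.c.app E.1)
    (isHomLift_congr (isHomLift_comp (P.isCartesian_zeroLift₂ E).toIsHomLift (P.isHomLift_c E))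
      (by
        -- The equation needed in the base is z T(z) c = z T(z). Additivity of the flip gives T(z) c
        -- = z_T, and naturality of z at z gives z z_T = z T(z).
        have h := (P.base.str.flip_additive A).zero
        have h' := P.base.str.z.naturality (P.base.str.z.app A)
        change P.base.T.map (P.base.str.z.app A) ≫ P.base.str.c.app A =
          𝟙 _ ≫ P.base.str.z.app (P.base.T.obj A) at h
        rw [Category.id_comp] at h
        rw [Category.assoc]
        erw [h]
        exact h') rfl)

theorem fiberC_fac (E : P.proj.Fiber A) :
    (P.fiberC E).1 ≫ P.zeroLift₂ E = P.zeroLift₂ E ≫ P.total.str.c.app E.1 :=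
  fiberLift_fac _ _ _ _

theorem total_isPullback (E : P.total) : IsPullback (P.total.str.π₁.app E) (P.total.str.π₂.app E)
    (P.total.str.p.app E : P.total.T.obj E ⟶ E) (P.total.str.p.app E) :=
  (P.total.str.additive E).isPullback

/-- The diagonal zero morphism `E ⟶ T₂ E`. -/
noncomputable def diagZero (E : P.total) : E ⟶ P.total.str.T₂.obj E :=
  (P.total_isPullback E).lift (P.total.str.z.app E) (P.total.str.z.app E) rfl

theorem diagZero_fst (E : P.total) :
    P.diagZero E ≫ P.total.str.π₁.app E = P.total.str.z.app E :=
  (P.total_isPullback E).lift_fst _ _ _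

theorem diagZero_snd (E : P.total) :
    P.diagZero E ≫ P.total.str.π₂.app E = P.total.str.z.app E :=
  (P.total_isPullback E).lift_snd _ _ _

theorem total_zero_proj (E : P.total) :
    P.total.str.z.app E ≫ P.total.str.p.app E = 𝟙 E :=
  (P.total.str.additive E).zero_proj

/-- This is 0 + 0 = 0: the unit law of the sum precomposed with the zero. -/
theorem diagZero_sum (E : P.total) :
    P.diagZero E ≫ P.total.str.s.app E = P.total.str.z.app E := by
  have h := congrArg (P.total.str.z.app E ≫ ·) (P.total.str.additive E).zero_sum
  have e : P.diagZero E = P.total.str.z.app E ≫ (P.total_isPullback E).lift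
      (P.total.str.p.app E ≫ P.total.str.z.app E) (𝟙 _)
      (by rw [Category.assoc, total_zero_proj, Category.id_comp]; exact Category.comp_id _) := by
    apply (P.total_isPullback E).hom_ext
    · rw [diagZero_fst, Category.assoc, IsPullback.lift_fst]
      erw [reassoc_of% P.total_zero_proj E]
    · rw [diagZero_snd, Category.assoc, IsPullback.lift_snd, Category.comp_id]
  rw [e, Category.assoc]
  refine h.trans (Category.comp_id _)

/-- The projection of the diagonal zero morphism. -/
noncomputable def baseDiag (E : P.proj.Fiber A) : A ⟶ P.proj.obj (P.total.str.T₂.obj E.1) :=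
  eqToHom E.2.symm ≫ P.proj.map (P.diagZero E.1)

theorem isHomLift_baseDiag (E : P.proj.Fiber A) :
    P.proj.IsHomLift (P.baseDiag E) (P.diagZero E.1) := by
  unfold baseDiag
  infer_instance

/-- The fibrewise double tangent bundle. -/
noncomputable def fiberT₂ (E : P.proj.Fiber A) : P.proj.Fiber A :=
  P.pull (P.baseDiag E) ⟨P.total.str.T₂.obj E.1, rfl⟩

/-- The cartesian morphism from the fibrewise double tangent bundle. -/
noncomputable def diagLift (E : P.proj.Fiber A) : (P.fiberT₂ E).1 ⟶ P.total.str.T₂.obj E.1 :=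
  P.lift (P.baseDiag E) ⟨P.total.str.T₂.obj E.1, rfl⟩

theorem isCartesian_diagLift (E : P.proj.Fiber A) :
    P.proj.IsStronglyCartesian (P.baseDiag E) (P.diagLift E) :=
  P.lift_cartesian _ _

theorem isCart_diagLift (E : P.proj.Fiber A) : IsCart P.proj (P.diagLift E) :=
  .of (P.isCartesian_diagLift E)

/-- Pulling T'_2 E back along the projection of ⟨0, 0⟩ avoids any identification of the projection
of T'_2 E with the base object T_2 A. Both projections and the sum send ⟨0, 0⟩ to 0, so after the
chosen lift all three lie over z and can be lifted through ζ. -/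
theorem isHomLift_diagLift (E : P.proj.Fiber A) {ψ : P.total.str.T₂.obj E.1 ⟶ P.total.T.obj E.1}
    (h : P.diagZero E.1 ≫ ψ = P.total.str.z.app E.1) :
    P.proj.IsHomLift (P.base.str.z.app A : A ⟶ P.base.T.obj A) (P.diagLift E ≫ ψ) := by
  refine isHomLift_transfer ψ (P.isCartesian_diagLift E).toIsHomLift (P.isHomLift_baseDiag E) ?_
  rw [h]
  exact P.isHomLift_z E

/-- The first projection. -/
noncomputable def fiberFst (E : P.proj.Fiber A) : P.fiberT₂ E ⟶ (P.fiberT A).obj E :=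
  fiberLift (P.zeroLift E) (P.isCartesian_zeroLift E) (P.diagLift E ≫ P.total.str.π₁.app E.1)
    (P.isHomLift_diagLift E (P.diagZero_fst E.1))

/-- The second projection. -/
noncomputable def fiberSnd (E : P.proj.Fiber A) : P.fiberT₂ E ⟶ (P.fiberT A).obj E :=
  fiberLift (P.zeroLift E) (P.isCartesian_zeroLift E) (P.diagLift E ≫ P.total.str.π₂.app E.1)
    (P.isHomLift_diagLift E (P.diagZero_snd E.1))

/-- The sum. -/
noncomputable def fiberSum (E : P.proj.Fiber A) : P.fiberT₂ E ⟶ (P.fiberT A).obj E :=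
  fiberLift (P.zeroLift E) (P.isCartesian_zeroLift E) (P.diagLift E ≫ P.total.str.s.app E.1)
    (P.isHomLift_diagLift E (P.diagZero_sum E.1))

theorem fiberFst_fac (E : P.proj.Fiber A) :
    (P.fiberFst E).1 ≫ P.zeroLift E = P.diagLift E ≫ P.total.str.π₁.app E.1 :=
  fiberLift_fac _ _ _ _

theorem fiberSnd_fac (E : P.proj.Fiber A) :
    (P.fiberSnd E).1 ≫ P.zeroLift E = P.diagLift E ≫ P.total.str.π₂.app E.1 :=
  fiberLift_fac _ _ _ _

theorem fiberSum_fac (E : P.proj.Fiber A) :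
    (P.fiberSum E).1 ≫ P.zeroLift E = P.diagLift E ≫ P.total.str.s.app E.1 :=
  fiberLift_fac _ _ _ _

theorem fiberP_fac (E : P.proj.Fiber A) :
    (P.fiberP E).1 ≫ 𝟙 E.1 = P.zeroLift E ≫ P.total.str.p.app E.1 :=
  Category.comp_id _

/-- The pullback square of p' at E restricts to the fibre along the cartesian morphisms ζ, ζ, 1 and
`diagLift`. The projection preserves the square because it is the case n = 2 of the tangent limits.
-/
theorem fiber_isPullback (E : P.proj.Fiber A) :
    IsPullback (P.fiberFst E) (P.fiberSnd E) (P.fiberP E) (P.fiberP E) :=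
  (FiberComparison.id A).isPullback_map (P.total_isPullback E.1)
    (isPullback_map_of_nfold P.proj (P.total_isPullback E.1)
      (fun _ _ h => P.preservesTangentLimits_proj.nfold 2 _ _ _ _ h))
    (P.isCart_zeroLift E) (P.isCart_zeroLift E) (IsCart.id E.1) (P.isCart_diagLift E)
    (P.fiberFst_fac E) (P.fiberSnd_fac E) (P.fiberP_fac E) (P.fiberP_fac E)

theorem fiberP_naturality {E E' : P.proj.Fiber A} (φ : E ⟶ E') :
    (P.fiberT A).map φ ≫ P.fiberP E' = P.fiberP E ≫ φ := by
  refine Subtype.ext ?_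
  change ((P.fiberT A).map φ).1 ≫ P.zeroLift E' ≫ P.total.str.p.app E'.1 =
    (P.zeroLift E ≫ P.total.str.p.app E.1) ≫ φ.1
  have h := P.zeroLift_naturality φ
  rw [reassoc_of% h, Category.assoc]
  congr 1
  exact P.total.str.p.naturality φ.1

/-- The functoriality of the fibrewise double tangent bundle. -/
noncomputable def fiberT₂Map {E E' : P.proj.Fiber A} (φ : E ⟶ E') : P.fiberT₂ E ⟶ P.fiberT₂ E' :=
  (P.fiber_isPullback E').lift (P.fiberFst E ≫ (P.fiberT A).map φ)
    (P.fiberSnd E ≫ (P.fiberT A).map φ) (by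
      simp only [Category.assoc, fiberP_naturality, reassoc_of% (P.fiber_isPullback E).w])

theorem fiberT₂Map_fst {E E' : P.proj.Fiber A} (φ : E ⟶ E') :
    P.fiberT₂Map φ ≫ P.fiberFst E' = P.fiberFst E ≫ (P.fiberT A).map φ :=
  (P.fiber_isPullback E').lift_fst _ _ _

theorem fiberT₂Map_snd {E E' : P.proj.Fiber A} (φ : E ⟶ E') :
    P.fiberT₂Map φ ≫ P.fiberSnd E' = P.fiberSnd E ≫ (P.fiberT A).map φ :=
  (P.fiber_isPullback E').lift_snd _ _ _

/-- The functor of fibrewise double tangent bundles. -/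
noncomputable def fiberT₂Functor (A : P.base) : P.proj.Fiber A ⥤ P.proj.Fiber A where
  obj := P.fiberT₂
  map φ := P.fiberT₂Map φ
  map_id E := by
    apply (P.fiber_isPullback E).hom_ext
    · rw [fiberT₂Map_fst, CategoryTheory.Functor.map_id, Category.comp_id, Category.id_comp]
    · rw [fiberT₂Map_snd, CategoryTheory.Functor.map_id, Category.comp_id, Category.id_comp]
  map_comp {E E' E''} φ ψ := by
    apply (P.fiber_isPullback E'').hom_ext
    · rw [Category.assoc, fiberT₂Map_fst, fiberT₂Map_fst, reassoc_of% P.fiberT₂Map_fst φ,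
        Functor.map_comp]
    · rw [Category.assoc, fiberT₂Map_snd, fiberT₂Map_snd, reassoc_of% P.fiberT₂Map_snd φ,
        Functor.map_comp]

/-- A morphism to the fibrewise double tangent bundle, compared with the total category. -/
theorem diagLift_ext {E : P.proj.Fiber A} {W : P.proj.Fiber A} {k : W ⟶ P.fiberT₂ E}
    {t : W.1 ⟶ P.total.str.T₂.obj E.1}
    (h₁ : (k ≫ P.fiberFst E).1 ≫ P.zeroLift E = t ≫ P.total.str.π₁.app E.1)
    (h₂ : (k ≫ P.fiberSnd E).1 ≫ P.zeroLift E = t ≫ P.total.str.π₂.app E.1) :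
    k.1 ≫ P.diagLift E = t := by
  apply (P.total_isPullback E.1).hom_ext
  · rw [← h₁, fiber_comp_val, Category.assoc, Category.assoc, fiberFst_fac]
  · rw [← h₂, fiber_comp_val, Category.assoc, Category.assoc, fiberSnd_fac]

theorem diagLift_naturality {E E' : P.proj.Fiber A} (φ : E ⟶ E') :
    (P.fiberT₂Map φ).1 ≫ P.diagLift E' = P.diagLift E ≫ P.total.str.T₂.map φ.1 := by
  apply P.diagLift_ext
  · rw [fiberT₂Map_fst, fiber_comp_val, Category.assoc, zeroLift_naturality,
      reassoc_of% P.fiberFst_fac E, Category.assoc, P.total.str.π₁.naturality]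
  · rw [fiberT₂Map_snd, fiber_comp_val, Category.assoc, zeroLift_naturality,
      reassoc_of% P.fiberSnd_fac E, Category.assoc, P.total.str.π₂.naturality]

theorem zeroLift₂_naturality {E E' : P.proj.Fiber A} (φ : E ⟶ E') :
    ((P.fiberT A).map ((P.fiberT A).map φ)).1 ≫ P.zeroLift₂ E' =
      P.zeroLift₂ E ≫ P.total.T.map (P.total.T.map φ.1) := by
  rw [zeroLift₂, ← Category.assoc, zeroLift_naturality, Category.assoc, ← P.total.T.map_comp,
    zeroLift_naturality, P.total.T.map_comp, zeroLift₂, Category.assoc]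

theorem fiberZ_naturality {E E' : P.proj.Fiber A} (φ : E ⟶ E') :
    φ ≫ P.fiberZ E' = P.fiberZ E ≫ (P.fiberT A).map φ := by
  refine (P.isCart_zeroLift E').fiber_ext ?_
  rw [fiber_comp_val, fiber_comp_val, Category.assoc, Category.assoc, fiberZ_fac,
    zeroLift_naturality, reassoc_of% P.fiberZ_fac E]
  exact P.total.str.z.naturality φ.1

theorem fiberSum_naturality {E E' : P.proj.Fiber A} (φ : E ⟶ E') :
    P.fiberT₂Map φ ≫ P.fiberSum E' = P.fiberSum E ≫ (P.fiberT A).map φ := by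
  refine (P.isCart_zeroLift E').fiber_ext ?_
  rw [fiber_comp_val, fiber_comp_val, Category.assoc, Category.assoc, fiberSum_fac,
    zeroLift_naturality, reassoc_of% P.fiberSum_fac E, reassoc_of% P.diagLift_naturality φ]
  congr 1
  exact P.total.str.s.naturality φ.1

theorem fiberL_naturality {E E' : P.proj.Fiber A} (φ : E ⟶ E') :
    (P.fiberT A).map φ ≫ P.fiberL E' =
      P.fiberL E ≫ (P.fiberT A).map ((P.fiberT A).map φ) := by
  refine (P.isCart_zeroLift₂ E').fiber_ext ?_
  rw [fiber_comp_val, fiber_comp_val, Category.assoc, Category.assoc, fiberL_fac,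
    zeroLift₂_naturality, reassoc_of% P.fiberL_fac E, reassoc_of% P.zeroLift_naturality φ]
  congr 1
  exact P.total.str.l.naturality φ.1

theorem fiberC_naturality {E E' : P.proj.Fiber A} (φ : E ⟶ E') :
    (P.fiberT A).map ((P.fiberT A).map φ) ≫ P.fiberC E' =
      P.fiberC E ≫ (P.fiberT A).map ((P.fiberT A).map φ) := by
  refine (P.isCart_zeroLift₂ E').fiber_ext ?_
  rw [fiber_comp_val, fiber_comp_val, Category.assoc, Category.assoc, fiberC_fac,
    zeroLift₂_naturality, reassoc_of% P.fiberC_fac E, reassoc_of% P.zeroLift₂_naturality φ]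
  congr 1
  exact P.total.str.c.naturality φ.1

/-- The data of the tangent structure of the fibre. -/
noncomputable def fiberData (A : P.base) : TangentData (P.fiberT A) where
  p := { app := P.fiberP, naturality := fun _ _ φ => P.fiberP_naturality φ }
  z := { app := P.fiberZ, naturality := fun _ _ φ => P.fiberZ_naturality φ }
  T₂ := P.fiberT₂Functor A
  π₁ := { app := P.fiberFst, naturality := fun _ _ φ => P.fiberT₂Map_fst φ }
  π₂ := { app := P.fiberSnd, naturality := fun _ _ φ => P.fiberT₂Map_snd φ }
  s := { app := P.fiberSum, naturality := fun _ _ φ => P.fiberSum_naturality φ }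
  l := { app := P.fiberL, naturality := fun _ _ φ => P.fiberL_naturality φ }
  c := { app := P.fiberC, naturality := fun _ _ φ => P.fiberC_naturality φ }

end TangentFibration

/-! ### Lifts into pullbacks and uniqueness of n-fold pullbacks -/

theorem isPullback_lift_congr {C : Type u} [Category.{v} C] {P X Y Z W : C} {a : P ⟶ X}
    {b : P ⟶ Y} {f : X ⟶ Z} {g : Y ⟶ Z} (h : IsPullback a b f g) {s s' : W ⟶ X} {t t' : W ⟶ Y}
    (hs : s = s') (ht : t = t') (w : s ≫ f = t ≫ g) :
    h.lift s t w = h.lift s' t' (by rw [← hs, ← ht, w]) := by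
  subst hs ht; rfl

theorem isPullback_comp_lift {C : Type u} [Category.{v} C] {P X Y Z W V : C} {a : P ⟶ X}
    {b : P ⟶ Y} {f : X ⟶ Z} {g : Y ⟶ Z} (h : IsPullback a b f g) {s : W ⟶ X} {t : W ⟶ Y}
    (w : s ≫ f = t ≫ g) (r : V ⟶ W) :
    r ≫ h.lift s t w = h.lift (r ≫ s) (r ≫ t) (by rw [Category.assoc, w, Category.assoc]) := by
  apply h.hom_ext <;> simp

/-- `n`-fold pullbacks of a morphism are unique up to isomorphism. -/
theorem IsNFoldPullback.exists_iso {C : Type u} [Category.{v} C] {X B P P' : C} {q : X ⟶ B}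
    {n : ℕ} {b : P ⟶ B} {π : Fin n → (P ⟶ X)} {b' : P' ⟶ B} {π' : Fin n → (P' ⟶ X)}
    (h : IsNFoldPullback q b π) (h' : IsNFoldPullback q b' π') :
    ∃ e : P ≅ P', e.hom ≫ b' = b ∧ ∀ i, e.hom ≫ π' i = π i := by
  obtain ⟨r, ⟨h1, h2⟩, -⟩ := (isNFoldPullback_iff.1 h').2 b π (isNFoldPullback_iff.1 h).1
  obtain ⟨r', ⟨h1', h2'⟩, -⟩ := (isNFoldPullback_iff.1 h).2 b' π' (isNFoldPullback_iff.1 h').1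
  refine ⟨⟨r, r', h.hom_ext ?_ fun i => ?_, h'.hom_ext ?_ fun i => ?_⟩, h1, h2⟩
  · rw [Category.assoc, h1', h1, Category.id_comp]
  · rw [Category.assoc, h2', h2, Category.id_comp]
  · rw [Category.assoc, h1, h1', Category.id_comp]
  · rw [Category.assoc, h2, h2', Category.id_comp]

/-- Strictness of Π makes T'^m followed by Π equal, as a functor, to Π followed by T^m; limit
statements are moved across that equality. -/
theorem IsNFoldPullback.congr_functor {C : Type u} [Category.{v} C] {D : Type u₁}
    [Category.{v₁} D] {F G : C ⥤ D} (e : F = G) {X B P : C} {q : X ⟶ B} {n : ℕ} {b : P ⟶ B}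
    {π : Fin n → (P ⟶ X)} (h : IsNFoldPullback (F.map q) (F.map b) (fun i => F.map (π i))) :
    IsNFoldPullback (G.map q) (G.map b) (fun i => G.map (π i)) := by
  subst e; exact h

namespace TangentFibration

variable (P : TangentFibration.{v₁, u₁, v₂, u₂}) {A : P.base}

/-! ### Preservation of `n`-fold pullbacks -/

/-- An `n`-fold pullback of the projection of the total category restricts to a fibre. -/
theorem exists_fiber_nfold (E : P.proj.Fiber A) {n : ℕ} {Q : P.total} {b : Q ⟶ E.1}
    {π : Fin n → (Q ⟶ P.total.T.obj E.1)}
    (h : IsNFoldPullback (P.total.str.p.app E.1 : P.total.T.obj E.1 ⟶ E.1) b π) :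
    ∃ (Q₀ : P.proj.Fiber A) (b₀ : Q₀ ⟶ E) (π₀ : Fin n → (Q₀ ⟶ (P.fiberT A).obj E))
      (t : Q₀.1 ⟶ Q), IsCart P.proj t ∧ b₀.1 = t ≫ b ∧
        (∀ i, (π₀ i).1 ≫ P.zeroLift E = t ≫ π i) ∧ IsNFoldPullback (P.fiberP E) b₀ π₀ := by
  obtain ⟨E, rfl⟩ := E
  -- d is the zero morphism E ⟶ T'_n E, all of whose components are z. The fibrewise n-fold pullback
  -- is the pullback of Q along its projection. The legs b and π i lift because d ≫ b is an identity
  -- and d ≫ π i is the zero. Carrying b along also covers n = 0.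
  obtain ⟨d, ⟨hd, hd'⟩, -⟩ := (isNFoldPullback_iff.1 h).2 (𝟙 E)
    (fun _ => P.total.str.z.app E) (fun _ => P.total_zero_proj E)
  let t := P.lift (P.proj.map d) ⟨Q, rfl⟩
  have ht : P.proj.IsStronglyCartesian (P.proj.map d) t := P.lift_cartesian _ _
  have hb : P.proj.IsHomLift (𝟙 (P.proj.obj E)) (t ≫ b) :=
    isHomLift_transfer b ht.toIsHomLift (IsHomLift.map P.proj d) (by rw [hd]; infer_instance)
  have hπ : ∀ i, P.proj.IsHomLift (P.base.str.z.app (P.proj.obj E) :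
      P.proj.obj E ⟶ P.base.T.obj (P.proj.obj E)) (t ≫ π i) := fun i =>
    isHomLift_transfer (π i) ht.toIsHomLift (IsHomLift.map P.proj d)
      (by rw [hd']; exact P.isHomLift_z ⟨E, rfl⟩)
  refine ⟨P.pull (P.proj.map d) ⟨Q, rfl⟩, ⟨t ≫ b, hb⟩, fun i => fiberLift
    (P.zeroLift ⟨E, rfl⟩) (P.isCartesian_zeroLift _) (t ≫ π i) (hπ i), t, .of ht, rfl,
    fun i => fiberLift_fac _ _ _ _, ?_⟩
  exact (FiberComparison.id _).isNFoldPullback_map h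
    (P.preservesTangentLimits_proj.nfold n E Q b π h) (P.isCart_zeroLift _) (IsCart.id E)
    (.of ht) (P.fiberP_fac _) (Category.comp_id _) (fun i => fiberLift_fac _ _ _ _)

theorem exists_total_p_nfold (E : P.total) (n : ℕ) :
    ∃ (Q : P.total) (b : Q ⟶ E) (π : Fin n → (Q ⟶ P.total.T.obj E)),
      IsNFoldPullback (P.total.str.p.app E : P.total.T.obj E ⟶ E) b π :=
  (P.total.str.additive E).exists_nfold n

/-- Every `n`-fold pullback of the projection of a fibre arises from one of the total category. -/
theorem exists_total_nfold {E Q₀ : P.proj.Fiber A} {n : ℕ} {b₀ : Q₀ ⟶ E}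
    {π₀ : Fin n → (Q₀ ⟶ (P.fiberT A).obj E)} (h : IsNFoldPullback (P.fiberP E) b₀ π₀) :
    ∃ (Q : P.total) (b : Q ⟶ E.1) (π : Fin n → (Q ⟶ P.total.T.obj E.1)) (t : Q₀.1 ⟶ Q),
      IsNFoldPullback (P.total.str.p.app E.1 : P.total.T.obj E.1 ⟶ E.1) b π ∧ IsCart P.proj t ∧
        b₀.1 = t ≫ b ∧ ∀ i, (π₀ i).1 ≫ P.zeroLift E = t ≫ π i := by
  obtain ⟨Q, b, π, hQ⟩ := P.exists_total_p_nfold E.1 n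
  obtain ⟨Q₁, b₁, π₁, t, ht, hb, hπ, h₁⟩ := P.exists_fiber_nfold E hQ
  -- An arbitrary n-fold pullback of the fibre is isomorphic to the one cut out of the total
  -- category, and a vertical isomorphism followed by a cartesian morphism is cartesian.
  obtain ⟨e, he, he'⟩ := h.exists_iso h₁
  refine ⟨Q, b, π, e.hom.1 ≫ t, hQ, .comp (.of (isCartesian_fiber_iso e)) ht, ?_, fun i => ?_⟩
  · rw [← he, fiber_comp_val, hb, Category.assoc]
  · rw [← he', fiber_comp_val, Category.assoc, hπ, Category.assoc]

/-- Functors between fibres compared with functors preserving `n`-fold pullbacks of the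
projection preserve them. -/
theorem isNFoldPullback_fiberMap {S : Type u₃} [Category.{v₃} S] {X : Type u₄} [Category.{v₄} X]
    {q : X ⥤ S} {B : S} {G : P.proj.Fiber A ⥤ q.Fiber B} {G' : P.total ⥤ X}
    (γ : FiberComparison G G') {E Q₀ : P.proj.Fiber A} {n : ℕ} {b₀ : Q₀ ⟶ E}
    {π₀ : Fin n → (Q₀ ⟶ (P.fiberT A).obj E)}
    (h₁ : ∀ (Q : P.total) (b : Q ⟶ E.1) (π : Fin n → (Q ⟶ P.total.T.obj E.1)),
      IsNFoldPullback (P.total.str.p.app E.1 : P.total.T.obj E.1 ⟶ E.1) b π →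
      IsNFoldPullback (G'.map (P.total.str.p.app E.1)) (G'.map b) (fun i => G'.map (π i)))
    (h₂ : ∀ (Q : P.total) (b : Q ⟶ E.1) (π : Fin n → (Q ⟶ P.total.T.obj E.1)),
      IsNFoldPullback (P.total.str.p.app E.1 : P.total.T.obj E.1 ⟶ E.1) b π →
      IsNFoldPullback (q.map (G'.map (P.total.str.p.app E.1))) (q.map (G'.map b))
        (fun i => q.map (G'.map (π i))))
    (h : IsNFoldPullback (P.fiberP E) b₀ π₀) :
    IsNFoldPullback (G.map (P.fiberP E)) (G.map b₀) (fun i => G.map (π₀ i)) := by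
  obtain ⟨Q, b, π, t, hQ, ht, hb, hπ⟩ := P.exists_total_nfold h
  exact γ.isNFoldPullback_map (h₁ Q b π hQ) (h₂ Q b π hQ) (P.isCart_zeroLift E) (.id E.1) ht
    (P.fiberP_fac E) ((Category.comp_id _).trans hb) hπ

theorem iter_proj (m : ℕ) : iter P.total.T m ⋙ P.proj = P.proj ⋙ iter P.base.T m := by
  induction m with
  | zero => rfl
  | succ m ih =>
    change iter P.total.T m ⋙ (P.total.T ⋙ P.proj) = (P.proj ⋙ iter P.base.T m) ⋙ P.base.T
    rw [P.T_proj, ← ih]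
    rfl

theorem proj_map_p (E : P.total) : (eqToHom (P.T_obj_proj ⟨E, rfl⟩).symm :
    P.base.T.obj (P.proj.obj E) ⟶ _) ≫ P.proj.map (P.total.str.p.app E) =
      P.base.str.p.app (P.proj.obj E) := by
  have := P.isHomLift_p ⟨E, rfl⟩
  rw [IsHomLift.fac P.proj (P.base.str.p.app (P.proj.obj E)) (P.total.str.p.app E)]
  simp

/-- The projection sends p' to p only after transport along the equality between Π T' and T Π on
objects. Correcting the legs by that `eqToHom` produces an n-fold pullback of p itself, to which the
axioms of the base apply. -/
theorem proj_nfold_base {E Q : P.total} {n : ℕ} {b : Q ⟶ E} {π : Fin n → (Q ⟶ P.total.T.obj E)}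
    (h : IsNFoldPullback (P.total.str.p.app E : P.total.T.obj E ⟶ E) b π) :
    IsNFoldPullback (P.base.str.p.app (P.proj.obj E) : P.base.T.obj _ ⟶ P.proj.obj E)
      (P.proj.map b) (fun i => P.proj.map (π i) ≫ eqToHom (P.T_obj_proj ⟨E, rfl⟩)) := by
  have h' := (P.preservesTangentLimits_proj.nfold n E Q b π h).of_iso
    (q' := (P.base.str.p.app (P.proj.obj E) : P.base.T.obj _ ⟶ P.proj.obj E))
    (eqToIso (P.T_obj_proj ⟨E, rfl⟩)) (Iso.refl _) (by
      rw [← P.proj_map_p, eqToIso.hom, eqToHom_trans_assoc]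
      simp)
  simpa using h'

/-- Removes the correction of `proj_nfold_base` after a functor has been applied. -/
theorem proj_nfold_map {S : Type u₃} [Category.{v₃} S] (F : P.base ⥤ S) {E Q : P.total} {n : ℕ}
    {b : Q ⟶ E} {π : Fin n → (Q ⟶ P.total.T.obj E)}
    (h : IsNFoldPullback (F.map (P.base.str.p.app (P.proj.obj E))) (F.map (P.proj.map b))
      (fun i => F.map (P.proj.map (π i) ≫ eqToHom (P.T_obj_proj ⟨E, rfl⟩)))) :
    IsNFoldPullback (F.map (P.proj.map (P.total.str.p.app E))) (F.map (P.proj.map b))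
      (fun i => F.map (P.proj.map (π i))) := by
  have h' := h.of_iso (q' := F.map (P.proj.map (P.total.str.p.app E)))
    (F.mapIso (eqToIso (P.T_obj_proj ⟨E, rfl⟩).symm)) (Iso.refl _) (by
      rw [← P.proj_map_p]
      erw [Category.comp_id]
      rw [F.map_comp]
      rfl)
  have e : ∀ i, F.map (P.proj.map (π i) ≫ eqToHom (P.T_obj_proj ⟨E, rfl⟩)) ≫
      F.map (eqToHom (P.T_obj_proj ⟨E, rfl⟩).symm) = F.map (P.proj.map (π i)) := fun i => by
    rw [← F.map_comp, Category.assoc, eqToHom_trans, eqToHom_refl, Category.comp_id]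
  rw [← funext e, ← Category.comp_id (F.map (P.proj.map b))]
  exact h'

/-- The iterates of T^A are compared with those of T' by the iterated ζ. Preservation by T'^m is an
axiom of the total category; preservation by T'^m followed by Π follows from that axiom in the base,
since this composite is Π followed by T^m. -/
theorem iter_nfold_fiber (m : ℕ) {E Q₀ : P.proj.Fiber A} {n : ℕ} {b₀ : Q₀ ⟶ E}
    {π₀ : Fin n → (Q₀ ⟶ (P.fiberT A).obj E)} (h : IsNFoldPullback (P.fiberP E) b₀ π₀) :
    IsNFoldPullback ((iter (P.fiberT A) m).map (P.fiberP E)) ((iter (P.fiberT A) m).map b₀)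
      (fun i => (iter (P.fiberT A) m).map (π₀ i)) :=
  P.isNFoldPullback_fiberMap (P.iterComparison A m)
    (fun Q b π hQ => P.total.str.iter_nfold m n E.1 Q b π hQ)
    (fun _ _ _ hQ => IsNFoldPullback.congr_functor (F := P.proj ⋙ iter P.base.T m)
      (G := iter P.total.T m ⋙ P.proj) (P.iter_proj m).symm
      (P.proj_nfold_map _ (P.base.str.iter_nfold m n _ _ _ _ (P.proj_nfold_base hQ)))) h

/-! ### Additive bundles -/

/-- Composition with ζ turns a fibrewise sum a + b into the sum of aζ and bζ in the total category.
The monoid axioms transfer through this formula. -/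
theorem lift_sum_val {E W : P.proj.Fiber A} (a b : W ⟶ (P.fiberT A).obj E)
    (hab : a ≫ P.fiberP E = b ≫ P.fiberP E)
    (hab' : (a.1 ≫ P.zeroLift E) ≫ P.total.str.p.app E.1 =
      (b.1 ≫ P.zeroLift E) ≫ P.total.str.p.app E.1) :
    ((P.fiber_isPullback E).lift a b hab ≫ P.fiberSum E).1 ≫ P.zeroLift E =
      (P.total_isPullback E.1).lift (a.1 ≫ P.zeroLift E) (b.1 ≫ P.zeroLift E) hab' ≫
        P.total.str.s.app E.1 := by
  have h : ((P.fiber_isPullback E).lift a b hab).1 ≫ P.diagLift E =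
      (P.total_isPullback E.1).lift (a.1 ≫ P.zeroLift E) (b.1 ≫ P.zeroLift E) hab' :=
    P.diagLift_ext (by rw [IsPullback.lift_fst, IsPullback.lift_fst])
      (by rw [IsPullback.lift_snd, IsPullback.lift_snd])
  rw [fiber_comp_val, Category.assoc, fiberSum_fac, reassoc_of% h]

theorem fiberP_val {E W : P.proj.Fiber A} {a b : W ⟶ (P.fiberT A).obj E}
    (hab : a ≫ P.fiberP E = b ≫ P.fiberP E) :
    (a.1 ≫ P.zeroLift E) ≫ P.total.str.p.app E.1 =
      (b.1 ≫ P.zeroLift E) ≫ P.total.str.p.app E.1 := by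
  rw [Category.assoc, Category.assoc]
  exact congrArg Subtype.val hab

theorem fiberZ_proj (E : P.proj.Fiber A) : P.fiberZ E ≫ P.fiberP E = 𝟙 E := by
  refine Subtype.ext ?_
  change (P.fiberZ E).1 ≫ P.zeroLift E ≫ P.total.str.p.app E.1 = 𝟙 E.1
  rw [reassoc_of% P.fiberZ_fac E, total_zero_proj]

theorem fiberSum_proj (E : P.proj.Fiber A) :
    P.fiberSum E ≫ P.fiberP E = P.fiberFst E ≫ P.fiberP E := by
  refine Subtype.ext ?_
  change (P.fiberSum E).1 ≫ P.zeroLift E ≫ P.total.str.p.app E.1 =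
    (P.fiberFst E).1 ≫ P.zeroLift E ≫ P.total.str.p.app E.1
  rw [reassoc_of% P.fiberSum_fac E, reassoc_of% P.fiberFst_fac E]
  congr 1
  exact (P.total.str.additive E.1).sum_proj

theorem lift_sum_proj {E W : P.proj.Fiber A} (a b : W ⟶ (P.fiberT A).obj E)
    (hab : a ≫ P.fiberP E = b ≫ P.fiberP E) :
    ((P.fiber_isPullback E).lift a b hab ≫ P.fiberSum E) ≫ P.fiberP E = a ≫ P.fiberP E := by
  rw [Category.assoc, fiberSum_proj, IsPullback.lift_fst_assoc]

theorem fiber_additive (E : P.proj.Fiber A) : ((P.fiberData A).bundle E).IsAdditive where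
  exists_nfold n := by
    obtain ⟨Q, b, π, hQ⟩ := P.exists_total_p_nfold E.1 n
    obtain ⟨Q₁, b₁, π₁, t, ht, hb, hπ, h₁⟩ := P.exists_fiber_nfold E hQ
    exact ⟨Q₁, b₁, π₁, h₁⟩
  isPullback := P.fiber_isPullback E
  zero_proj := P.fiberZ_proj E
  sum_proj := P.fiberSum_proj E
  sum_assoc {W} a b c hab hbc := by
    refine (P.isCart_zeroLift E).fiber_ext ?_
    have h := (P.total.str.additive E.1).sum_assoc (a.1 ≫ P.zeroLift E) (b.1 ≫ P.zeroLift E)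
      (c.1 ≫ P.zeroLift E) (P.fiberP_val hab) (P.fiberP_val hbc)
    -- The outer sums are evaluated by `lift_sum_val`, associativity is used in the total category,
    -- and the inner sums are then matched by the same formula.
    refine (P.lift_sum_val _ _ _ (P.fiberP_val ?_)).trans (Eq.trans ?_
      (h.trans (Eq.trans ?_ (P.lift_sum_val _ _ _ (P.fiberP_val ?_)).symm)))
    · exact (P.lift_sum_proj a b hab).trans (hab.trans hbc)
    · congr 1
      exact isPullback_lift_congr _ (P.lift_sum_val a b hab (P.fiberP_val hab)) rfl _
    · congr 1
      exact isPullback_lift_congr _ rfl (P.lift_sum_val b c hbc (P.fiberP_val hbc)).symm _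
    · exact hab.trans (P.lift_sum_proj b c hbc).symm
  zero_sum := by
    refine (P.isCart_zeroLift E).fiber_ext ?_
    have h := (P.total.str.additive E.1).zero_sum
    have w : (P.fiberP E ≫ P.fiberZ E) ≫ P.fiberP E = 𝟙 _ ≫ P.fiberP E := by
      rw [Category.assoc, fiberZ_proj, Category.comp_id, Category.id_comp]
    refine (P.lift_sum_val _ _ w (P.fiberP_val w)).trans (Eq.trans ?_
      ((congrArg (P.zeroLift E ≫ ·) h).trans ((Category.comp_id _).trans
        (Category.id_comp _).symm)))
    refine Eq.trans ?_ (Category.assoc _ _ _)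
    congr 1
    refine Eq.trans ?_ (isPullback_comp_lift _ _ _).symm
    refine isPullback_lift_congr _ ?_ ?_ _
    · rw [fiber_comp_val, Category.assoc, fiberZ_fac]
      exact Category.assoc _ _ _
    · exact (Category.id_comp _).trans (Category.comp_id _).symm
  sum_comm := by
    refine (P.isCart_zeroLift E).fiber_ext ?_
    have h := (P.total.str.additive E.1).sum_comm
    have w := (P.fiber_isPullback E).w.symm
    refine (P.lift_sum_val _ _ w (P.fiberP_val w)).trans (Eq.trans ?_
      ((congrArg (P.diagLift E ≫ ·) h).trans (P.fiberSum_fac E).symm))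
    refine Eq.trans ?_ (Category.assoc _ _ _)
    congr 1
    refine Eq.trans ?_ (isPullback_comp_lift _ _ _).symm
    exact isPullback_lift_congr _ (P.fiberSnd_fac E) (P.fiberFst_fac E) _

/-- The comparison of the tangent bundle of a fibre with that of the total category, along a
cartesian morphism. -/
noncomputable def bundleComparison (E : P.proj.Fiber A) {X : P.total} (x : E.1 ⟶ X)
    (hx : IsCart P.proj x) :
    BundleComparison ((P.fiberData A).bundle E) (P.total.str.bundle X) where
  B := x
  E := (P.zeroComparison A).map x
  E₂ := P.diagLift E ≫ P.total.str.T₂.map x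
  isCart_B := hx
  isCart_E := (P.zeroComparison A).isCart_map hx
  q := by
    change (P.zeroLift E ≫ P.total.str.p.app E.1) ≫ x =
      (P.zeroLift E ≫ P.total.T.map x) ≫ P.total.str.p.app X
    rw [Category.assoc, Category.assoc]
    congr 1
    exact (P.total.str.p.naturality x).symm
  π₁ := by
    change (P.fiberFst E).1 ≫ P.zeroLift E ≫ P.total.T.map x =
      (P.diagLift E ≫ P.total.str.T₂.map x) ≫ P.total.str.π₁.app X
    rw [reassoc_of% P.fiberFst_fac E, Category.assoc, P.total.str.π₁.naturality]
  π₂ := by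
    change (P.fiberSnd E).1 ≫ P.zeroLift E ≫ P.total.T.map x =
      (P.diagLift E ≫ P.total.str.T₂.map x) ≫ P.total.str.π₂.app X
    rw [reassoc_of% P.fiberSnd_fac E, Category.assoc, P.total.str.π₂.naturality]
  z := by
    change (P.fiberZ E).1 ≫ P.zeroLift E ≫ P.total.T.map x = x ≫ P.total.str.z.app X
    rw [reassoc_of% P.fiberZ_fac E]
    exact (P.total.str.z.naturality x).symm
  s := by
    change (P.fiberSum E).1 ≫ P.zeroLift E ≫ P.total.T.map x =
      (P.diagLift E ≫ P.total.str.T₂.map x) ≫ P.total.str.s.app X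
    rw [reassoc_of% P.fiberSum_fac E, Category.assoc, P.total.str.s.naturality]

theorem isPullback_T (E : P.proj.Fiber A) :
    IsPullback ((P.fiberT A).map (P.fiberFst E)) ((P.fiberT A).map (P.fiberSnd E))
      ((P.fiberT A).map (P.fiberP E)) ((P.fiberT A).map (P.fiberP E)) :=
  isPullback_map_of_nfold (P.fiberT A) (P.fiber_isPullback E)
    -- The first iterate of T^A is T^A itself by unfolding.
    (fun _ _ h => P.iter_nfold_fiber 1 h)

theorem total_isPullback_T (E : P.total) :
    IsPullback (P.total.T.map (P.total.str.π₁.app E)) (P.total.T.map (P.total.str.π₂.app E))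
      (P.total.T.map (P.total.str.p.app E)) (P.total.T.map (P.total.str.p.app E)) :=
  isPullback_map_of_nfold P.total.T (P.total_isPullback E)
    (fun _ _ h => P.total.str.iter_nfold 1 2 E _ _ _ h)

theorem fiber_lift_additive (E : P.proj.Fiber A) :
    IsAdditiveMorphism ((P.fiberData A).bundle E) (((P.fiberData A).bundle E).map (P.fiberT A))
      (P.fiberZ E) (P.fiberL E) := by
  refine (P.bundleComparison E (𝟙 E.1) (.id _)).isAdditiveMorphism_of_isPullback
    ((P.bundleComparison E (𝟙 E.1) (.id _)).map (P.zeroComparison A))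
    (P.total.str.lift_additive E.1) ?_ ?_ (P.fiber_isPullback E).w (P.isPullback_T E)
    (P.total_isPullback_T E.1)
  · change (P.fiberZ E).1 ≫ P.zeroLift E ≫ P.total.T.map (𝟙 E.1) = 𝟙 E.1 ≫ P.total.str.z.app E.1
    rw [reassoc_of% P.fiberZ_fac E, CategoryTheory.Functor.map_id, Category.id_comp]
    exact Category.comp_id _
  · change (P.fiberL E).1 ≫ P.zeroLift _ ≫ P.total.T.map (P.zeroLift E ≫ P.total.T.map (𝟙 E.1)) =
      (P.zeroLift E ≫ P.total.T.map (𝟙 E.1)) ≫ P.total.str.l.app E.1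
    rw [CategoryTheory.Functor.map_id, Category.comp_id]
    exact P.fiberL_fac E

/-- The codomain is the bundle of the fibre at T^A E, which must be compared with the bundle of T'
at T'E and not at the underlying object of T^A E. For this `bundleComparison` is taken along ζ; both
comparisons then have ζ² as their component on total objects. -/
theorem fiber_flip_additive (E : P.proj.Fiber A) :
    IsAdditiveMorphism (((P.fiberData A).bundle E).map (P.fiberT A))
      ((P.fiberData A).bundle ((P.fiberT A).obj E)) (𝟙 ((P.fiberT A).obj E)) (P.fiberC E) := by
  refine ((P.bundleComparison E (𝟙 E.1) (.id _)).map
      (P.zeroComparison A)).isAdditiveMorphism_of_isPullback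
    (P.bundleComparison ((P.fiberT A).obj E) (P.zeroLift E) (P.isCart_zeroLift E))
    (P.total.str.flip_additive E.1) ?_ ?_ (P.isPullback_T E).w
    (P.fiber_isPullback ((P.fiberT A).obj E)) (P.total_isPullback (P.total.T.obj E.1))
  · change 𝟙 _ ≫ P.zeroLift E = (P.zeroLift E ≫ P.total.T.map (𝟙 E.1)) ≫ 𝟙 _
    rw [CategoryTheory.Functor.map_id, Category.comp_id, Category.comp_id, Category.id_comp]
  · change (P.fiberC E).1 ≫ P.zeroLift₂ E =
      (P.zeroLift _ ≫ P.total.T.map (P.zeroLift E ≫ P.total.T.map (𝟙 E.1))) ≫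
        P.total.str.c.app E.1
    rw [CategoryTheory.Functor.map_id, Category.comp_id]
    exact P.fiberC_fac E

/-! ### Vertical lift -/

/-- The auxiliary morphisms ⟨π₁ l, π₂ z_T⟩ of the fibre and of the total category are compared
first; applying the sums under the tangent functors then compares the vertical lift maps. -/
theorem verticalLift_fac (E : P.proj.Fiber A)
    {w : P.fiberT₂ E ⟶ (P.fiberT A).obj ((P.fiberT A).obj E)}
    (hw : (P.fiberData A).IsVerticalLiftMap E w)
    {w' : P.total.str.T₂.obj E.1 ⟶ P.total.T.obj (P.total.T.obj E.1)}
    (hw' : P.total.str.IsVerticalLiftMap E.1 w') :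
    w.1 ≫ P.zeroLift₂ E = P.diagLift E ≫ w' := by
  obtain ⟨r, h1, h2, rfl⟩ := hw
  obtain ⟨r', h1', h2', rfl⟩ := hw'
  change P.fiberT₂ E ⟶ (P.fiberT A).obj (P.fiberT₂ E) at r
  have h1 : r.1 ≫ ((P.fiberT A).map (P.fiberFst E)).1 = (P.fiberFst E).1 ≫ (P.fiberL E).1 :=
    congrArg Subtype.val h1
  have h2 : r.1 ≫ ((P.fiberT A).map (P.fiberSnd E)).1 =
    (P.fiberSnd E).1 ≫ (P.fiberZ ((P.fiberT A).obj E)).1 := congrArg Subtype.val h2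
  -- T' T'_2 E is a pullback of T'(p'), so two equations suffice: the factorization of the lift for
  -- the first projection, and that of the zero, with naturality of z' at ζ, for the second.
  have key : r.1 ≫ (P.zeroComparison A).map (P.diagLift E) = P.diagLift E ≫ r' := by
    apply (P.total_isPullback_T E.1).hom_ext
    · rw [Category.assoc, (P.zeroComparison A).map_comp_map, ← fiberFst_fac,
        ← (P.zeroComparison A).map_val_map, reassoc_of% h1]
      change _ ≫ _ ≫ P.zeroLift₂ E = _
      rw [fiberL_fac, reassoc_of% P.fiberFst_fac E, Category.assoc, h1']
    · rw [Category.assoc, (P.zeroComparison A).map_comp_map, ← fiberSnd_fac,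
        ← (P.zeroComparison A).map_val_map, reassoc_of% h2]
      change _ ≫ _ ≫ P.zeroLift _ ≫ P.total.T.map (P.zeroLift E) = _
      have hn := P.total.str.z.naturality (P.zeroLift E)
      rw [reassoc_of% P.fiberZ_fac ((P.fiberT A).obj E), Category.assoc, h2',
        ← reassoc_of% P.fiberSnd_fac E]
      congr 1
      exact hn.symm
  change (r.1 ≫ ((P.fiberT A).map (P.fiberSum E)).1) ≫ (P.zeroComparison A).map (P.zeroLift E) = _
  rw [Category.assoc, (P.zeroComparison A).map_val_map, fiberSum_fac,
    ← (P.zeroComparison A).map_comp_map, reassoc_of% key]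

/-- Functors between fibres compared with functors preserving the universal property of the
vertical lift preserve it. -/
theorem isPullback_fiber_verticalLift {S : Type u₃} [Category.{v₃} S] {X : Type u₄}
    [Category.{v₄} X] {q : X ⥤ S} {B : S} {G : P.proj.Fiber A ⥤ q.Fiber B} {G' : P.total ⥤ X}
    (γ : FiberComparison G G') (E : P.proj.Fiber A)
    (h₁ : ∀ w', P.total.str.IsVerticalLiftMap E.1 w' → IsPullback (G'.map w')
      (G'.map (P.total.str.π₁.app E.1 ≫ P.total.str.p.app E.1))
      (G'.map (P.total.T.map (P.total.str.p.app E.1))) (G'.map (P.total.str.z.app E.1)))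
    (h₂ : ∀ w', P.total.str.IsVerticalLiftMap E.1 w' → IsPullback (q.map (G'.map w'))
      (q.map (G'.map (P.total.str.π₁.app E.1 ≫ P.total.str.p.app E.1)))
      (q.map (G'.map (P.total.T.map (P.total.str.p.app E.1))))
      (q.map (G'.map (P.total.str.z.app E.1))))
    {w : P.fiberT₂ E ⟶ (P.fiberT A).obj ((P.fiberT A).obj E)}
    (hw : (P.fiberData A).IsVerticalLiftMap E w) :
    IsPullback (G.map w) (G.map (P.fiberFst E ≫ P.fiberP E))
      (G.map ((P.fiberT A).map (P.fiberP E))) (G.map (P.fiberZ E)) := by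
  obtain ⟨w', hw', -⟩ := P.total.str.lift_universal E.1
  refine γ.isPullback_map (h₁ w' hw') (h₂ w' hw') (P.isCart_zeroLift₂ E) (IsCart.id E.1)
    (P.isCart_zeroLift E) (P.isCart_diagLift E) (P.verticalLift_fac E hw hw') ?_ ?_ ?_
  · rw [fiber_comp_val, Category.assoc, fiberP_fac, reassoc_of% P.fiberFst_fac E]
  · change ((P.fiberT A).map (P.fiberP E)).1 ≫ P.zeroLift E =
      (P.zeroComparison A).map (P.zeroLift E) ≫ _
    rw [zeroLift_naturality, (P.zeroComparison A).map_comp_map]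
    rfl
  · rw [fiberZ_fac]
    exact (Category.id_comp _).symm

/-- T^A preserves the fibre product of p, so ⟨π₁ l, π₂ z_T⟩ exists once its components agree after
T(p). Both become the common projection to E followed by z: the first because l lies over z, the
second by naturality of z. -/
theorem exists_fiber_verticalLift (E : P.proj.Fiber A) :
    ∃ w, (P.fiberData A).IsVerticalLiftMap E w := by
  have hl := (P.fiber_lift_additive E).proj
  change P.fiberP E ≫ P.fiberZ E = P.fiberL E ≫ (P.fiberT A).map (P.fiberP E) at hl
  have w : (P.fiberFst E ≫ P.fiberL E) ≫ (P.fiberT A).map (P.fiberP E) =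
      (P.fiberSnd E ≫ P.fiberZ _) ≫ (P.fiberT A).map (P.fiberP E) := by
    rw [Category.assoc, Category.assoc, ← hl, ← P.fiberZ_naturality,
      reassoc_of% (P.fiber_isPullback E).w]
  exact ⟨_, (P.isPullback_T E).lift _ _ w, (P.isPullback_T E).lift_fst _ _ w,
    (P.isPullback_T E).lift_snd _ _ w, rfl⟩

/-! ### Equations -/

/-- The chosen lift of the triply iterated zero. -/
noncomputable def zeroLift₃ (E : P.proj.Fiber A) :
    ((P.fiberT A).obj ((P.fiberT A).obj ((P.fiberT A).obj E))).1 ⟶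
      P.total.T.obj (P.total.T.obj (P.total.T.obj E.1)) :=
  (P.zeroComparison A).map (P.zeroLift₂ E)

theorem isCart_zeroLift₃ (E : P.proj.Fiber A) : IsCart P.proj (P.zeroLift₃ E) :=
  (P.zeroComparison A).isCart_map (P.isCart_zeroLift₂ E)

/-- The triple lift has two bracketings. As the image of ζ² it is adapted to T(c) and T(l); as ζ² at
T^A E followed by T'T'(ζ) it is adapted to c and l at T^A E, where naturality in ζ is used. -/
theorem zeroLift₃_eq (E : P.proj.Fiber A) :
    P.zeroLift₃ E = P.zeroLift₂ ((P.fiberT A).obj E) ≫ P.total.T.map (P.total.T.map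
      (P.zeroLift E)) := by
  change P.zeroLift _ ≫ P.total.T.map (P.zeroLift _ ≫ P.total.T.map (P.zeroLift E)) =
    (P.zeroLift _ ≫ P.total.T.map (P.zeroLift _)) ≫ _
  rw [Functor.map_comp, Category.assoc]

theorem T_fiberC_fac (E : P.proj.Fiber A) : ((P.fiberT A).map (P.fiberC E)).1 ≫ P.zeroLift₃ E =
    P.zeroLift₃ E ≫ P.total.T.map (P.total.str.c.app E.1) :=
  (P.zeroComparison A).map_square (P.fiberC_fac E)

theorem T_fiberL_fac (E : P.proj.Fiber A) : ((P.fiberT A).map (P.fiberL E)).1 ≫ P.zeroLift₃ E =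
    P.zeroLift₂ E ≫ P.total.T.map (P.total.str.l.app E.1) :=
  (P.zeroComparison A).map_square (P.fiberL_fac E)

theorem fiberC_T_fac (E : P.proj.Fiber A) :
    (P.fiberC ((P.fiberT A).obj E)).1 ≫ P.zeroLift₃ E =
      P.zeroLift₃ E ≫ P.total.str.c.app (P.total.T.obj E.1) := by
  rw [zeroLift₃_eq, reassoc_of% P.fiberC_fac ((P.fiberT A).obj E), Category.assoc]
  congr 1
  exact (P.total.str.c.naturality (P.zeroLift E)).symm

theorem fiberL_T_fac (E : P.proj.Fiber A) :
    (P.fiberL ((P.fiberT A).obj E)).1 ≫ P.zeroLift₃ E =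
      P.zeroLift₂ E ≫ P.total.str.l.app (P.total.T.obj E.1) := by
  rw [zeroLift₃_eq, reassoc_of% P.fiberL_fac ((P.fiberT A).obj E), zeroLift₂, Category.assoc]
  congr 1
  exact (P.total.str.l.naturality (P.zeroLift E)).symm

/-- The tangent structure of the fibre. -/
noncomputable def fiberStr (A : P.base) : TangentStructure (P.fiberT A) where
  toTangentData := P.fiberData A
  additive := P.fiber_additive
  iter_nfold m _ _ _ _ _ h := P.iter_nfold_fiber m h
  lift_additive := P.fiber_lift_additive
  flip_additive := P.fiber_flip_additive
  lift_coassoc E := by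
    change P.fiberL E ≫ (P.fiberT A).map (P.fiberL E) = P.fiberL E ≫ P.fiberL _
    -- As in the remaining equations, composition with the iterated lift moves each structure
    -- morphism of the fibre past it, and what remains is the axiom of the total tangent structure.
    refine (P.isCart_zeroLift₃ E).fiber_ext ?_
    rw [fiber_comp_val, fiber_comp_val, Category.assoc, Category.assoc, T_fiberL_fac,
      fiberL_T_fac, reassoc_of% P.fiberL_fac E, reassoc_of% P.fiberL_fac E,
      P.total.str.lift_coassoc]
  flip_flip E := by
    change P.fiberC E ≫ P.fiberC E = 𝟙 _
    refine (P.isCart_zeroLift₂ E).fiber_ext ?_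
    rw [fiber_comp_val, Category.assoc, fiberC_fac, reassoc_of% P.fiberC_fac E,
      P.total.str.flip_flip]
    exact (Category.comp_id _).trans (Category.id_comp _).symm
  flip_braid E := by
    change (P.fiberT A).map (P.fiberC E) ≫ P.fiberC _ ≫ (P.fiberT A).map (P.fiberC E) =
      P.fiberC _ ≫ (P.fiberT A).map (P.fiberC E) ≫ P.fiberC _
    refine (P.isCart_zeroLift₃ E).fiber_ext ?_
    simp only [fiber_comp_val, Category.assoc]
    rw [T_fiberC_fac, reassoc_of% P.fiberC_T_fac E, reassoc_of% P.T_fiberC_fac E, fiberC_T_fac,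
      reassoc_of% P.T_fiberC_fac E, reassoc_of% P.fiberC_T_fac E, P.total.str.flip_braid]
  lift_flip E := by
    change P.fiberL E ≫ P.fiberC E = P.fiberL E
    refine (P.isCart_zeroLift₂ E).fiber_ext ?_
    rw [fiber_comp_val, Category.assoc, fiberC_fac, reassoc_of% P.fiberL_fac E,
      P.total.str.lift_flip, fiberL_fac]
  lift_flip' E := by
    change P.fiberL _ ≫ (P.fiberT A).map (P.fiberC E) ≫ P.fiberC _ =
      P.fiberC E ≫ (P.fiberT A).map (P.fiberL E)
    refine (P.isCart_zeroLift₃ E).fiber_ext ?_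
    simp only [fiber_comp_val, Category.assoc]
    rw [fiberC_T_fac, reassoc_of% P.T_fiberC_fac E, reassoc_of% P.fiberL_T_fac E, T_fiberL_fac,
      reassoc_of% P.fiberC_fac E, P.total.str.lift_flip']
  lift_universal E := by
    obtain ⟨w, hw⟩ := P.exists_fiber_verticalLift E
    -- Taken with the identity comparison, the transport lemma says that the universal square of the
    -- total category restricts to the fibre.
    exact ⟨w, hw, P.isPullback_fiber_verticalLift (FiberComparison.id A) E
      (fun w' hw' => (PreservesTangentLimits.id P.total).vlift E.1 w' hw')
      (fun w' hw' => P.preservesTangentLimits_proj.vlift E.1 w' hw') hw⟩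

end TangentFibration

/-- The isomorphism between the domains of two cartesian morphisms over the same morphism. -/
noncomputable def fiberIso {S : Type u₁} [Category.{v₁} S] {E : Type u₂} [Category.{v₂} E]
    {p : E ⥤ S} {A B : S} {W X : p.Fiber A} {f : A ⟶ B} {Y : E} (w : W.1 ⟶ Y)
    (hw : p.IsStronglyCartesian f w) (x : X.1 ⟶ Y) (hx : p.IsStronglyCartesian f x) : W ≅ X where
  hom := fiberLift x hx w hw.toIsHomLift
  inv := fiberLift w hw x hx.toIsHomLift
  hom_inv_id := fiber_ext w hw (by
    rw [fiber_comp_val, Category.assoc, fiberLift_fac, fiberLift_fac]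
    exact (Category.id_comp _).symm)
  inv_hom_id := fiber_ext x hx (by
    rw [fiber_comp_val, Category.assoc, fiberLift_fac, fiberLift_fac]
    exact (Category.id_comp _).symm)

theorem fiberIso_hom_fac {S : Type u₁} [Category.{v₁} S] {E : Type u₂} [Category.{v₂} E]
    {p : E ⥤ S} {A B : S} {W X : p.Fiber A} {f : A ⟶ B} {Y : E} (w : W.1 ⟶ Y)
    (hw : p.IsStronglyCartesian f w) (x : X.1 ⟶ Y) (hx : p.IsStronglyCartesian f x) :
    (fiberIso w hw x hx).hom.1 ≫ x = w :=
  fiberLift_fac _ _ _ _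

/-! ### Substitution functors and the pseudofunctor of fibres -/

namespace TangentFibration

variable (P : TangentFibration.{v₁, u₁, v₂, u₂}) {A A' A'' : P.base}

/-- The fibres as tangent categories. -/
noncomputable abbrev fiberCat (A : P.base) : TangentCat.{v₂, u₂} :=
  ⟨P.proj.Fiber A, P.fiberT A, P.fiberStr A⟩

/-- The chosen lifts, as morphisms out of the value of a substitution functor. -/
noncomputable def subLift (f : A ⟶ A') (E : P.proj.Fiber A') : ((P.sub f).obj E).1 ⟶ E.1 :=
  P.lift f E

theorem isCartesian_subLift (f : A ⟶ A') (E : P.proj.Fiber A') :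
    P.proj.IsStronglyCartesian f (P.subLift f E) :=
  P.lift_cartesian f E

theorem isCart_subLift (f : A ⟶ A') (E : P.proj.Fiber A') : IsCart P.proj (P.subLift f E) :=
  .of (P.isCartesian_subLift f E)

theorem subLift_naturality (f : A ⟶ A') {E E' : P.proj.Fiber A'} (φ : E ⟶ E') :
    ((P.sub f).map φ).1 ≫ P.subLift f E' = P.subLift f E ≫ φ.1 :=
  P.sub_map_fac f φ

/-- The coherence axioms hold up to transport along equalities such as 𝟙 ≫ f = f. This is the rule
for cancelling such a transport against a chosen lift. -/
theorem eqToHom_subLift {f g : A ⟶ A'} (e : f = g) (E : P.proj.Fiber A')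
    (h : (P.sub f).obj E = (P.sub g).obj E) :
    (eqToHom h : (P.sub f).obj E ⟶ (P.sub g).obj E).1 ≫ P.subLift g E = P.subLift f E := by
  subst e
  exact Category.id_comp _

/-- The chosen cartesian morphism `f^* T E ⟶ T' E`. -/
noncomputable def subZeroLift (f : A ⟶ A') (E : P.proj.Fiber A') :
    ((P.sub f).obj ((P.fiberT A').obj E)).1 ⟶ P.total.T.obj E.1 :=
  P.subLift f _ ≫ P.zeroLift E

theorem isCartesian_subZeroLift (f : A ⟶ A') (E : P.proj.Fiber A') :
    P.proj.IsStronglyCartesian (f ≫ (P.base.str.z.app A' : A' ⟶ P.base.T.obj A'))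
      (P.subZeroLift f E) :=
  isCartesian_comp (P.isCartesian_subLift f _) (P.isCartesian_zeroLift E)

theorem isCart_subZeroLift (f : A ⟶ A') (E : P.proj.Fiber A') :
    IsCart P.proj (P.subZeroLift f E) :=
  .of (P.isCartesian_subZeroLift f E)

/-- The composite naturally lies over z T(f), which naturality of z rewrites as f z. It thus lies
over the same morphism as `subZeroLift`, and comparing the two gives an invertible distributive law.
-/
theorem isCartesian_zeroSubLift (f : A ⟶ A') (E : P.proj.Fiber A') :
    P.proj.IsStronglyCartesian (f ≫ (P.base.str.z.app A' : A' ⟶ P.base.T.obj A'))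
      (P.zeroLift ((P.sub f).obj E) ≫ P.total.T.map (P.subLift f E)) :=
  isCartesian_congr (isCartesian_comp (P.isCartesian_zeroLift _)
    (P.isCartesian_T (P.isCartesian_subLift f E))) (P.base.str.z.naturality f).symm rfl

/-- The distributive laws of the substitution functors. -/
noncomputable def subLawIso (f : A ⟶ A') (E : P.proj.Fiber A') :
    (P.fiberT A).obj ((P.sub f).obj E) ≅ (P.sub f).obj ((P.fiberT A').obj E) :=
  fiberIso _ (P.isCartesian_zeroSubLift f E) _ (P.isCartesian_subZeroLift f E)

theorem subLaw_fac (f : A ⟶ A') (E : P.proj.Fiber A') :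
    (P.subLawIso f E).hom.1 ≫ P.subZeroLift f E =
      P.zeroLift ((P.sub f).obj E) ≫ P.total.T.map (P.subLift f E) :=
  fiberIso_hom_fac _ _ _ _

theorem subZeroLift_naturality (f : A ⟶ A') {E E' : P.proj.Fiber A'} (φ : E ⟶ E') :
    ((P.sub f).map ((P.fiberT A').map φ)).1 ≫ P.subZeroLift f E' =
      P.subZeroLift f E ≫ P.total.T.map φ.1 := by
  rw [subZeroLift, ← Category.assoc, subLift_naturality, Category.assoc, zeroLift_naturality,
    subZeroLift, Category.assoc]

theorem subLaw_naturality (f : A ⟶ A') {E E' : P.proj.Fiber A'} (φ : E ⟶ E') :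
    (P.fiberT A).map ((P.sub f).map φ) ≫ (P.subLawIso f E').hom =
      (P.subLawIso f E).hom ≫ (P.sub f).map ((P.fiberT A').map φ) := by
  refine (P.isCart_subZeroLift f E').fiber_ext ?_
  rw [fiber_comp_val, fiber_comp_val, Category.assoc, Category.assoc, subLaw_fac,
    subZeroLift_naturality, reassoc_of% P.subLaw_fac f E,
    reassoc_of% P.zeroLift_naturality ((P.sub f).map φ), ← Functor.map_comp,
    subLift_naturality, Functor.map_comp]

/-- The chosen lifts compare f^* with the identity functor of the total category, so all that is
required is that the total limits are limits and that Π preserves them. -/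
theorem preservesTangentLimits_sub (f : A ⟶ A') :
    PreservesTangentLimits (X := P.fiberCat A') (Y := P.fiberCat A) (P.sub f) where
  nfold n E _ _ _ h := P.isNFoldPullback_fiberMap (P.subComparison f) (fun _ _ _ h => h)
    (fun Q b π h => P.preservesTangentLimits_proj.nfold n E.1 Q b π h) h
  vlift E _ h := P.isPullback_fiber_verticalLift (P.subComparison f) E
    (fun w' hw' => (PreservesTangentLimits.id P.total).vlift E.1 w' hw')
    (fun w' hw' => P.preservesTangentLimits_proj.vlift E.1 w' hw') h

/-- The chosen cartesian morphism `f^* T T E ⟶ T' T' E`. -/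
noncomputable def subZeroLift₂ (f : A ⟶ A') (E : P.proj.Fiber A') :
    ((P.sub f).obj ((P.fiberT A').obj ((P.fiberT A').obj E))).1 ⟶
      P.total.T.obj (P.total.T.obj E.1) :=
  P.subLift f _ ≫ P.zeroLift₂ E

theorem isCart_subZeroLift₂ (f : A ⟶ A') (E : P.proj.Fiber A') :
    IsCart P.proj (P.subZeroLift₂ f E) :=
  (P.isCart_subLift f _).comp (P.isCart_zeroLift₂ E)

/-- The law applied twice, T T f^* ⟶ f^* T T, lies over T'T' of the chosen lift. Compatibility with
l and c thereby becomes naturality of l' and c' at that lift. -/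
theorem subLaw₂_fac (f : A ⟶ A') (E : P.proj.Fiber A') :
    ((P.fiberT A).map (P.subLawIso f E).hom).1 ≫ (P.subLawIso f ((P.fiberT A').obj E)).hom.1 ≫
        P.subZeroLift₂ f E =
      P.zeroLift₂ ((P.sub f).obj E) ≫ P.total.T.map (P.total.T.map (P.subLift f E)) := by
  have e : P.subZeroLift₂ f E =
      P.subZeroLift f ((P.fiberT A').obj E) ≫ P.total.T.map (P.zeroLift E) := by
    rw [subZeroLift₂, zeroLift₂, subZeroLift, Category.assoc]
  rw [e, reassoc_of% P.subLaw_fac f ((P.fiberT A').obj E), ← P.total.T.map_comp]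
  change _ ≫ _ ≫ P.total.T.map (P.subZeroLift f E) = _
  rw [reassoc_of% P.zeroLift_naturality (P.subLawIso f E).hom, ← P.total.T.map_comp, subLaw_fac,
    P.total.T.map_comp, zeroLift₂, Category.assoc]

theorem subZeroLift₂_fac (f : A ⟶ A') {E X : P.proj.Fiber A'}
    (φ : X ⟶ (P.fiberT A').obj ((P.fiberT A').obj E)) :
    ((P.sub f).map φ).1 ≫ P.subZeroLift₂ f E = P.subLift f X ≫ φ.1 ≫ P.zeroLift₂ E := by
  rw [subZeroLift₂, ← Category.assoc, subLift_naturality, Category.assoc]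

/-- The substitution functors as colax tangent morphisms. -/
noncomputable def subLaw (f : A ⟶ A') :
    ColaxLaw (X := P.fiberCat A') (Y := P.fiberCat A) (P.sub f) where
  β :=
    { app := fun E => (P.subLawIso f E).hom
      naturality := fun _ _ φ => P.subLaw_naturality f φ }
  additive E := by
    -- Both the bundle at f^* E and the image under f^* of the bundle at E are compared with the
    -- bundle of T' at E; over it the law covers the identity, which is additive.
    refine (P.bundleComparison ((P.sub f).obj E) (P.subLift f E)
      (P.isCart_subLift f E)).isAdditiveMorphism_of_isPullback
      ((P.bundleComparison E (𝟙 E.1) (.id _)).map (P.subComparison f))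
      (IsAdditiveMorphism.refl (P.total.str.bundle E.1)) ?_ ?_
      (P.fiber_isPullback ((P.sub f).obj E)).w
      ((P.preservesTangentLimits_sub f).isPullback E) (P.total_isPullback E.1)
    · change 𝟙 _ ≫ P.subLift f E ≫ 𝟙 _ = P.subLift f E ≫ 𝟙 _
      rw [Category.id_comp]
    · change (P.subLawIso f E).hom.1 ≫ P.subLift f _ ≫ P.zeroLift E ≫ P.total.T.map (𝟙 E.1) =
        (P.zeroLift ((P.sub f).obj E) ≫ P.total.T.map (P.subLift f E)) ≫ 𝟙 _
      rw [CategoryTheory.Functor.map_id, Category.comp_id, Category.comp_id]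
      exact P.subLaw_fac f E
  lift E := by
    change P.fiberL _ ≫ (P.fiberT A).map (P.subLawIso f E).hom ≫ (P.subLawIso f _).hom =
      (P.subLawIso f E).hom ≫ (P.sub f).map (P.fiberL E)
    refine (P.isCart_subZeroLift₂ f E).fiber_ext ?_
    simp only [fiber_comp_val, Category.assoc]
    rw [subLaw₂_fac, subZeroLift₂_fac, fiberL_fac, reassoc_of% P.fiberL_fac ((P.sub f).obj E)]
    have h := P.subLaw_fac f E
    rw [subZeroLift] at h
    rw [reassoc_of% h]
    congr 1
    exact (P.total.str.l.naturality (P.subLift f E)).symm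
  flip E := by
    change P.fiberC _ ≫ (P.fiberT A).map (P.subLawIso f E).hom ≫ (P.subLawIso f _).hom =
      ((P.fiberT A).map (P.subLawIso f E).hom ≫ (P.subLawIso f _).hom) ≫
        (P.sub f).map (P.fiberC E)
    refine (P.isCart_subZeroLift₂ f E).fiber_ext ?_
    simp only [fiber_comp_val, Category.assoc]
    rw [subLaw₂_fac, subZeroLift₂_fac, fiberC_fac, reassoc_of% P.fiberC_fac ((P.sub f).obj E)]
    have h := P.subLaw₂_fac f E
    rw [subZeroLift₂] at h
    rw [reassoc_of% h]
    congr 1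
    exact (P.total.str.c.naturality (P.subLift f E)).symm

theorem subLaw_isStrong (f : A ⟶ A') : (P.subLaw f).IsStrong := by
  refine ⟨?_, P.preservesTangentLimits_sub f⟩
  have : ∀ E, IsIso ((P.subLaw f).β.app E) := fun E =>
    inferInstanceAs (IsIso (P.subLawIso f E).hom)
  exact NatIso.isIso_of_isIso_app _

theorem isCartesian_id (E : P.proj.Fiber A) : P.proj.IsStronglyCartesian (𝟙 A) (𝟙 E.1) :=
  isCartesian_fiber_iso (Iso.refl E)

/-- The comparison for identities. -/
noncomputable def subUnitIso (E : P.proj.Fiber A) : E ≅ (P.sub (𝟙 A)).obj E :=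
  fiberIso _ (P.isCartesian_id E) _ (P.isCartesian_subLift (𝟙 A) E)

theorem subUnit_fac (E : P.proj.Fiber A) :
    (P.subUnitIso E).hom.1 ≫ P.subLift (𝟙 A) E = 𝟙 E.1 :=
  fiberIso_hom_fac _ _ _ _

/-- The comparison for composition. -/
noncomputable def subCompIso (f : A ⟶ A') (g : A' ⟶ A'') (E : P.proj.Fiber A'') :
    (P.sub f).obj ((P.sub g).obj E) ≅ (P.sub (f ≫ g)).obj E :=
  fiberIso _ (isCartesian_comp (P.isCartesian_subLift f _) (P.isCartesian_subLift g E)) _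
    (P.isCartesian_subLift (f ≫ g) E)

theorem subComp_fac (f : A ⟶ A') (g : A' ⟶ A'') (E : P.proj.Fiber A'') :
    (P.subCompIso f g E).hom.1 ≫ P.subLift (f ≫ g) E =
      P.subLift f ((P.sub g).obj E) ≫ P.subLift g E :=
  fiberIso_hom_fac _ _ _ _

/-- The natural comparison for identities. -/
noncomputable def subUnit (A : P.base) : 𝟭 (P.proj.Fiber A) ≅ P.sub (𝟙 A) :=
  NatIso.ofComponents P.subUnitIso (fun {E E'} φ => by
    change φ ≫ (P.subUnitIso E').hom = (P.subUnitIso E).hom ≫ (P.sub (𝟙 A)).map φ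
    refine (P.isCart_subLift (𝟙 A) E').fiber_ext ?_
    rw [fiber_comp_val, fiber_comp_val, Category.assoc, Category.assoc, subUnit_fac,
      subLift_naturality, reassoc_of% P.subUnit_fac E, Category.comp_id])

/-- The natural comparison for composition. -/
noncomputable def subComp (f : A ⟶ A') (g : A' ⟶ A'') : P.sub g ⋙ P.sub f ≅ P.sub (f ≫ g) :=
  NatIso.ofComponents (P.subCompIso f g) (fun {E E'} φ => by
    change (P.sub f).map ((P.sub g).map φ) ≫ (P.subCompIso f g E').hom =
      (P.subCompIso f g E).hom ≫ (P.sub (f ≫ g)).map φ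
    refine (P.isCart_subLift (f ≫ g) E').fiber_ext ?_
    rw [fiber_comp_val, fiber_comp_val, Category.assoc, Category.assoc, subComp_fac,
      subLift_naturality, reassoc_of% P.subComp_fac f g E,
      reassoc_of% P.subLift_naturality f ((P.sub g).map φ), subLift_naturality])

/-- The pseudofunctor of fibres. -/
noncomputable def fiberIdx : PseudoStr P.base P.fiberCat P.sub where
  law f := P.subLaw f
  law_strong f := P.subLaw_isStrong f
  unit := P.subUnit
  comp f g := P.subComp f g
  unit_law A E := by
    change (P.fiberT A).map (P.subUnitIso E).hom ≫ (P.subLawIso (𝟙 A) E).hom =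
      (P.subUnitIso ((P.fiberT A).obj E)).hom
    -- As in the other coherence equations, both sides are vertical morphisms into the domain of a
    -- cartesian morphism, and both composites with it reduce to the same chosen lifts.
    refine (P.isCart_subZeroLift (𝟙 A) E).fiber_ext ?_
    rw [fiber_comp_val, Category.assoc, subLaw_fac,
      reassoc_of% P.zeroLift_naturality (P.subUnitIso E).hom, ← Functor.map_comp, subUnit_fac,
      CategoryTheory.Functor.map_id, Category.comp_id, subZeroLift,
      reassoc_of% P.subUnit_fac ((P.fiberT A).obj E)]
  comp_law {A A' A''} f g E := by
    change (P.fiberT A).map (P.subCompIso f g E).hom ≫ (P.subLawIso (f ≫ g) E).hom =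
      ((P.subLawIso f ((P.sub g).obj E)).hom ≫ (P.sub f).map (P.subLawIso g E).hom) ≫
        (P.subCompIso f g ((P.fiberT A'').obj E)).hom
    refine (P.isCart_subZeroLift (f ≫ g) E).fiber_ext ?_
    have h := P.subLaw_fac f ((P.sub g).obj E)
    have h' := P.subLaw_fac g E
    rw [subZeroLift] at h h'
    simp only [fiber_comp_val, Category.assoc]
    rw [subLaw_fac, reassoc_of% P.zeroLift_naturality (P.subCompIso f g E).hom,
      ← Functor.map_comp, subComp_fac, subZeroLift,
      reassoc_of% P.subComp_fac f g ((P.fiberT A'').obj E),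
      reassoc_of% P.subLift_naturality f (P.subLawIso g E).hom, h', reassoc_of% h,
      Functor.map_comp]
  unit_comp {A A'} f E := by
    change (P.subUnitIso ((P.sub f).obj E)).hom ≫ (P.subCompIso (𝟙 A) f E).hom = _
    refine (P.isCart_subLift (𝟙 A ≫ f) E).fiber_ext ?_
    rw [fiber_comp_val, Category.assoc, subComp_fac,
      reassoc_of% P.subUnit_fac ((P.sub f).obj E)]
    exact (P.eqToHom_subLift (Category.id_comp f).symm E _).symm
  comp_unit {A A'} f E := by
    change (P.sub f).map (P.subUnitIso E).hom ≫ (P.subCompIso f (𝟙 A') E).hom = _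
    refine (P.isCart_subLift (f ≫ 𝟙 A') E).fiber_ext ?_
    rw [fiber_comp_val, Category.assoc, subComp_fac,
      reassoc_of% P.subLift_naturality f (P.subUnitIso E).hom, subUnit_fac, Category.comp_id]
    exact (P.eqToHom_subLift (Category.comp_id f).symm E _).symm
  assoc {A A' A'' B} f g h E := by
    change (P.sub f).map (P.subCompIso g h E).hom ≫ (P.subCompIso f (g ≫ h) E).hom =
      (P.subCompIso f g ((P.sub h).obj E)).hom ≫ (P.subCompIso (f ≫ g) h E).hom ≫ _
    refine (P.isCart_subLift (f ≫ g ≫ h) E).fiber_ext ?_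
    simp only [fiber_comp_val, Category.assoc]
    have e := P.eqToHom_subLift (Category.assoc f g h) E (by rw [Category.assoc])
    rw [subComp_fac, reassoc_of% P.subLift_naturality f (P.subCompIso g h E).hom, subComp_fac]
    refine Eq.symm ((congrArg (fun t => (P.subCompIso f g ((P.sub h).obj E)).hom.1 ≫
      (P.subCompIso (f ≫ g) h E).hom.1 ≫ t) e).trans ?_)
    rw [subComp_fac, reassoc_of% P.subComp_fac f g ((P.sub h).obj E)]

/-- The indexed tangent structure on the fibres. -/
noncomputable def fibreStr : FibreStr P where
  str := P.fiberStr
  idx := P.fiberIdx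
  p_eq _ := rfl
  z_eq := P.fiberZ_fac
  s_eq E w h₁ h₂ := by
    -- The two conditions fix the components of w in the total fibre product, and `diagLift` has the
    -- same components.
    obtain rfl : w = P.diagLift E := (P.total_isPullback E.1).hom_ext
      (h₁.trans (P.fiberFst_fac E)) (h₂.trans (P.fiberSnd_fac E))
    exact P.fiberSum_fac E
  l_eq := P.fiberL_fac
  c_eq := P.fiberC_fac
  law_eq := P.subLaw_fac
  unit_eq _ E := P.subUnit_fac E
  comp_eq := P.subComp_fac

end TangentFibration

/-! ## Morphisms of fibrations -/

namespace FibrationMap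

variable {P Q : TangentFibration.{v₁, u₁, v₂, u₂}} (m : FibrationMap P Q) {A A' A'' : P.base}

theorem isCart_total {a b : P.total} {φ : a ⟶ b} (h : IsCart P.proj φ) :
    IsCart Q.proj (m.total.map φ) :=
  .of (m.cartesian _ _ h)

/-- The image in the total category of a morphism out of an object of a fibre. -/
def ofFiber {X : P.proj.Fiber A} {Y : P.total} (x : X.1 ⟶ Y) :
    ((m.fiber A).obj X).1 ⟶ m.total.obj Y :=
  m.total.map x

theorem fiber_map_ofFiber {X Y : P.proj.Fiber A} {Z : P.total} (φ : X ⟶ Y) (y : Y.1 ⟶ Z) :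
    ((m.fiber A).map φ).1 ≫ m.ofFiber y = m.ofFiber (φ.1 ≫ y) :=
  (m.total.map_comp _ _).symm

theorem ofFiber_map {X : P.proj.Fiber A} {Y Z : P.total} (x : X.1 ⟶ Y) (y : Y ⟶ Z) :
    m.ofFiber x ≫ m.total.map y = m.ofFiber (x ≫ y) :=
  (m.total.map_comp _ _).symm

theorem isCartesian_ofFiber {X : P.proj.Fiber A} {Y : P.total} {f : A ⟶ A'} {x : X.1 ⟶ Y}
    (h : P.proj.IsStronglyCartesian f x) :
    Q.proj.IsStronglyCartesian (m.base.map f) (m.ofFiber x) :=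
  m.cartesian f x h

theorem isCart_ofFiber {X : P.proj.Fiber A} {Y : P.total} {x : X.1 ⟶ Y} (h : IsCart P.proj x) :
    IsCart Q.proj (m.ofFiber x) :=
  m.isCart_total h

/-- The comparison of the restriction to the fibres with the functor of total categories. -/
def fiberComparison (A : P.base) : FiberComparison (m.fiber A) m.total where
  app X := m.ofFiber (𝟙 X.1)
  isCart X := m.isCart_ofFiber (.id X.1)
  naturality φ := by
    rw [fiber_map_ofFiber, ofFiber_map, Category.comp_id, Category.id_comp]
  map_isCart := m.isCart_total

theorem fiberComparison_map {X : P.proj.Fiber A} {Y : P.total} (x : X.1 ⟶ Y) :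
    (m.fiberComparison A).map x = m.ofFiber x := by
  change m.ofFiber (𝟙 X.1) ≫ m.total.map x = _
  rw [ofFiber_map, Category.id_comp]

/-- The image in the total category of a morphism between objects of fibres. -/
def between {X : P.proj.Fiber A} {Y : P.proj.Fiber A'} (x : X.1 ⟶ Y.1) :
    ((m.fiber A).obj X).1 ⟶ ((m.fiber A').obj Y).1 :=
  m.total.map x

theorem isCartesian_between {X : P.proj.Fiber A} {Y : P.proj.Fiber A'} {f : A ⟶ A'}
    {x : X.1 ⟶ Y.1} (h : P.proj.IsStronglyCartesian f x) :
    Q.proj.IsStronglyCartesian (m.base.map f) (m.between x) :=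
  m.cartesian f x h

theorem between_id (X : P.proj.Fiber A) : m.between (𝟙 X.1) = 𝟙 ((m.fiber A).obj X).1 :=
  m.total.map_id _

theorem between_between {X : P.proj.Fiber A} {Y : P.proj.Fiber A'} {Z : P.proj.Fiber A''}
    (x : X.1 ⟶ Y.1) (y : Y.1 ⟶ Z.1) : m.between x ≫ m.between y = m.between (x ≫ y) :=
  (m.total.map_comp _ _).symm

theorem between_ofFiber {X : P.proj.Fiber A} {Y : P.proj.Fiber A'} {Z : P.total} (x : X.1 ⟶ Y.1)
    (y : Y.1 ⟶ Z) : m.between x ≫ m.ofFiber y = m.ofFiber (x ≫ y) :=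
  (m.total.map_comp _ _).symm

theorem fiber_map_val {X Y : P.proj.Fiber A} (φ : X ⟶ Y) :
    ((m.fiber A).map φ).1 = m.between φ.1 :=
  rfl

/-! ### Distributors -/

/-- The components of the distributors. -/
noncomputable def distIso (f : A ⟶ A') (E : P.proj.Fiber A') :
    (m.fiber A).obj ((P.sub f).obj E) ≅ (Q.sub (m.base.map f)).obj ((m.fiber A').obj E) :=
  fiberIso _ (m.isCartesian_between (P.isCartesian_subLift f E)) _
    (Q.isCartesian_subLift (m.base.map f) ((m.fiber A').obj E))

theorem dist_fac (f : A ⟶ A') (E : P.proj.Fiber A') :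
    (m.distIso f E).hom.1 ≫ Q.subLift (m.base.map f) ((m.fiber A').obj E) =
      m.between (P.subLift f E) :=
  fiberIso_hom_fac _ _ _ _

theorem dist_naturality (f : A ⟶ A') {E E' : P.proj.Fiber A'} (φ : E ⟶ E') :
    (m.fiber A).map ((P.sub f).map φ) ≫ (m.distIso f E').hom =
      (m.distIso f E).hom ≫ (Q.sub (m.base.map f)).map ((m.fiber A').map φ) := by
  refine (Q.isCart_subLift (m.base.map f) ((m.fiber A').obj E')).fiber_ext ?_
  rw [fiber_comp_val, fiber_comp_val, Category.assoc, Category.assoc, Q.subLift_naturality,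
    dist_fac, reassoc_of% m.dist_fac f E, fiber_map_val, fiber_map_val, between_between,
    between_between, P.subLift_naturality]

theorem dist_unit (A : P.base) (E : P.proj.Fiber A)
    (h : (Q.sub (𝟙 (m.base.obj A))).obj ((m.fiber A).obj E) =
      (Q.sub (m.base.map (𝟙 A))).obj ((m.fiber A).obj E)) :
    (m.fiber A).map (P.subUnitIso E).hom ≫ (m.distIso (𝟙 A) E).hom =
      (Q.subUnitIso ((m.fiber A).obj E)).hom ≫ eqToHom h := by
  refine (Q.isCart_subLift (m.base.map (𝟙 A)) ((m.fiber A).obj E)).fiber_ext ?_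
  rw [fiber_comp_val, fiber_comp_val, Category.assoc, Category.assoc, dist_fac,
    Q.eqToHom_subLift (m.base.map_id A).symm, Q.subUnit_fac, fiber_map_val, between_between,
    P.subUnit_fac, between_id]

theorem dist_comp (f : A ⟶ A') (g : A' ⟶ A'') (E : P.proj.Fiber A'')
    (h : (Q.sub (m.base.map f ≫ m.base.map g)).obj ((m.fiber A'').obj E) =
      (Q.sub (m.base.map (f ≫ g))).obj ((m.fiber A'').obj E)) :
    (m.fiber A).map (P.subCompIso f g E).hom ≫ (m.distIso (f ≫ g) E).hom =
      (m.distIso f ((P.sub g).obj E)).hom ≫ (Q.sub (m.base.map f)).map (m.distIso g E).hom ≫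
        (Q.subCompIso (m.base.map f) (m.base.map g) ((m.fiber A'').obj E)).hom ≫ eqToHom h := by
  refine (Q.isCart_subLift (m.base.map (f ≫ g)) ((m.fiber A'').obj E)).fiber_ext ?_
  simp only [fiber_comp_val, Category.assoc]
  rw [dist_fac, Q.eqToHom_subLift (m.base.map_comp f g).symm, Q.subComp_fac,
    reassoc_of% Q.subLift_naturality (m.base.map f) (m.distIso g E).hom, dist_fac,
    reassoc_of% m.dist_fac f ((P.sub g).obj E), fiber_map_val, between_between, between_between,
    P.subComp_fac]

/-- The distributors of a morphism of fibrations. -/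
noncomputable def dist :
    Distributors P.fibreStr.indexed Q.fibreStr.indexed m.base m.fiber where
  κ f := NatIso.ofComponents (m.distIso f) (fun φ => m.dist_naturality f φ)
  κ_id A E := m.dist_unit A E _
  κ_comp f g E := m.dist_comp f g E _

theorem isDistributors_dist : m.IsDistributors P.fibreStr Q.fibreStr m.dist :=
  fun f E => m.dist_fac f E

/-! ### Preservation of tangent limits -/

/-- The composite equals Π followed by F. Both preserve tangent limits, and Π carries an invertible
lax law, the inverse of its colax one, so the limits of the total category are sent to tangent
limits of the base before F is applied. -/
theorem preservesTangentLimits_comp_proj (hF : PreservesTangentLimits m.base) :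
    PreservesTangentLimits (m.total ⋙ Q.proj) := by
  obtain ⟨L, ⟨e, he⟩, hP⟩ := P.proj_strict
  have : IsIso L.β := by rw [he]; infer_instance
  rw [m.comm]
  exact hP.comp hF (L.invLax (inv L.β) (IsIso.inv_hom_id _) (IsIso.hom_inv_id _) hP)
    (IsIso.inv_isIso)

/-- Only the functors matter here, not the distributive laws: F' preserves the limits of the total
category, and F' followed by the projection preserves them because F does. The fibres inherit the
preservation along cartesian morphisms. -/
theorem preservesTangentLimits_fiber (hF : PreservesTangentLimits m.base)
    (hF' : PreservesTangentLimits m.total) (A : P.base) :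
    PreservesTangentLimits (X := P.fiberCat A) (Y := Q.fiberCat (m.base.obj A)) (m.fiber A) where
  nfold n E _ _ _ h := P.isNFoldPullback_fiberMap (m.fiberComparison A)
    (fun S b π h => hF'.nfold n E.1 S b π h)
    (fun S b π h => (m.preservesTangentLimits_comp_proj hF).nfold n E.1 S b π h) h
  vlift E _ h := P.isPullback_fiber_verticalLift (m.fiberComparison A) E
    (fun w' hw' => hF'.vlift E.1 w' hw')
    (fun w' hw' => (m.preservesTangentLimits_comp_proj hF).vlift E.1 w' hw') h

/-! ### The lifts of the zero morphisms in the codomain -/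

/-- The chosen lift of the zero morphism at an object in the image. -/
def zero (E : P.proj.Fiber A) :
    ((Q.fiberT (m.base.obj A)).obj ((m.fiber A).obj E)).1 ⟶ Q.total.T.obj (m.total.obj E.1) :=
  Q.zeroLift ((m.fiber A).obj E)

theorem isCartesian_zero (E : P.proj.Fiber A) :
    Q.proj.IsStronglyCartesian
      (Q.base.str.z.app (m.base.obj A) : m.base.obj A ⟶ Q.base.T.obj (m.base.obj A))
      (m.zero E) :=
  Q.isCartesian_zeroLift _

theorem isCart_zero (E : P.proj.Fiber A) : IsCart Q.proj (m.zero E) :=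
  .of (m.isCartesian_zero E)

/-- `ofFiber` and `zero` only change how endpoints are presented, either as objects of the total
category or as underlying objects of a fibre. The equation lets rewriting pass between the two
presentations. -/
theorem zeroLift_ofFiber (E : P.proj.Fiber A) {X : P.total} (x : E.1 ⟶ X) :
    Q.zeroLift ((m.fiber A).obj E) ≫ Q.total.T.map (m.ofFiber x) =
      m.zero E ≫ Q.total.T.map (m.total.map x) :=
  rfl

/-- The chosen lift of the iterated zero morphism at an object in the image. -/
noncomputable def zero₂ (E : P.proj.Fiber A) :
    ((Q.fiberT _).obj ((Q.fiberT _).obj ((m.fiber A).obj E))).1 ⟶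
      Q.total.T.obj (Q.total.T.obj (m.total.obj E.1)) :=
  Q.zeroLift₂ ((m.fiber A).obj E)

theorem isCart_zero₂ (E : P.proj.Fiber A) : IsCart Q.proj (m.zero₂ E) :=
  Q.isCart_zeroLift₂ _

theorem zero₂_eq (E : P.proj.Fiber A) : m.zero₂ E =
    Q.zeroLift ((Q.fiberT _).obj ((m.fiber A).obj E)) ≫ Q.total.T.map (m.zero E) :=
  rfl

theorem fiberL_zero₂ (E : P.proj.Fiber A) : (Q.fiberL ((m.fiber A).obj E)).1 ≫ m.zero₂ E =
    m.zero E ≫ Q.total.str.l.app (m.total.obj E.1) :=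
  Q.fiberL_fac _

theorem fiberC_zero₂ (E : P.proj.Fiber A) : (Q.fiberC ((m.fiber A).obj E)).1 ≫ m.zero₂ E =
    m.zero₂ E ≫ Q.total.str.c.app (m.total.obj E.1) :=
  Q.fiberC_fac _

/-- The chosen lift `f^* T F E ⟶ T' F E`. -/
noncomputable def subZero (f : A ⟶ A') (E : P.proj.Fiber A') :
    ((Q.sub (m.base.map f)).obj ((Q.fiberT _).obj ((m.fiber A').obj E))).1 ⟶
      Q.total.T.obj (m.total.obj E.1) :=
  Q.subLift (m.base.map f) _ ≫ m.zero E

theorem isCart_subZero (f : A ⟶ A') (E : P.proj.Fiber A') : IsCart Q.proj (m.subZero f E) :=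
  (Q.isCart_subLift _ _).comp (m.isCart_zero E)

/-- Evaluates T(κ) followed by α^{Ff} against the cartesian morphism into T'F'E: only the chosen
lift of zero and T'F' of the chosen lift of f survive. Both the lax and the colax coherence rest on
this. -/
theorem dist_subLaw_fac (f : A ⟶ A') (E : P.proj.Fiber A') :
    ((Q.fiberT (m.base.obj A)).map (m.distIso f E).hom).1 ≫
        (Q.subLawIso (m.base.map f) ((m.fiber A').obj E)).hom.1 ≫ m.subZero f E =
      m.zero ((P.sub f).obj E) ≫ Q.total.T.map (m.total.map (P.subLift f E)) := by
  have h := congrArg (((Q.fiberT (m.base.obj A)).map (m.distIso f E).hom).1 ≫ ·)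
    (Q.subLaw_fac (m.base.map f) ((m.fiber A').obj E))
  refine h.trans ?_
  rw [reassoc_of% Q.zeroLift_naturality (m.distIso f E).hom, ← Functor.map_comp, dist_fac]
  rfl

end FibrationMap

/-! ## Lax morphisms -/

namespace LaxHom

variable {P Q : TangentFibration.{v₁, u₁, v₂, u₂}} (φ : LaxHom P Q) {A A' : P.base}

theorem isHomLift_law (E : P.proj.Fiber A) :
    Q.proj.IsHomLift (φ.baseLaw.α.app A) (φ.totalLaw.α.app E.1) := by
  obtain ⟨E, rfl⟩ := E
  exact φ.law_lift E

/-- Compatibility of β with zeros is what makes F'ζ followed by β' lie over the zero at F A, so that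
it can be lifted. -/
theorem base_zero (A : P.base) :
    φ.map.base.map (P.base.str.z.app A : A ⟶ P.base.T.obj A) ≫ φ.baseLaw.α.app A =
      (Q.base.str.z.app (φ.map.base.obj A) : φ.map.base.obj A ⟶ Q.base.T.obj _) :=
  (φ.baseLaw.additive A).zero.trans (Category.id_comp _)

theorem isHomLift_zeroLift_law (E : P.proj.Fiber A) :
    Q.proj.IsHomLift
      (Q.base.str.z.app (φ.map.base.obj A) : φ.map.base.obj A ⟶ Q.base.T.obj (φ.map.base.obj A))
      (φ.map.ofFiber (P.zeroLift E) ≫ φ.totalLaw.α.app E.1) :=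
  isHomLift_congr (isHomLift_comp
    (φ.map.isCartesian_ofFiber (P.isCartesian_zeroLift E)).toIsHomLift (φ.isHomLift_law E))
    (φ.base_zero A) rfl

/-- The components of the distributive laws on the fibres. -/
noncomputable def fiberLawApp (E : P.proj.Fiber A) :
    (φ.map.fiber A).obj ((P.fiberT A).obj E) ⟶ (Q.fiberT _).obj ((φ.map.fiber A).obj E) :=
  fiberLift (φ.map.zero E) (φ.map.isCartesian_zero E) _ (φ.isHomLift_zeroLift_law E)

theorem fiberLaw_fac (E : P.proj.Fiber A) : (φ.fiberLawApp E).1 ≫ φ.map.zero E =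
    φ.map.ofFiber (P.zeroLift E) ≫ φ.totalLaw.α.app E.1 :=
  fiberLift_fac _ _ _ _

theorem law_naturality {X Y : P.total} (f : X ⟶ Y) :
    φ.map.total.map (P.total.T.map f) ≫ φ.totalLaw.α.app Y =
      φ.totalLaw.α.app X ≫ Q.total.T.map (φ.map.total.map f) :=
  φ.totalLaw.α.naturality f

theorem fiberLaw_naturality {E E' : P.proj.Fiber A} (f : E ⟶ E') :
    (φ.map.fiber A).map ((P.fiberT A).map f) ≫ φ.fiberLawApp E' =
      φ.fiberLawApp E ≫ (Q.fiberT _).map ((φ.map.fiber A).map f) := by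
  refine (φ.map.isCart_zero E').fiber_ext ?_
  have h : ((Q.fiberT _).map ((φ.map.fiber A).map f)).1 ≫ φ.map.zero E' =
      φ.map.zero E ≫ Q.total.T.map (φ.map.total.map f.1) :=
    Q.zeroLift_naturality ((φ.map.fiber A).map f)
  rw [fiber_comp_val, fiber_comp_val, Category.assoc, Category.assoc, fiberLaw_fac, h,
    reassoc_of% φ.fiberLaw_fac E, ← law_naturality,
    reassoc_of% φ.map.fiber_map_ofFiber ((P.fiberT A).map f) (P.zeroLift E'),
    reassoc_of% φ.map.ofFiber_map (P.zeroLift E) (P.total.T.map f.1), P.zeroLift_naturality]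

theorem fiberLaw₂_fac (E : P.proj.Fiber A) :
    (φ.fiberLawApp ((P.fiberT A).obj E)).1 ≫ ((Q.fiberT _).map (φ.fiberLawApp E)).1 ≫
        φ.map.zero₂ E =
      φ.map.ofFiber (P.zeroLift₂ E) ≫ φ.totalLaw.α.app (P.total.T.obj E.1) ≫
        Q.total.T.map (φ.totalLaw.α.app E.1) := by
  rw [φ.map.zero₂_eq, reassoc_of% Q.zeroLift_naturality (φ.fiberLawApp E),
    ← Functor.map_comp, fiberLaw_fac, Functor.map_comp,
    reassoc_of% φ.map.zeroLift_ofFiber ((P.fiberT A).obj E) (P.zeroLift E),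
    reassoc_of% φ.fiberLaw_fac ((P.fiberT A).obj E), ← reassoc_of% φ.law_naturality (P.zeroLift E),
    reassoc_of% φ.map.ofFiber_map (P.zeroLift ((P.fiberT A).obj E))
      (P.total.T.map (P.zeroLift E))]
  rfl

/-- The distributive laws on the fibres. -/
noncomputable def fiberLaw (A : P.base) : LaxLaw (X := P.fiberCat A)
    (Y := Q.fiberCat (φ.map.base.obj A)) (φ.map.fiber A) where
  α := { app := φ.fiberLawApp, naturality := fun _ _ f => φ.fiberLaw_naturality f }
  additive E := by
    -- The codomain is a bundle of a fibre of the target fibration, whose fibre product is a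
    -- pullback there and above, so no preservation of limits by F or F' is used.
    refine ((P.bundleComparison E (𝟙 E.1) (.id _)).map
      (φ.map.fiberComparison A)).isAdditiveMorphism_of_isPullback
      (Q.bundleComparison ((φ.map.fiber A).obj E) (φ.map.ofFiber (𝟙 E.1))
        (φ.map.isCart_ofFiber (.id _)))
      (φ.totalLaw.additive E.1) ?_ ?_ ?_ (Q.fiber_isPullback ((φ.map.fiber A).obj E))
      (Q.total_isPullback (φ.map.total.obj E.1))
    · change 𝟙 _ ≫ φ.map.ofFiber (𝟙 E.1) = (φ.map.fiberComparison A).map (𝟙 E.1) ≫ 𝟙 _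
      rw [φ.map.fiberComparison_map, Category.id_comp, Category.comp_id]
    · change (φ.fiberLawApp E).1 ≫ Q.zeroLift _ ≫ Q.total.T.map (φ.map.ofFiber (𝟙 E.1)) =
        (φ.map.fiberComparison A).map (P.zeroLift E ≫ P.total.T.map (𝟙 E.1)) ≫
          φ.totalLaw.α.app E.1
      rw [φ.map.fiberComparison_map, φ.map.zeroLift_ofFiber, CategoryTheory.Functor.map_id,
        CategoryTheory.Functor.map_id, CategoryTheory.Functor.map_id, Category.comp_id,
        Category.comp_id, fiberLaw_fac]
    · change (φ.map.fiber A).map (P.fiberFst E) ≫ (φ.map.fiber A).map (P.fiberP E) =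
        (φ.map.fiber A).map (P.fiberSnd E) ≫ (φ.map.fiber A).map (P.fiberP E)
      rw [← Functor.map_comp, (P.fiber_isPullback E).w, Functor.map_comp]
  lift E := by
    change (φ.map.fiber A).map (P.fiberL E) ≫ φ.fiberLawApp ((P.fiberT A).obj E) ≫
      (Q.fiberT _).map (φ.fiberLawApp E) = φ.fiberLawApp E ≫ Q.fiberL ((φ.map.fiber A).obj E)
    refine (φ.map.isCart_zero₂ E).fiber_ext ?_
    have h : φ.map.total.map (P.total.str.l.app E.1) ≫ φ.totalLaw.α.app (P.total.T.obj E.1) ≫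
      Q.total.T.map (φ.totalLaw.α.app E.1) = _ := φ.totalLaw.lift E.1
    simp only [fiber_comp_val, Category.assoc]
    rw [fiberLaw₂_fac, φ.map.fiberL_zero₂, reassoc_of% φ.fiberLaw_fac E, ← h,
      reassoc_of% φ.map.fiber_map_ofFiber (P.fiberL E) (P.zeroLift₂ E), P.fiberL_fac,
      ← φ.map.ofFiber_map, Category.assoc]
  flip E := by
    change (φ.map.fiber A).map (P.fiberC E) ≫ φ.fiberLawApp ((P.fiberT A).obj E) ≫
      (Q.fiberT _).map (φ.fiberLawApp E) = (φ.fiberLawApp ((P.fiberT A).obj E) ≫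
        (Q.fiberT _).map (φ.fiberLawApp E)) ≫ Q.fiberC ((φ.map.fiber A).obj E)
    refine (φ.map.isCart_zero₂ E).fiber_ext ?_
    have h : φ.map.total.map (P.total.str.c.app E.1) ≫ φ.totalLaw.α.app (P.total.T.obj E.1) ≫
      Q.total.T.map (φ.totalLaw.α.app E.1) = _ := φ.totalLaw.flip E.1
    simp only [fiber_comp_val, Category.assoc] at h ⊢
    rw [fiberLaw₂_fac, φ.map.fiberC_zero₂, reassoc_of% φ.fiberLaw₂_fac E, ← h,
      reassoc_of% φ.map.fiber_map_ofFiber (P.fiberC E) (P.zeroLift₂ E), P.fiberC_fac,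
      ← φ.map.ofFiber_map, Category.assoc]

/-- Against the cartesian morphism into T'F'E both sides become F' of the composite of ζ and
T'(φ^f), followed by β'. The two sides are matched by naturality of β' and the equation defining
α^f. -/
theorem fiberLaw_coherence (f : A ⟶ A') (E : P.proj.Fiber A') :
    (φ.map.fiber A).map (P.subLawIso f E).hom ≫ (φ.map.distIso f ((P.fiberT A').obj E)).hom ≫
        (Q.sub (φ.map.base.map f)).map (φ.fiberLawApp E) =
      φ.fiberLawApp ((P.sub f).obj E) ≫ (Q.fiberT _).map (φ.map.distIso f E).hom ≫
        (Q.subLawIso (φ.map.base.map f) ((φ.map.fiber A').obj E)).hom := by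
  refine (φ.map.isCart_subZero f E).fiber_ext ?_
  simp only [fiber_comp_val, Category.assoc]
  rw [φ.map.dist_subLaw_fac, reassoc_of% φ.fiberLaw_fac ((P.sub f).obj E), ← law_naturality,
    reassoc_of% φ.map.ofFiber_map (P.zeroLift ((P.sub f).obj E))
      (P.total.T.map (P.subLift f E)), ← P.subLaw_fac, FibrationMap.subZero,
    reassoc_of% Q.subLift_naturality (φ.map.base.map f) (φ.fiberLawApp E), fiberLaw_fac,
    reassoc_of% φ.map.dist_fac f ((P.fiberT A').obj E),
    reassoc_of% φ.map.between_ofFiber (P.subLift f ((P.fiberT A').obj E)) (P.zeroLift E)]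
  change _ ≫ φ.map.ofFiber (P.subZeroLift f E) ≫ _ = _
  rw [reassoc_of% φ.map.fiber_map_ofFiber (P.subLawIso f E).hom (P.subZeroLift f E)]

/-- The induced lax morphism of indexed tangent categories. -/
noncomputable def indexed : LaxIndexedHom P.fibreStr.indexed Q.fibreStr.indexed where
  base := φ.map.base
  fib := φ.map.fiber
  dist := φ.map.dist
  baseLaw := φ.baseLaw
  fibLaw := φ.fiberLaw
  coherence f E := φ.fiberLaw_coherence f E

theorem induces_indexed : φ.Induces P.fibreStr Q.fibreStr φ.indexed :=
  ⟨φ.map.dist, φ.fiberLaw, _, rfl, φ.map.isDistributors_dist, fun _ E => φ.fiberLaw_fac E⟩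

/-- An invertible β' is cartesian over its projection, so F'ζ followed by β' is cartesian over the
zero at F A, as is ζ at F'E. The vertical comparison of the two is invertible. -/
theorem isIso_fiberLawApp (h : IsIso φ.totalLaw.α) (E : P.proj.Fiber A) :
    IsIso (φ.fiberLawApp E) := by
  refine isIso_fiber (φ.map.isCartesian_zero E) _ ?_
  have h₁ := φ.isHomLift_law E
  have h₂ : Q.proj.IsStronglyCartesian (φ.baseLaw.α.app A) (φ.totalLaw.α.app E.1) := inferInstance
  exact isCartesian_congr (isCartesian_comp
    (φ.map.isCartesian_ofFiber (P.isCartesian_zeroLift E)) h₂) (φ.base_zero A)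
    (φ.fiberLaw_fac E).symm

theorem isIso_fiberLaw (h : IsIso φ.totalLaw.α) (A : P.base) : IsIso (φ.fiberLaw A).α := by
  have : ∀ E, IsIso ((φ.fiberLaw A).α.app E) := fun E => φ.isIso_fiberLawApp h E
  exact NatIso.isIso_of_isIso_app _

theorem fiberLaw_isStrong (h : φ.baseLaw.IsStrong) (h' : φ.totalLaw.IsStrong) (A : P.base) :
    (φ.fiberLaw A).IsStrong :=
  ⟨φ.isIso_fiberLaw h'.1 A, φ.map.preservesTangentLimits_fiber h.2 h'.2 A⟩

end LaxHom

/-- Strictness asks for an equality of functors, not only of objects. Naturality of an invertible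
transformation with transports as components forces the functors to agree on morphisms as well. -/
theorem exists_eq_eqToHom {C : Type u} [Category.{v} C] {D : Type u₁} [Category.{v₁} D]
    {F G : C ⥤ D} (α : F ⟶ G) (hα : IsIso α)
    (h : ∀ X, ∃ e : F.obj X = G.obj X, α.app X = eqToHom e) : ∃ e : F = G, α = eqToHom e := by
  have e : F = G := Functor.ext_of_iso (asIso α) (fun X => (h X).1) (fun X => (h X).2)
  refine ⟨e, ?_⟩
  ext X
  rw [eqToHom_app]
  exact (h X).2

theorem fiber_eqToHom_val {S : Type u₁} [Category.{v₁} S] {E : Type u₂} [Category.{v₂} E]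
    {p : E ⥤ S} {A : S} {X Y : p.Fiber A} (h : X = Y) (h' : X.1 = Y.1) :
    (eqToHom h : X ⟶ Y).1 = eqToHom h' := by
  subst h; rfl

/-- Since F' carries chosen lifts of zero to chosen lifts of zero, the law and a transport have the
same composite with the cartesian ζ at F'E, hence coincide. -/
theorem LaxHom.fiberLaw_isStrict {P Q : TangentFibration.{v₁, u₁, v₂, u₂}} (φ : LaxHom P Q)
    (h : φ.baseLaw.IsStrict) (h' : φ.totalLaw.IsStrict) (hz : TNGFIB.zeroCloven φ)
    (A : P.base) : (φ.fiberLaw A).IsStrict := by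
  have hs := φ.fiberLaw_isStrong h.isStrong h'.isStrong A
  refine ⟨exists_eq_eqToHom _ hs.1 fun E => ?_, hs.2⟩
  obtain ⟨e, he⟩ := hz A E
  have e' : (φ.map.fiber A).obj ((P.fiberT A).obj E) =
    (Q.fiberT _).obj ((φ.map.fiber A).obj E) := Subtype.ext e
  refine ⟨e', (φ.map.isCart_zero E).fiber_ext ?_⟩
  refine (φ.fiberLaw_fac E).trans (he.trans ?_)
  erw [fiber_eqToHom_val e' e]
  rfl

/-! ## Colax morphisms -/

namespace ColaxHom

variable {P Q : TangentFibration.{v₁, u₁, v₂, u₂}} (φ : ColaxHom P Q) {A A' : P.base}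

theorem isHomLift_law (E : P.proj.Fiber A) :
    Q.proj.IsHomLift (φ.baseLaw.β.app A) (φ.totalLaw.β.app E.1) := by
  obtain ⟨E, rfl⟩ := E
  exact φ.law_lift E

theorem base_zero (A : P.base) :
    (Q.base.str.z.app (φ.map.base.obj A) : φ.map.base.obj A ⟶ Q.base.T.obj _) ≫
      φ.baseLaw.β.app A = φ.map.base.map (P.base.str.z.app A : A ⟶ P.base.T.obj A) :=
  (φ.baseLaw.additive A).zero.trans (Category.id_comp _)

theorem isHomLift_zero_law (E : P.proj.Fiber A) :
    Q.proj.IsHomLift (φ.map.base.map (P.base.str.z.app A : A ⟶ P.base.T.obj A))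
      (φ.map.zero E ≫ φ.totalLaw.β.app E.1) :=
  isHomLift_congr (isHomLift_comp (φ.map.isCartesian_zero E).toIsHomLift (φ.isHomLift_law E))
    (φ.base_zero A) rfl

theorem isCart_ofFiber_zeroLift (E : P.proj.Fiber A) :
    IsCart Q.proj (φ.map.ofFiber (P.zeroLift E)) :=
  φ.map.isCart_ofFiber (P.isCart_zeroLift E)

/-- The components of the distributive laws on the fibres. -/
noncomputable def fiberLawApp (E : P.proj.Fiber A) :
    (Q.fiberT _).obj ((φ.map.fiber A).obj E) ⟶ (φ.map.fiber A).obj ((P.fiberT A).obj E) :=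
  fiberLift (φ.map.ofFiber (P.zeroLift E))
    (φ.map.isCartesian_ofFiber (P.isCartesian_zeroLift E)) _ (φ.isHomLift_zero_law E)

theorem fiberLaw_fac (E : P.proj.Fiber A) :
    (φ.fiberLawApp E).1 ≫ φ.map.ofFiber (P.zeroLift E) =
      φ.map.zero E ≫ φ.totalLaw.β.app E.1 :=
  fiberLift_fac _ _ _ _

theorem law_naturality {X Y : P.total} (f : X ⟶ Y) :
    Q.total.T.map (φ.map.total.map f) ≫ φ.totalLaw.β.app Y =
      φ.totalLaw.β.app X ≫ φ.map.total.map (P.total.T.map f) :=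
  φ.totalLaw.β.naturality f

theorem fiberLaw_naturality {E E' : P.proj.Fiber A} (f : E ⟶ E') :
    (Q.fiberT _).map ((φ.map.fiber A).map f) ≫ φ.fiberLawApp E' =
      φ.fiberLawApp E ≫ (φ.map.fiber A).map ((P.fiberT A).map f) := by
  refine (φ.isCart_ofFiber_zeroLift E').fiber_ext ?_
  have h : ((Q.fiberT _).map ((φ.map.fiber A).map f)).1 ≫ φ.map.zero E' =
      φ.map.zero E ≫ Q.total.T.map (φ.map.total.map f.1) :=
    Q.zeroLift_naturality ((φ.map.fiber A).map f)
  rw [fiber_comp_val, fiber_comp_val, Category.assoc, Category.assoc, fiberLaw_fac,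
    φ.map.fiber_map_ofFiber, P.zeroLift_naturality, ← φ.map.ofFiber_map,
    reassoc_of% φ.fiberLaw_fac E, reassoc_of% h, law_naturality]

/-- The law applied twice lies over β' applied twice; compatibility with the lift and the flip then
reduces to the axioms of β'. -/
theorem fiberLaw₂_fac (E : P.proj.Fiber A) :
    ((Q.fiberT _).map (φ.fiberLawApp E)).1 ≫ (φ.fiberLawApp ((P.fiberT A).obj E)).1 ≫
        φ.map.ofFiber (P.zeroLift₂ E) =
      φ.map.zero₂ E ≫ Q.total.T.map (φ.totalLaw.β.app E.1) ≫
        φ.totalLaw.β.app (P.total.T.obj E.1) := by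
  rw [TangentFibration.zeroLift₂, ← φ.map.ofFiber_map,
    reassoc_of% φ.fiberLaw_fac ((P.fiberT A).obj E), ← law_naturality,
    ← reassoc_of% φ.map.zeroLift_ofFiber ((P.fiberT A).obj E) (P.zeroLift E),
    reassoc_of% Q.zeroLift_naturality (φ.fiberLawApp E), ← Functor.map_comp_assoc, fiberLaw_fac,
    Functor.map_comp, φ.map.zero₂_eq]
  simp only [Category.assoc]

/-- F' need not preserve the fibre product T'_2 E, but its image becomes a pullback after projection
to the base, because F preserves tangent limits. -/
theorem isPullback_total_proj (hF : PreservesTangentLimits φ.map.base) (E : P.total) :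
    IsPullback (Q.proj.map (φ.map.total.map (P.total.str.π₁.app E)))
      (Q.proj.map (φ.map.total.map (P.total.str.π₂.app E)))
      (Q.proj.map (φ.map.total.map (P.total.str.p.app E)))
      (Q.proj.map (φ.map.total.map (P.total.str.p.app E))) :=
  (φ.map.preservesTangentLimits_comp_proj hF).isPullback E

/-- A morphism over the projections between double tangent bundles restricts to the fibres. -/
theorem exists_fiber_double (hF : PreservesTangentLimits φ.map.base) (E : P.proj.Fiber A)
    (g : Q.total.str.T₂.obj (φ.map.total.obj E.1) ⟶ φ.map.total.obj (P.total.str.T₂.obj E.1))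
    (h₁ : g ≫ φ.map.total.map (P.total.str.π₁.app E.1) =
      Q.total.str.π₁.app (φ.map.total.obj E.1) ≫ φ.totalLaw.β.app E.1)
    (h₂ : g ≫ φ.map.total.map (P.total.str.π₂.app E.1) =
      Q.total.str.π₂.app (φ.map.total.obj E.1) ≫ φ.totalLaw.β.app E.1)
    (d : (Q.fiberT₂ ((φ.map.fiber A).obj E)).1 ⟶ Q.total.str.T₂.obj (φ.map.total.obj E.1))
    (hd₁ : d ≫ Q.total.str.π₁.app (φ.map.total.obj E.1) =
      (Q.fiberFst ((φ.map.fiber A).obj E)).1 ≫ φ.map.zero E)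
    (hd₂ : d ≫ Q.total.str.π₂.app (φ.map.total.obj E.1) =
      (Q.fiberSnd ((φ.map.fiber A).obj E)).1 ≫ φ.map.zero E) :
    ∃ k : Q.fiberT₂ ((φ.map.fiber A).obj E) ⟶ (φ.map.fiber A).obj (P.fiberT₂ E),
      k.1 ≫ φ.map.ofFiber (P.diagLift E) = d ≫ g := by
  refine exists_fiberLift (φ.map.isCartesian_ofFiber (P.isCartesian_diagLift E)) _ ?_
  -- The projection of d ≫ g is identified by its two components in the base. Each component of d ≫
  -- g is a projection of the fibrewise double bundle, then the law on the fibre, then F'ζ; the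
  -- first two are vertical and project to transports.
  apply (φ.isPullback_total_proj hF E.1).hom_ext
  · rw [← Functor.map_comp, Category.assoc, h₁, reassoc_of% hd₁, ← fiberLaw_fac, Category.assoc,
      ← Functor.map_comp, φ.map.ofFiber_map, ← P.fiberFst_fac, ← φ.map.fiber_map_ofFiber,
      Functor.map_comp, Functor.map_comp, fiber_map_proj, fiber_map_proj, Functor.map_comp,
      fiber_map_proj, eqToHom_trans_assoc, eqToHom_trans_assoc]
  · rw [← Functor.map_comp, Category.assoc, h₂, reassoc_of% hd₂, ← fiberLaw_fac, Category.assoc,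
      ← Functor.map_comp, φ.map.ofFiber_map, ← P.fiberSnd_fac, ← φ.map.fiber_map_ofFiber,
      Functor.map_comp, Functor.map_comp, fiber_map_proj, fiber_map_proj, Functor.map_comp,
      fiber_map_proj, eqToHom_trans_assoc, eqToHom_trans_assoc]

/-- The distributive laws on the fibres. -/
noncomputable def fiberLaw (hF : PreservesTangentLimits φ.map.base) (A : P.base) :
    ColaxLaw (X := P.fiberCat A) (Y := Q.fiberCat (φ.map.base.obj A)) (φ.map.fiber A) where
  β := { app := φ.fiberLawApp, naturality := fun _ _ f => φ.fiberLaw_naturality f }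
  additive E := by
    let κ := Q.bundleComparison ((φ.map.fiber A).obj E) (φ.map.ofFiber (𝟙 E.1))
      (φ.map.isCart_ofFiber (.id _))
    let μ := (P.bundleComparison E (𝟙 E.1) (.id _)).map (φ.map.fiberComparison A)
    have hκ : κ.E = φ.map.zero E := by
      change Q.zeroLift _ ≫ Q.total.T.map (φ.map.ofFiber (𝟙 E.1)) = _
      rw [φ.map.zeroLift_ofFiber, CategoryTheory.Functor.map_id, CategoryTheory.Functor.map_id,
        Category.comp_id]
    -- F^A T_2 E need not be a pullback in the fibre, so the morphism of double bundles cannot be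
    -- induced there. It is lifted from the one that belongs to β'.
    refine κ.isAdditiveMorphism μ (φ.totalLaw.additive E.1) ?_ ?_ fun g h₁ h₂ => ?_
    · change 𝟙 _ ≫ (φ.map.fiberComparison A).map (𝟙 E.1) = φ.map.ofFiber (𝟙 E.1) ≫ 𝟙 _
      rw [φ.map.fiberComparison_map, Category.id_comp, Category.comp_id]
    · rw [hκ]
      change (φ.fiberLawApp E).1 ≫
        (φ.map.fiberComparison A).map (P.zeroLift E ≫ P.total.T.map (𝟙 E.1)) = _
      rw [φ.map.fiberComparison_map, CategoryTheory.Functor.map_id, Category.comp_id,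
        fiberLaw_fac]
      rfl
    · have hd₁ := κ.π₁.symm
      have hd₂ := κ.π₂.symm
      rw [hκ] at hd₁ hd₂
      obtain ⟨k, hk⟩ := φ.exists_fiber_double hF E g h₁ h₂ κ.E₂ hd₁ hd₂
      refine ⟨k, ?_⟩
      change k.1 ≫ (φ.map.fiberComparison A).map (P.diagLift E ≫ P.total.str.T₂.map (𝟙 E.1)) = _
      rw [φ.map.fiberComparison_map, CategoryTheory.Functor.map_id, Category.comp_id]
      exact hk
  lift E := by
    change Q.fiberL ((φ.map.fiber A).obj E) ≫ (Q.fiberT _).map (φ.fiberLawApp E) ≫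
      φ.fiberLawApp ((P.fiberT A).obj E) = φ.fiberLawApp E ≫ (φ.map.fiber A).map (P.fiberL E)
    refine (φ.map.isCart_ofFiber (P.isCart_zeroLift₂ E)).fiber_ext ?_
    have h : Q.total.str.l.app (φ.map.total.obj E.1) ≫ Q.total.T.map (φ.totalLaw.β.app E.1) ≫
      φ.totalLaw.β.app (P.total.T.obj E.1) = _ := φ.totalLaw.lift E.1
    simp only [fiber_comp_val, Category.assoc]
    rw [fiberLaw₂_fac, φ.map.fiber_map_ofFiber, P.fiberL_fac, ← φ.map.ofFiber_map,
      reassoc_of% φ.fiberLaw_fac E, reassoc_of% φ.map.fiberL_zero₂ E, h]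
  flip E := by
    change Q.fiberC ((φ.map.fiber A).obj E) ≫ (Q.fiberT _).map (φ.fiberLawApp E) ≫
      φ.fiberLawApp ((P.fiberT A).obj E) = ((Q.fiberT _).map (φ.fiberLawApp E) ≫
        φ.fiberLawApp ((P.fiberT A).obj E)) ≫ (φ.map.fiber A).map (P.fiberC E)
    refine (φ.map.isCart_ofFiber (P.isCart_zeroLift₂ E)).fiber_ext ?_
    have h : Q.total.str.c.app (φ.map.total.obj E.1) ≫ Q.total.T.map (φ.totalLaw.β.app E.1) ≫
      φ.totalLaw.β.app (P.total.T.obj E.1) = _ := φ.totalLaw.flip E.1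
    simp only [fiber_comp_val, Category.assoc] at h ⊢
    rw [fiberLaw₂_fac, φ.map.fiber_map_ofFiber, P.fiberC_fac, ← φ.map.ofFiber_map,
      reassoc_of% φ.fiberLaw₂_fac E, reassoc_of% φ.map.fiberC_zero₂ E, h]

/-- The common codomain maps by a chosen lift of F f followed by F'ζ, a cartesian composite into
F'T'E. Against it both sides reduce to the lift of zero, β' and F'T' of the chosen lift of f. -/
theorem fiberLaw_coherence (f : A ⟶ A') (E : P.proj.Fiber A') :
    φ.fiberLawApp ((P.sub f).obj E) ≫ (φ.map.fiber A).map (P.subLawIso f E).hom ≫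
        (φ.map.distIso f ((P.fiberT A').obj E)).hom =
      (Q.fiberT _).map (φ.map.distIso f E).hom ≫
        (Q.subLawIso (φ.map.base.map f) ((φ.map.fiber A').obj E)).hom ≫
          (Q.sub (φ.map.base.map f)).map (φ.fiberLawApp E) := by
  refine ((Q.isCart_subLift (φ.map.base.map f) _).comp
    (φ.isCart_ofFiber_zeroLift E)).fiber_ext ?_
  simp only [fiber_comp_val, Category.assoc]
  rw [reassoc_of% Q.subLift_naturality (φ.map.base.map f) (φ.fiberLawApp E), fiberLaw_fac,
    reassoc_of% φ.map.dist_fac f ((P.fiberT A').obj E),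
    φ.map.between_ofFiber (P.subLift f ((P.fiberT A').obj E)) (P.zeroLift E)]
  have h := φ.map.dist_subLaw_fac f E
  rw [FibrationMap.subZero] at h
  rw [reassoc_of% h]
  change _ ≫ _ ≫ φ.map.ofFiber (P.subZeroLift f E) = _
  rw [φ.map.fiber_map_ofFiber, P.subLaw_fac, ← φ.map.ofFiber_map,
    reassoc_of% φ.fiberLaw_fac ((P.sub f).obj E), law_naturality]

/-- The induced colax morphism of indexed tangent categories. -/
noncomputable def indexed (hF : PreservesTangentLimits φ.map.base) :
    ColaxIndexedHom P.fibreStr.indexed Q.fibreStr.indexed where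
  base := φ.map.base
  fib := φ.map.fiber
  dist := φ.map.dist
  baseLaw := φ.baseLaw
  fibLaw := φ.fiberLaw hF
  coherence f E := φ.fiberLaw_coherence f E

theorem induces_indexed (hF : PreservesTangentLimits φ.map.base) :
    φ.Induces P.fibreStr Q.fibreStr (φ.indexed hF) :=
  ⟨φ.map.dist, φ.fiberLaw hF, _, rfl, φ.map.isDistributors_dist, fun _ E => φ.fiberLaw_fac E⟩

/-- The mirror image of the lax case: ζ at F'E followed by the invertible β' is cartesian over F(z),
as is F'ζ. -/
theorem isIso_fiberLawApp (h : IsIso φ.totalLaw.β) (E : P.proj.Fiber A) :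
    IsIso (φ.fiberLawApp E) := by
  refine isIso_fiber (φ.map.isCartesian_ofFiber (P.isCartesian_zeroLift E)) _ ?_
  have h₁ := φ.isHomLift_law E
  have h₂ : Q.proj.IsStronglyCartesian (φ.baseLaw.β.app A) (φ.totalLaw.β.app E.1) := inferInstance
  exact isCartesian_congr (isCartesian_comp (φ.map.isCartesian_zero E) h₂) (φ.base_zero A)
    (φ.fiberLaw_fac E).symm

theorem fiberLaw_isStrong (h : φ.baseLaw.IsStrong) (h' : φ.totalLaw.IsStrong) (A : P.base) :
    (φ.fiberLaw h.2 A).IsStrong := by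
  refine ⟨?_, φ.map.preservesTangentLimits_fiber h.2 h'.2 A⟩
  have : ∀ E, IsIso ((φ.fiberLaw h.2 A).β.app E) := fun E => φ.isIso_fiberLawApp h'.1 E
  exact NatIso.isIso_of_isIso_app _

theorem fiberLaw_isStrict (h : φ.baseLaw.IsStrict) (h' : φ.totalLaw.IsStrict)
    (hz : TNGFIBco.zeroCloven φ) (A : P.base) : (φ.fiberLaw h.2 A).IsStrict := by
  have hs := φ.fiberLaw_isStrong h.isStrong h'.isStrong A
  refine ⟨exists_eq_eqToHom _ hs.1 fun E => ?_, hs.2⟩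
  obtain ⟨e, he⟩ := hz A E
  have e' : (Q.fiberT _).obj ((φ.map.fiber A).obj E) =
    (φ.map.fiber A).obj ((P.fiberT A).obj E) := Subtype.ext e
  refine ⟨e', (φ.isCart_ofFiber_zeroLift E).fiber_ext ?_⟩
  refine (φ.fiberLaw_fac E).trans (he.trans ?_)
  erw [fiber_eqToHom_val e' e]
  rfl

end ColaxHom

/-! ## Functoriality -/

section Functoriality

variable {P Q R : TangentFibration.{v₁, u₁, v₂, u₂}}

theorem FibrationMap.dist_id_app {A A' : P.base} (f : A ⟶ A') (E : P.proj.Fiber A') :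
    ((FibrationMap.id P).distIso f E).hom = 𝟙 ((P.sub f).obj E) := by
  refine (P.isCart_subLift f E).fiber_ext ?_
  refine ((FibrationMap.id P).dist_fac f E).trans ?_
  exact (Category.id_comp _).symm

/-- Distributors are determined by their composites with chosen lifts, and both sides give the image
of the chosen lift of f under the two total functors. -/
theorem FibrationMap.dist_comp_app (m : FibrationMap P Q) (n : FibrationMap Q R) {A A' : P.base}
    (f : A ⟶ A') (E : P.proj.Fiber A') :
    ((m.comp n).distIso f E).hom = (n.fiber _).map (m.distIso f E).hom ≫
      (n.distIso (m.base.map f) ((m.fiber A').obj E)).hom := by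
  refine (R.isCart_subLift (n.base.map (m.base.map f))
    ((n.fiber _).obj ((m.fiber A').obj E))).fiber_ext ?_
  have h : ((n.fiber _).map (m.distIso f E).hom).1 ≫
      (n.distIso (m.base.map f) ((m.fiber A').obj E)).hom.1 ≫
        R.subLift (n.base.map (m.base.map f)) ((n.fiber _).obj ((m.fiber A').obj E)) =
      n.between (m.between (P.subLift f E)) := by
    rw [n.dist_fac, n.fiber_map_val, n.between_between, m.dist_fac]
  exact ((m.comp n).dist_fac f E).trans ((Category.assoc _ _ _).trans h).symm

theorem LaxHom.fiberLawApp_id {A : P.base} (E : P.proj.Fiber A) :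
    LaxHom.fiberLawApp (𝟙 (show TNGFIB.{v₁, u₁, v₂, u₂} from P)) E =
      𝟙 ((P.fiberT A).obj E) := by
  refine (P.isCart_zeroLift E).fiber_ext ?_
  refine (LaxHom.fiberLaw_fac (𝟙 (show TNGFIB.{v₁, u₁, v₂, u₂} from P)) E).trans ?_
  exact (Category.comp_id _).trans (Category.id_comp _).symm

/-- After ζ both sides become the image of ζ under the composite functor followed by the composite
of the two total laws. -/
theorem LaxHom.fiberLawApp_comp (φ : LaxHom P Q) (ψ : LaxHom Q R) {A : P.base}
    (E : P.proj.Fiber A) :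
    LaxHom.fiberLawApp (CategoryStruct.comp (obj := TNGFIB) φ ψ) E =
      (ψ.map.fiber _).map (φ.fiberLawApp E) ≫ ψ.fiberLawApp ((φ.map.fiber A).obj E) := by
  refine (ψ.map.isCart_zero ((φ.map.fiber A).obj E)).fiber_ext ?_
  have h : ((ψ.map.fiber _).map (φ.fiberLawApp E)).1 ≫
      (ψ.fiberLawApp ((φ.map.fiber A).obj E)).1 ≫ ψ.map.zero ((φ.map.fiber A).obj E) =
      ψ.map.ofFiber ((φ.fiberLawApp E).1 ≫ Q.zeroLift ((φ.map.fiber A).obj E)) ≫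
        ψ.totalLaw.α.app ((φ.map.fiber A).obj E).1 := by
    rw [ψ.fiberLaw_fac,
      reassoc_of% ψ.map.fiber_map_ofFiber (φ.fiberLawApp E) (Q.zeroLift ((φ.map.fiber A).obj E))]
  have h' : ψ.map.ofFiber ((φ.fiberLawApp E).1 ≫ Q.zeroLift ((φ.map.fiber A).obj E)) =
      ψ.map.ofFiber (φ.map.ofFiber (P.zeroLift E)) ≫ ψ.map.total.map (φ.totalLaw.α.app E.1) :=
    (congrArg ψ.map.total.map (φ.fiberLaw_fac E)).trans (ψ.map.total.map_comp _ _)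
  rw [h'] at h
  exact (LaxHom.fiberLaw_fac (CategoryStruct.comp (obj := TNGFIB) φ ψ) E).trans
    ((Category.assoc _ _ _).trans (h.trans (Category.assoc _ _ _))).symm

theorem ColaxHom.fiberLawApp_id {A : P.base} (E : P.proj.Fiber A) :
    ColaxHom.fiberLawApp (𝟙 (show TNGFIBco.{v₁, u₁, v₂, u₂} from P)) E =
      𝟙 ((P.fiberT A).obj E) := by
  refine (P.isCart_zeroLift E).fiber_ext ?_
  refine (ColaxHom.fiberLaw_fac (𝟙 (show TNGFIBco.{v₁, u₁, v₂, u₂} from P)) E).trans ?_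
  exact (Category.comp_id _).trans (Category.id_comp _).symm

theorem ColaxHom.fiberLawApp_comp (φ : ColaxHom P Q) (ψ : ColaxHom Q R) {A : P.base}
    (E : P.proj.Fiber A) :
    ColaxHom.fiberLawApp (CategoryStruct.comp (obj := TNGFIBco) φ ψ) E =
      ψ.fiberLawApp ((φ.map.fiber A).obj E) ≫ (ψ.map.fiber _).map (φ.fiberLawApp E) := by
  refine (ColaxHom.isCart_ofFiber_zeroLift
    (CategoryStruct.comp (obj := TNGFIBco) φ ψ) E).fiber_ext ?_
  have h' : ψ.map.ofFiber ((φ.fiberLawApp E).1 ≫ φ.map.ofFiber (P.zeroLift E)) =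
      ψ.map.ofFiber (Q.zeroLift ((φ.map.fiber A).obj E)) ≫
        ψ.map.total.map (φ.totalLaw.β.app E.1) :=
    (congrArg ψ.map.total.map (φ.fiberLaw_fac E)).trans (ψ.map.total.map_comp _ _)
  have h : (ψ.fiberLawApp ((φ.map.fiber A).obj E)).1 ≫
      ((ψ.map.fiber _).map (φ.fiberLawApp E)).1 ≫ ψ.map.ofFiber (φ.map.ofFiber (P.zeroLift E)) =
      ψ.map.zero ((φ.map.fiber A).obj E) ≫ ψ.totalLaw.β.app ((φ.map.fiber A).obj E).1 ≫
        ψ.map.total.map (φ.totalLaw.β.app E.1) := by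
    rw [ψ.map.fiber_map_ofFiber (φ.fiberLawApp E) (φ.map.ofFiber (P.zeroLift E)), h',
      reassoc_of% ψ.fiberLaw_fac ((φ.map.fiber A).obj E)]
  exact (ColaxHom.fiberLaw_fac (CategoryStruct.comp (obj := TNGFIBco) φ ψ) E).trans
    ((Category.assoc _ _ _).trans h).symm

end Functoriality

/-- The functor sending tangent fibrations to their indexed tangent categories, on lax
morphisms. -/
noncomputable def indexedFunctor : WideSubcategory TNGFIB.strb.{v₁, u₁, v₂, u₂} ⥤
    WideSubcategory INDXTNG.strb.{v₁, u₁, v₂, u₂} where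
  obj P := ⟨(TangentFibration.fibreStr P.obj).indexed⟩
  map φ := ⟨LaxHom.indexed φ.hom, φ.property⟩
  map_id P := by
    apply WideSubcategory.hom_ext
    exact LaxIndexedHom.mk_congr (I := (TangentFibration.fibreStr P.obj).indexed)
      (J := (TangentFibration.fibreStr P.obj).indexed)
      (fun A A' f E => FibrationMap.dist_id_app f E) rfl
      (fun A => LaxLaw.ext (NatTrans.ext (funext fun E => LaxHom.fiberLawApp_id E))) _ _
  map_comp {P Q R} φ ψ := by
    apply WideSubcategory.hom_ext
    exact LaxIndexedHom.mk_congr (I := (TangentFibration.fibreStr P.obj).indexed)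
      (J := (TangentFibration.fibreStr R.obj).indexed)
      (fun A A' f E => FibrationMap.dist_comp_app (LaxHom.map φ.hom) (LaxHom.map ψ.hom) f E) rfl
      (fun A => LaxLaw.ext (NatTrans.ext (funext fun E =>
        LaxHom.fiberLawApp_comp φ.hom ψ.hom E))) _ _

/-- The functor sending tangent fibrations to their indexed tangent categories, on colax
morphisms. -/
noncomputable def indexedFunctorCo : WideSubcategory TNGFIBco.strb.{v₁, u₁, v₂, u₂} ⥤
    WideSubcategory INDXTNGco.strb.{v₁, u₁, v₂, u₂} where
  obj P := ⟨(TangentFibration.fibreStr P.obj).indexed⟩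
  -- Strictness on the base includes preservation of tangent limits by F, which the construction of
  -- the colax laws on the fibres requires.
  map φ := ⟨ColaxHom.indexed φ.hom φ.property.2, φ.property⟩
  map_id P := by
    apply WideSubcategory.hom_ext
    exact ColaxIndexedHom.mk_congr (I := (TangentFibration.fibreStr P.obj).indexed)
      (J := (TangentFibration.fibreStr P.obj).indexed)
      (fun A A' f E => FibrationMap.dist_id_app f E) rfl
      (fun A => ColaxLaw.ext (NatTrans.ext (funext fun E => ColaxHom.fiberLawApp_id E))) _ _
  map_comp {P Q R} φ ψ := by
    apply WideSubcategory.hom_ext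
    exact ColaxIndexedHom.mk_congr (I := (TangentFibration.fibreStr P.obj).indexed)
      (J := (TangentFibration.fibreStr R.obj).indexed)
      (fun A A' f E => FibrationMap.dist_comp_app (ColaxHom.map φ.hom) (ColaxHom.map ψ.hom) f E)
      rfl
      (fun A => ColaxLaw.ext (NatTrans.ext (funext fun E =>
        ColaxHom.fiberLawApp_comp φ.hom ψ.hom E))) _ _

end TangentTheory

/-! ### The proposition -/

theorem mainTheorem12 :
    ∃ cc : ∀ P : TangentFibration.{v₁, u₁, v₂, u₂}, FibreStr P,
      (∃ (I : WideSubcategory TNGFIB.strb.{v₁, u₁, v₂, u₂} ⥤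
            WideSubcategory INDXTNG.strb.{v₁, u₁, v₂, u₂})
          (hI : ∀ P : WideSubcategory TNGFIB.strb, I.obj P = ⟨(cc P.obj).indexed⟩),
        ∀ {P Q : WideSubcategory TNGFIB.strb} (φ : P ⟶ Q),
          LaxHom.Induces φ.hom (cc P.obj) (cc Q.obj)
            (eqToHom (hI P).symm ≫ I.map φ ≫ eqToHom (hI Q)).hom ∧
          (TNGFIB.strong φ.hom → INDXTNG.strong (I.map φ).hom) ∧
          (TNGFIB.strict φ.hom → TNGFIB.zeroCloven φ.hom → INDXTNG.strict (I.map φ).hom)) ∧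
      (∃ (I : WideSubcategory TNGFIBco.strb.{v₁, u₁, v₂, u₂} ⥤
            WideSubcategory INDXTNGco.strb.{v₁, u₁, v₂, u₂})
          (hI : ∀ P : WideSubcategory TNGFIBco.strb, I.obj P = ⟨(cc P.obj).indexed⟩),
        ∀ {P Q : WideSubcategory TNGFIBco.strb} (φ : P ⟶ Q),
          ColaxHom.Induces φ.hom (cc P.obj) (cc Q.obj)
            (eqToHom (hI P).symm ≫ I.map φ ≫ eqToHom (hI Q)).hom ∧
          (TNGFIBco.exact φ.hom → INDXTNGco.exact (I.map φ).hom) ∧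
          (TNGFIBco.strong φ.hom → INDXTNGco.strong (I.map φ).hom) ∧
          (TNGFIBco.strict φ.hom → TNGFIBco.zeroCloven φ.hom →
            INDXTNGco.strict (I.map φ).hom)) := by
  refine ⟨fun P => P.fibreStr, ⟨indexedFunctor, fun _ => rfl, fun φ => ⟨?_, ?_, ?_⟩⟩,
    ⟨indexedFunctorCo, fun _ => rfl, fun φ => ⟨?_, ?_, ?_, ?_⟩⟩⟩
  -- The functor takes the prescribed values on objects by definition, so the transports around its
  -- value on φ are identities.
  · have h : eqToHom rfl ≫ indexedFunctor.map φ ≫ eqToHom rfl = indexedFunctor.map φ :=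
      (Category.id_comp _).trans (Category.comp_id _)
    exact (congrArg (fun ψ => LaxHom.Induces φ.hom _ _ ψ.hom) h).mpr
      (LaxHom.induces_indexed φ.hom)
  · exact fun h => ⟨h.1, fun A => LaxHom.fiberLaw_isStrong φ.hom h.1 h.2 A⟩
  · exact fun h hz => ⟨h.1, fun A => LaxHom.fiberLaw_isStrict φ.hom h.1 h.2 hz A⟩
  · have h : eqToHom rfl ≫ indexedFunctorCo.map φ ≫ eqToHom rfl = indexedFunctorCo.map φ :=
      (Category.id_comp _).trans (Category.comp_id _)
    exact (congrArg (fun ψ => ColaxHom.Induces φ.hom _ _ ψ.hom) h).mpr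
      (ColaxHom.induces_indexed φ.hom φ.property.2)
  -- Preservation of limits by the fibre functors concerns only the underlying morphism of
  -- fibrations; no invertibility of the laws enters.
  · exact fun h => ⟨h.1, fun A => (ColaxHom.map φ.hom).preservesTangentLimits_fiber h.1 h.2 A⟩
  · exact fun h => ⟨h.1, fun A => ColaxHom.fiberLaw_isStrong φ.hom h.1 h.2 A⟩
  · exact fun h hz => ⟨h.1, fun A => ColaxHom.fiberLaw_isStrict φ.hom h.1 h.2 hz A⟩
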